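/- **Setting.** Let $D$ be a data set of $m$ elements $e=(e.\mathrm{key},e.\mathrm{val})$ with keys in a set $\mathcal X$ and values $e.\mathrm{val}>0$. The frequency of a key is $\nu_x=\sum_{e\in D,\,e.\mathrm{key}=x}e.\mathrm{val}$; put $\mathrm{SUM}_D=\sum_x\nu_x$ and $\mathrm{MIN}(D)=\min_{e\in D}e.\mathrm{val}$. Let $f:[0,\infty)\to[0,\infty)$ be soft concave sublinear, that is, $f(\nu)=\int_{(0,\infty)}(1-e^{-\nu t})\,a(dt)$ for a nonnegative measure $a$ on $(0,\infty)$ (a density $a(t)\,dt$, possibly with point masses). For $0<\gamma\le\infty$ write $A(\gamma)=\int_{[\gamma,\infty)}a(dt)$ and $B(\gamma)=\int_{(0,\gamma)}t\,a(dt)$. Let $k\ge 3$ be an integer, $0<\varepsilon\le\frac12$, and $r=\lceil k/\varepsilon\rceil$. A *bottom-$k$ structure* holds at most $k$ key-value pairs with distinct keys. To process $(x,v)$, it replaces the value of $x$ by the minimum of $v$ and that value if $x$ is present, and otherwise inserts $(x,v)$ and, if it now holds $k+1$ pairs, removes one of maximum value. Merging two structures keeps the (at most) $k$ pairs of lowest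 value in their union, with the lower value for a common key. **The sketch.** It consists of two bottom-$k$ structures (PPSWOR and SumMax), a number $\mathrm{sum}$, a threshold $\gamma$, and a set SideLine of elements with distinct keys in $\mathcal X\times[r]$. Initially the structures are empty, $\mathrm{sum}=0$ and $\gamma=\infty$. A hash function $h$ with independent values $h(x,i)\sim\mathrm{Exp}[1]$ is shared by all sketches; "SumMax processes $((x,i),w)$" means that the SumMax bottom-$k$ structure processes $(x,h(x,i)/w)$. * *Process $e$:* draw $v\sim\mathrm{Exp}[e.\mathrm{val}]$ and let PPSWOR process $(e.\mathrm{key},v)$; add $e.\mathrm{val}$ to $\mathrm{sum}$; set $\gamma=2\varepsilon/\mathrm{sum}$; for each $i\in[r]$ draw $y_i\sim\mathrm{Exp}[e.\mathrm{val}]$ and add $((e.\mathrm{key},i),y_i)$ to SideLine (keeping the minimum value if the key is present). Then remove from SideLine each element $g$ with $g.\mathrm{val}\ge\gamma$, and let SumMax process $(g.\mathrm{key},A(g.\mathrm{val}))$ if $A(g.\mathrm{val})>0$. * *Merge two sketches:* add the sums, set $\gamma=2\varepsilon/\mathrm{sum}$ ($\infty$ if $\mathrm{sum}=0$), merge the SideLines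 (minimum value for a common key) and the two pairs of bottom-$k$ structures, and then remove elements from SideLine as above. * *Final sample:* if $A(\gamma)>0$, SumMax processes $(z,A(\gamma))$ for each key $z$ in SideLine. Multiply all SumMax values by $r$. If $B(\gamma)>0$, divide all PPSWOR values by $B(\gamma)$ and output the bottom-$k$ merge of the two structures; otherwise output the SumMax structure. The values in the output are called seeds. All random draws are independent. Below, $\gamma=2\varepsilon/\mathrm{SUM}_D$ is the final threshold ($\infty$ if $D$ is empty), and $M_{x,i}$ is the minimum value $y_i$ drawn for an element with key $x$ ($\infty$ if there is none). The seed $\mathrm{seed}(x)\in[0,\infty]$ is the minimum of all values $r\,h(x,i)/A(\max\{\gamma,M_{x,i}\})$ with positive denominator and, if $B(\gamma)>0$, of all values $v/B(\gamma)$ with $v$ drawn by PPSWOR for an element with key $x$ ($\infty$ if there are no such values). **Theorem.** There is an absolute constant $C>0$ such that the following holds for all $k,\varepsilon,f,a,D$ as above. 1. For every computation by initializations, processing steps and merges (any merge tree) that processes each element of $D$ exactly once, the output is a stochastic PPSWOR sample with weights $V_x=\frac1r\sum_{i=1}^rA(\max\{\gamma,M_{x,i}\})+\nu_xB(\gamma)$.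 That is: for some $T>0$, each $V_x$ is a finite sum of random variables with values in $[0,T]$, all of which (over all keys) are independent; conditioned on the weights, the seeds are independent with $\mathrm{seed}(x)\sim\mathrm{Exp}[V_x]$ ($\mathrm{seed}(x)=\infty$ if $V_x=0$); and almost surely the output consists of the $k$ keys of lowest finite seed with their seeds (all keys with finite seed if there are fewer than $k$). The sample $S$ is the $k-1$ keys of lowest seed in the output (all of them if there are fewer), and $\tau$ is the $k$-th lowest seed ($\infty$ if there are fewer than $k$ finite seeds). 2. For every key $x$, $\ f(\nu_x)\le\mathsf E[V_x]\le\frac1{1-\varepsilon}f(\nu_x)$. 3. For every key $x$, the inverse-probability estimator $\widehat{f(\nu_x)}$, equal to $f(\nu_x)/\Pr[\mathrm{seed}(x)<\tau]$ if $x\in S$ (the probability being over the distribution of $\mathrm{seed}(x)$ with $\tau$ fixed) and to $0$ if $x\notin S$, is square integrable and unbiased, $\mathsf E[\widehat{f(\nu_x)}]=f(\nu_x)$, with $$\mathsf{Var}\bigl[\widehat{f(\nu_x)}\bigr]\le\frac{4f(\nu_x)\sum_{z\in\mathcal X}f(\nu_z)}{(1-\varepsilon)^2(k-2)} .$$ 4.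 Space is the number of words needed for the elements stored in SideLine and in the two bottom-$k$ structures and for $\mathrm{sum}$ and $\gamma$, measured after a completed processing step or merge. Every sketch computed from elements of $D$, each processed at most once, uses at most $Ck$ space in expectation. 5. If $m\ge1$, then for every $0<\delta<1$, with probability at least $1-\delta$, the space never exceeds $$C\Bigl(k+\min\Bigl\{\log m,\ \log\log\tfrac{\mathrm{SUM}_D}{\mathrm{MIN}(D)}\Bigr\}+\log\tfrac1\delta\Bigr)$$ at any time while the elements of $D$ are processed one after the other in a stream, where $\log\log q$ is read as $\log\max\{1,\log q\}$. -/

import Mathlib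

open MeasureTheory ProbabilityTheory
open scoped ENNReal NNReal

noncomputable section

namespace ConcaveSketch

/-! ### Soft concave sublinear functions -/

/-- `f : [0,∞) → [0,∞)` is the soft concave sublinear function with coefficients `a`:
`f ν = ∫_{(0,∞)} (1 - e^{-ν t}) a(dt)`. The coefficients form a nonnegative measure: a density
`a(t) dt` and point masses are both allowed. The equation is between values in `[0,∞]` while `f ν`
is real, so it includes the finiteness of the integral. Only the values of `f` on `[0,∞)` and the
restriction of `a` to `(0,∞)` matter. -/
def IsSoftConcaveSublinear (a : Measure ℝ) (f : ℝ → ℝ) : Prop :=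
  ∀ ν : ℝ, 0 ≤ ν → 0 ≤ f ν ∧
    ENNReal.ofReal (f ν) = ∫⁻ t in Set.Ioi 0, ENNReal.ofReal (1 - Real.exp (-(ν * t))) ∂a

/-- `A(γ) = ∫_γ^∞ a(t) dt`, for a threshold `γ ∈ (0,∞]`. -/
def tailMass (a : Measure ℝ) (γ : ℝ≥0∞) : ℝ :=
  (a {t : ℝ | 0 < t ∧ γ ≤ ENNReal.ofReal t}).toReal

/-- `B(γ) = ∫_0^γ t a(t) dt`. A point mass at `γ` is counted in `A(γ)`, not in `B(γ)`. -/
def headMoment (a : Measure ℝ) (γ : ℝ≥0∞) : ℝ :=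
  (∫⁻ t in {t : ℝ | 0 < t ∧ ENNReal.ofReal t < γ}, ENNReal.ofReal t ∂a).toReal

/-! ### Data -/

/-- A data element: a key and a value. -/
structure Element (𝒳 : Type*) where
  key : 𝒳
  val : ℝ

/-- The frequency `ν_x` of the key `x`: the sum of the values of the elements with key `x`. -/
def freq {𝒳 : Type*} [DecidableEq 𝒳] {m : ℕ} (D : Fin m → Element 𝒳) (x : 𝒳) : ℝ :=
  ∑ j with (D j).key = x, (D j).val

/-- The keys that appear in the data. All other keys have frequency `0`. -/
def activeKeys {𝒳 : Type*} [DecidableEq 𝒳] {m : ℕ} (D : Fin m → Element 𝒳) : Finset 𝒳 :=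
  Finset.univ.image fun j => (D j).key

/-- The sum of the values of all elements. -/
def sumVal {𝒳 : Type*} {m : ℕ} (D : Fin m → Element 𝒳) : ℝ := ∑ j, (D j).val

/-- The minimum value of an element. -/
def minVal {𝒳 : Type*} {m : ℕ} (D : Fin m → Element 𝒳) : ℝ := ⨅ j, (D j).val

/-! ### Sets of key-value pairs and the bottom-`k` structure -/

/-- A finite set of key-value pairs with at most one pair per key. The pairs are `(x, val x)` for
`x ∈ keys`; the other values of `val` are irrelevant. -/
structure Store (K : Type*) where
  keys : Finset K
  val : K → ℝ

namespace Store

variable {K : Type*} [DecidableEq K]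

def empty : Store K := ⟨∅, fun _ => 0⟩

/-- Add the pair `(x, v)`; if `x` is already present, its value becomes the minimum of the two. -/
def insertMin (s : Store K) (x : K) (v : ℝ) : Store K :=
  ⟨insert x s.keys, Function.update s.val x (if x ∈ s.keys then min (s.val x) v else v)⟩

/-- Union of two sets of pairs, with the smaller value for a key that is present in both. -/
def union (s₁ s₂ : Store K) : Store K :=
  ⟨s₁.keys ∪ s₂.keys, fun x =>
    if x ∈ s₁.keys then (if x ∈ s₂.keys then min (s₁.val x) (s₂.val x) else s₁.val x)
    else s₂.val x⟩

/-- Remove a pair of maximum value. -/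
def removeMax (s : Store K) : Store K :=
  if h : s.keys.Nonempty then
    ⟨s.keys.erase (Classical.choose (s.keys.exists_max_image s.val h)), s.val⟩
  else s

/-- The (at most) `k` pairs of lowest values. -/
def trim (k : ℕ) (s : Store K) : Store K := removeMax^[s.keys.card - k] s

/-- Process the element `(x, v)` into a bottom-`k` structure. -/
def processBottomK (k : ℕ) (s : Store K) (x : K) (v : ℝ) : Store K :=
  if x ∈ s.keys then s.insertMin x v
  else if (s.insertMin x v).keys.card = k + 1 then (s.insertMin x v).removeMax
  else s.insertMin x v

/-- Merge two bottom-`k` structures. -/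
def mergeBottomK (k : ℕ) (s₁ s₂ : Store K) : Store K := (s₁.union s₂).trim k

/-- Multiply all values by `c`. -/
def scale (c : ℝ) (s : Store K) : Store K := ⟨s.keys, fun x => c * s.val x⟩

end Store

/-- Process the element `(z, w)` with structured key `z = (primary key, secondary key)` into a
SumMax sketch of size `k` with hash function `h`: the bottom-`k` structure processes
`(z.p, h(z) / w)`. -/
def sumMaxProcess {𝒳 : Type*} [DecidableEq 𝒳] {r : ℕ} (k : ℕ) (h : 𝒳 × Fin r → ℝ)
    (s : Store 𝒳) (z : 𝒳 × Fin r) (w : ℝ) : Store 𝒳 :=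
  s.processBottomK k z.1 (h z / w)

/-! ### The sampling sketch for `f` -/

/-- The sketch structure. The hash function of the SumMax part is shared by all sketches and is
given to the operations as an argument. -/
structure Sketch (𝒳 : Type*) (r : ℕ) where
  summax : Store 𝒳
  ppswor : Store 𝒳
  sum : ℝ
  γ : ℝ≥0∞
  sideline : Store (𝒳 × Fin r)

/-- The threshold `2 ε / σ`, which is `∞` for `σ = 0`. -/
def threshold (ε σ : ℝ) : ℝ≥0∞ := ENNReal.ofReal (2 * ε) / ENNReal.ofReal σ

namespace Sketch

variable {𝒳 : Type*} [DecidableEq 𝒳] {r : ℕ}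

/-- The empty sketch. -/
def init : Sketch 𝒳 r := ⟨Store.empty, Store.empty, 0, ∞, Store.empty⟩

/-- The elements of SideLine whose value is at least `γ`. -/
def overflow (s : Sketch 𝒳 r) : Finset (𝒳 × Fin r) :=
  {z ∈ s.sideline.keys | s.γ ≤ ENNReal.ofReal (s.sideline.val z)}

/-- Remove every element `g` with `g.val ≥ γ` from SideLine, and let the SumMax sketch process
`(g.key, A(g.val))` if `A(g.val) > 0`. -/
def flush (k : ℕ) (a : Measure ℝ) (h : 𝒳 × Fin r → ℝ) (s : Sketch 𝒳 r) : Sketch 𝒳 r :=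
  { s with
    sideline := ⟨s.sideline.keys \ s.overflow, s.sideline.val⟩
    summax := s.overflow.toList.foldl
      (fun t z =>
        if 0 < tailMass a (ENNReal.ofReal (s.sideline.val z)) then
          sumMaxProcess k h t z (tailMass a (ENNReal.ofReal (s.sideline.val z)))
        else t)
      s.summax }

/-- Process the element `e`. Here `v ∼ Exp[e.val]` is the value drawn by the PPSWOR sketch, and
`y i ∼ Exp[e.val]`, for `i ∈ [r]`, are the values of the `r` output elements. -/
def process (k : ℕ) (ε : ℝ) (a : Measure ℝ) (h : 𝒳 × Fin r → ℝ) (s : Sketch 𝒳 r)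
    (e : Element 𝒳) (v : ℝ) (y : Fin r → ℝ) : Sketch 𝒳 r :=
  flush k a h
    { summax := s.summax
      ppswor := s.ppswor.processBottomK k e.key v
      sum := s.sum + e.val
      γ := threshold ε (s.sum + e.val)
      sideline := (List.finRange r).foldl (fun t i => t.insertMin (e.key, i) (y i)) s.sideline }

/-- Merge two sketches. -/
def merge (k : ℕ) (ε : ℝ) (a : Measure ℝ) (h : 𝒳 × Fin r → ℝ) (s₁ s₂ : Sketch 𝒳 r) :
    Sketch 𝒳 r :=
  flush k a h
    { summax := s₁.summax.mergeBottomK k s₂.summax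
      ppswor := s₁.ppswor.mergeBottomK k s₂.ppswor
      sum := s₁.sum + s₂.sum
      γ := threshold ε (s₁.sum + s₂.sum)
      sideline := s₁.sideline.union s₂.sideline }

/-- The sample of (at most) `k` key-seed pairs that is produced from the sketch `s`. -/
def finalSample (k : ℕ) (a : Measure ℝ) (h : 𝒳 × Fin r → ℝ) (s : Sketch 𝒳 r) : Store 𝒳 :=
  let sm : Store 𝒳 :=
    if 0 < tailMass a s.γ then
      s.sideline.keys.toList.foldl (fun t z => sumMaxProcess k h t z (tailMass a s.γ)) s.summax
    else s.summax
  if 0 < headMoment a s.γ then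
    (sm.scale r).mergeBottomK k (s.ppswor.scale (headMoment a s.γ)⁻¹)
  else sm.scale r

/-- The space used by the sketch in words: three words for an element `((key, i), value)` of
SideLine, two words for a key-value pair of a bottom-`k` structure, and two words for the
numbers `sum` and `γ`. -/
def space (s : Sketch 𝒳 r) : ℕ :=
  3 * s.sideline.keys.card + 2 * s.summax.keys.card + 2 * s.ppswor.keys.card + 2

end Sketch

/-! ### Randomness and computations -/

/-- The random draws used on the data elements `j : Fin m`: the value drawn for `j` by the PPSWOR
sketch, the value of the `i`-th output element of `j`, and the hash of the output key `(x, i)`. -/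
inductive Draw (𝒳 : Type*) (m r : ℕ) where
  | ppswor (j : Fin m) : Draw 𝒳 m r
  | output (j : Fin m) (i : Fin r) : Draw 𝒳 m r
  | hash (x : 𝒳) (i : Fin r) : Draw 𝒳 m r

/-- The parameter of the exponential distribution of a draw. -/
def Draw.rate {𝒳 : Type*} {m r : ℕ} (D : Fin m → Element 𝒳) : Draw 𝒳 m r → ℝ
  | .ppswor j => (D j).val
  | .output j _ => (D j).val
  | .hash _ _ => 1

/-- `U` is a family of independent exponential random variables, one for each draw, with the
prescribed parameters. -/
structure IsRandomness {𝒳 : Type*} {m r : ℕ} {Ω : Type*} [MeasurableSpace Ω] (P : Measure Ω)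
    (D : Fin m → Element 𝒳) (U : Draw 𝒳 m r → Ω → ℝ) : Prop where
  measurable : ∀ d, Measurable (U d)
  law : ∀ d, P.map (U d) = expMeasure (d.rate D)
  indep : iIndepFun U P

/-- A (streamed or distributed) computation of a sketch of data elements indexed by `Fin m`. -/
inductive Plan (m : ℕ) where
  | init : Plan m
  | process (p : Plan m) (j : Fin m) : Plan m
  | merge (p q : Plan m) : Plan m

namespace Plan

variable {m : ℕ}

/-- The elements processed in a computation, with repetitions. -/
def elements : Plan m → List (Fin m)
  | init => []
  | process p j => p.elements ++ [j]
  | merge p q => p.elements ++ q.elements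

/-- The streaming computation that has processed the first `n` elements in order. -/
def stream (m n : ℕ) : Plan m := ((List.finRange m).take n).foldl Plan.process Plan.init

variable {𝒳 : Type*} [DecidableEq 𝒳] {r : ℕ}

/-- The sketch that a computation produces when the outcomes of the draws are `u`. -/
def run (k : ℕ) (ε : ℝ) (a : Measure ℝ) (D : Fin m → Element 𝒳) (u : Draw 𝒳 m r → ℝ) :
    Plan m → Sketch 𝒳 r
  | init => Sketch.init
  | process p j => (run k ε a D u p).process k ε a (fun z => u (.hash z.1 z.2)) (D j)
      (u (.ppswor j)) (fun i => u (.output j i))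
  | merge p q => (run k ε a D u p).merge k ε a (fun z => u (.hash z.1 z.2)) (run k ε a D u q)

/-- The sample produced from the sketch of a computation. -/
def sample (k : ℕ) (ε : ℝ) (a : Measure ℝ) (D : Fin m → Element 𝒳) (u : Draw 𝒳 m r → ℝ)
    (p : Plan m) : Store 𝒳 :=
  (run k ε a D u p).finalSample k a (fun z => u (.hash z.1 z.2))

end Plan

/-! ### Seeds and weights of the keys -/

section Seeds

variable {𝒳 : Type*} [DecidableEq 𝒳] {m r : ℕ}

/-- `M_{x,i}`: the minimum value generated with key `(x, i)` (`∞` if there is none). -/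
def minOutput (D : Fin m → Element 𝒳) (u : Draw 𝒳 m r → ℝ) (x : 𝒳) (i : Fin r) : ℝ≥0∞ :=
  ⨅ j, ⨅ (_ : (D j).key = x), ENNReal.ofReal (u (.output j i))

/-- `Max_E((x,i)) = A(max{γ, M_{x,i}})`: the maximum value of an element with key `(x, i)` that is
passed on to the SumMax sketch, where `γ` is the final threshold (`0` if there is none). -/
def maxPassed (ε : ℝ) (a : Measure ℝ) (D : Fin m → Element 𝒳) (u : Draw 𝒳 m r → ℝ) (x : 𝒳)
    (i : Fin r) : ℝ :=
  tailMass a (max (threshold ε (sumVal D)) (minOutput D u x i))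

/-- The random weight `V_x = (1/r) SumMax_E(x) + ν_x B(γ)`. -/
def weight (ε : ℝ) (a : Measure ℝ) (D : Fin m → Element 𝒳) (u : Draw 𝒳 m r → ℝ) (x : 𝒳) : ℝ :=
  (∑ i, maxPassed ε a D u x i) / r + freq D x * headMoment a (threshold ε (sumVal D))

/-- The seed of `x` (`∞` if no value is generated for `x`): the minimum of its seed in the SumMax
part, multiplied by `r`, and its seed in the PPSWOR part, divided by `B(γ)`. -/
def seed (ε : ℝ) (a : Measure ℝ) (D : Fin m → Element 𝒳) (u : Draw 𝒳 m r → ℝ) (x : 𝒳) : ℝ≥0∞ :=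
  min
    (⨅ i, ⨅ (_ : 0 < maxPassed ε a D u x i),
      ENNReal.ofReal (r * (u (.hash x i) / maxPassed ε a D u x i)))
    (⨅ j, ⨅ (_ : (D j).key = x), ⨅ (_ : 0 < headMoment a (threshold ε (sumVal D))),
      ENNReal.ofReal (u (.ppswor j) / headMoment a (threshold ε (sumVal D))))

end Seeds

/-! ### Stochastic PPSWOR samples and inverse-probability estimators -/

section Sampling

variable {𝒳 : Type*} {Ω : Type*} [MeasurableSpace Ω]

/-- The seeds are those of stochastic PPSWOR sampling with random weights `V_x`: each `V_x` is the
sum of finitely many random variables with values in `[0,T]`, all of them (over all keys)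
independent; and conditioned on the weights, the seeds are independent with
`seed(x) ∼ Exp[V_x]` (`seed(x) = ∞` if `V_x = 0`), that is,
`Pr[seed(x) > t_x for all x ∈ F | weights] = ∏_{x ∈ F} exp(-V_x t_x)`. -/
def IsStochasticPPSWOR (P : Measure Ω) (V : 𝒳 → Ω → ℝ) (seed : 𝒳 → Ω → ℝ≥0∞) : Prop :=
  (∃ (T : ℝ) (n : 𝒳 → ℕ) (S : (Σ x, Fin (n x)) → Ω → ℝ),
    0 < T ∧ (∀ q, Measurable (S q)) ∧ iIndepFun S P ∧ (∀ q ω, S q ω ∈ Set.Icc 0 T) ∧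
    ∀ x ω, V x ω = ∑ i : Fin (n x), S ⟨x, i⟩ ω) ∧
  (∀ x, Measurable (seed x)) ∧
  ∀ (F : Finset 𝒳) (t : 𝒳 → ℝ≥0),
    P⟦{ω | ∀ x ∈ F, (t x : ℝ≥0∞) < seed x ω} | ⨆ x, MeasurableSpace.comap (V x) inferInstance⟧
      =ᵐ[P] fun ω => ∏ x ∈ F, Real.exp (-(V x ω * t x))

/-- `s` consists of the `k` keys with lowest seeds and their seeds (of all the keys with finite
seed, if there are fewer than `k` of them). -/
def IsBottomK (k : ℕ) (seed : 𝒳 → ℝ≥0∞) (s : Store 𝒳) : Prop :=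
  (∀ x, x ∈ s.keys ↔ seed x < ∞ ∧ {z | seed z < seed x}.encard < k) ∧
  ∀ x ∈ s.keys, ENNReal.ofReal (s.val x) = seed x

/-- The inclusion threshold `τ`: the `k`-th lowest seed (`∞` if there are fewer than `k`). -/
def inclusionThreshold (k : ℕ) (s : Store 𝒳) : ℝ≥0∞ :=
  if s.keys.card < k then ∞ else s.keys.sup fun x => ENNReal.ofReal (s.val x)

/-- The inverse-probability estimator of `w` for the key `x`, computed from a set `s` of `k`
key-seed pairs. The sample consists of the `k - 1` keys of lowest seed, and the estimate is
`w / Pr[seed(x) < τ]` for a key in the sample and `0` otherwise; the probability is over the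
distribution of `seed(x)`, with `τ` fixed. -/
def estimate [DecidableEq 𝒳] (P : Measure Ω) (k : ℕ) (w : ℝ) (seed : 𝒳 → Ω → ℝ≥0∞)
    (s : Store 𝒳) (x : 𝒳) : ℝ :=
  if x ∈ (s.trim (k - 1)).keys then
    w / P.real {ω | seed x ω < inclusionThreshold k s}
  else 0

/-- The inverse-probability estimator of `f(ν_x)` for the key `x`, computed from the sample that is
produced from the sketch of the computation `p`. -/
def Plan.estimator [DecidableEq 𝒳] {m r : ℕ} (P : Measure Ω) (k : ℕ) (ε : ℝ) (a : Measure ℝ)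
    (f : ℝ → ℝ) (D : Fin m → Element 𝒳) (U : Draw 𝒳 m r → Ω → ℝ) (p : Plan m) (x : 𝒳)
    (ω : Ω) : ℝ :=
  estimate P k (f (freq D x)) (fun z ω' => seed ε a D (fun d => U d ω') z)
    (p.sample k ε a D fun d => U d ω) x

end Sampling

end ConcaveSketch

end

open ConcaveSketch

/-! Fix the outcomes of all draws. A bottom-`k` structure stores the `k` lowest values of some
function on the keys, and merging two of them stores the `k` lowest values of the pointwise minimum
(`Store.Represents.merge`). For SideLine the point is that γ only decreases along a computation. A
value y that was passed on earlier is at least the final γ and at least the minimum M of its output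
key, so its weight A(y) is at most A(max γ M). The minimum itself is either passed on with weight
A(M), or is still pending and is passed on at the end with weight A(γ). So for every merge tree the
largest weight seen by SumMax is A(max γ M) (`PassSpec.combine`, `PassSpec.max_eq`), and the output
is the bottom-`k` of `seed` (`Plan.represents_sample`).

Given the output draws, seed(x) is a minimum of independent exponentials whose rates add up to V_x.
Integrating out the hash and PPSWOR draws one by one gives the conditional law
(`lintegral_mul_lt_seed`, `condExp_lt_seed`). Seeds of distinct keys use disjoint sets of draws.

Since M is exponential with rate ν_x, Tonelli shows that E A(max γ M) is exactly the part of the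
integral f(ν_x) over t ≥ γ. The part over t < γ is replaced by its linearization ν_x B(γ); there ν_x
t < 2ε, which costs a factor of at most 1/(1-ε).

For the variance, let τ be the (k-1)-th lowest seed of the other keys. It is independent of seed(x),
and the estimator of w = f(ν_x) is w/q(τ) on {seed(x) < τ}, where q(t) = Pr[seed(x) < t]; its
variance is w²(E[1/q(τ)] - 1). With W the sum of all f(ν_z), every random summand of V_x is at most
A(γ)/r ≤ W/k (`mul_tailMass_le_sum`), which gives 1/q(t) ≤ 1 + (W/k + 1/t)/E V_x
(`inv_measure_seed_lt_le`). A Chernoff bound on the number of seeds below t bounds E[1/τ].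

SideLine holds the output keys whose minimum is below 2ε/sum, at most 2εr ≤ 2k+1 in expectation.
Their indicators are independent, so Chernoff bounds apply. Along a stream a union bound runs over
the m times, or over the scales at which the running sum doubles. -/

noncomputable section

set_option linter.unusedSectionVars false

namespace ConcaveSketch

/-! ### Bottom-`k` structures and their merges -/

namespace Store

variable {K : Type*}

/-- The stored value of a key, which is `∞` for a key that is not present. -/
def value [DecidableEq K] (s : Store K) (x : K) : ℝ≥0∞ :=
  if x ∈ s.keys then ENNReal.ofReal (s.val x) else ∞

/-- `t` consists of `k` pairs of lowest value of `u`, or of all of them if there are fewer. -/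
structure IsTrim (k : ℕ) (u t : Store K) : Prop where
  subset : t.keys ⊆ u.keys
  val_eq : ∀ x ∈ t.keys, t.val x = u.val x
  card_eq : t.keys.card = min k u.keys.card
  le : ∀ y ∈ t.keys, ∀ x ∈ u.keys, x ∉ t.keys → u.val y ≤ u.val x

/-- `s` is a bottom-`k` structure for the pairs `(x, g x)` with `g x < ∞`. -/
structure Represents (k : ℕ) (s : Store K) (g : K → ℝ≥0∞) : Prop where
  val_eq : ∀ x ∈ s.keys, ENNReal.ofReal (s.val x) = g x
  card_le : s.keys.card ≤ k
  outside : ∀ x ∉ s.keys, g x = ∞ ∨ (s.keys.card = k ∧ ∀ y ∈ s.keys, g y ≤ g x)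

/-- `u` is the union of `s₁` and `s₂`, with the smaller value for a common key. -/
structure IsUnion (s₁ s₂ u : Store K) : Prop where
  mem_iff : ∀ x, x ∈ u.keys ↔ x ∈ s₁.keys ∨ x ∈ s₂.keys
  val_left : ∀ x, x ∈ s₁.keys → x ∉ s₂.keys → u.val x = s₁.val x
  val_right : ∀ x, x ∉ s₁.keys → x ∈ s₂.keys → u.val x = s₂.val x
  val_both : ∀ x, x ∈ s₁.keys → x ∈ s₂.keys → u.val x = min (s₁.val x) (s₂.val x)

lemma IsTrim.refl {k : ℕ} {u : Store K} (h : u.keys.card ≤ k) : IsTrim k u u :=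
  ⟨subset_rfl, fun _ _ => rfl, (min_eq_right h).symm, fun _ _ _ hx hx' => absurd hx hx'⟩

lemma IsTrim.trans {i j : ℕ} {u t t' : Store K} (h : IsTrim i u t) (h' : IsTrim j t t') :
    IsTrim (min j i) u t' where
  subset := h'.subset.trans h.subset
  val_eq x hx := (h'.val_eq x hx).trans (h.val_eq x (h'.subset hx))
  card_eq := by rw [h'.card_eq, h.card_eq, min_assoc]
  le y hy x hx hx' := by
    by_cases hxt : x ∈ t.keys
    · have := h'.le y hy x hxt hx'
      rwa [h.val_eq _ hxt, h.val_eq _ (h'.subset hy)] at this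
    · exact h.le y (h'.subset hy) x hx hxt

lemma IsUnion.symm {s₁ s₂ u : Store K} (h : IsUnion s₁ s₂ u) : IsUnion s₂ s₁ u where
  mem_iff x := by rw [h.mem_iff, or_comm]
  val_left x h₁ h₂ := h.val_right x h₂ h₁
  val_right x h₁ h₂ := h.val_left x h₂ h₁
  val_both x h₁ h₂ := by rw [h.val_both x h₂ h₁, min_comm]

lemma IsUnion.val_le_left {s₁ s₂ u : Store K} (h : IsUnion s₁ s₂ u) {x : K} (hx : x ∈ s₁.keys) :
    u.val x ≤ s₁.val x := by
  by_cases h' : x ∈ s₂.keys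
  · rw [h.val_both x hx h']; exact min_le_left _ _
  · rw [h.val_left x hx h']

/-- A pair of `t` above `c` would force all `k` pairs of the full structure `s₁`, which lie at or
below `c`, to survive the trimming too; that makes `k + 1` keys. -/
lemma Represents.le_of_isTrim {k : ℕ} {s₁ s₂ u t : Store K} {g : K → ℝ≥0∞}
    (h : Represents k s₁ g) (hu : IsUnion s₁ s₂ u) (ht : IsTrim k u t) {c : ℝ≥0∞}
    (hk : s₁.keys.card = k) (hc : ∀ y ∈ s₁.keys, g y ≤ c) (y : K) (hy : y ∈ t.keys) :
    ENNReal.ofReal (t.val y) ≤ c := by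
  classical
  by_contra! hlt
  have hval : ∀ z ∈ s₁.keys, ENNReal.ofReal (u.val z) ≤ c := fun z hz =>
    (ENNReal.ofReal_le_ofReal (hu.val_le_left hz)).trans ((h.val_eq z hz).trans_le (hc z hz))
  rw [ht.val_eq y hy] at hlt
  have hsub : insert y s₁.keys ⊆ t.keys := by
    intro z hz
    rcases Finset.mem_insert.1 hz with rfl | hz
    · exact hy
    by_contra hzt
    have := ht.le y hy z ((hu.mem_iff z).2 (Or.inl hz)) hzt
    exact absurd (hlt.trans_le (ENNReal.ofReal_le_ofReal this)) (not_lt.2 (hval z hz))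
  have hys : y ∉ s₁.keys := fun hys => absurd hlt (not_lt.2 (hval y hys))
  have h1 := Finset.card_le_card hsub
  rw [Finset.card_insert_of_notMem hys, hk, ht.card_eq] at h1
  omega

lemma Represents.le_outside {k : ℕ} {s₁ s₂ u t : Store K} {g : K → ℝ≥0∞}
    (h : Represents k s₁ g) (hu : IsUnion s₁ s₂ u) (ht : IsTrim k u t) {x : K}
    (hx : x ∉ t.keys) (y : K) (hy : y ∈ t.keys) : ENNReal.ofReal (t.val y) ≤ g x := by
  by_cases hxs : x ∈ s₁.keys
  · rw [← h.val_eq x hxs, ht.val_eq y hy]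
    exact ENNReal.ofReal_le_ofReal ((ht.le y hy x ((hu.mem_iff x).2 (Or.inl hxs)) hx).trans
      (hu.val_le_left hxs))
  · rcases h.outside x hxs with h' | ⟨h₁, h₂⟩
    · simp [h']
    · exact h.le_of_isTrim hu ht h₁ h₂ y hy

/-- A key with a finite value is missing only for lack of room: either the trimming dropped it, or
`s₁` was already full. -/
lemma Represents.card_eq_of_isTrim {k : ℕ} {s₁ s₂ u t : Store K} {g : K → ℝ≥0∞}
    (h : Represents k s₁ g) (hu : IsUnion s₁ s₂ u) (ht : IsTrim k u t) {x : K}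
    (hx : x ∉ t.keys) (hg : g x ≠ ∞) : t.keys.card = k := by
  have hsub : s₁.keys ⊆ u.keys := fun z hz => (hu.mem_iff z).2 (Or.inl hz)
  have h1 := Finset.card_le_card hsub
  rw [ht.card_eq]
  by_cases hxs : x ∈ s₁.keys
  · have : t.keys ⊂ u.keys := Finset.ssubset_iff_subset_ne.2
      ⟨ht.subset, fun e => hx (e ▸ hsub hxs)⟩
    have := Finset.card_lt_card this
    have := ht.card_eq
    omega
  · rcases h.outside x hxs with h' | ⟨h₁, -⟩
    · exact absurd h' hg
    · omega

/-- Inserting a pair is a union with a singleton, so this lemma carries processing as well as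
merging. `removeMax` breaks ties arbitrarily, which is why `Represents` asks only for weak
inequalities outside the structure. -/
lemma Represents.merge {k : ℕ} {s₁ s₂ u t : Store K} {g₁ g₂ : K → ℝ≥0∞}
    (h₁ : Represents k s₁ g₁) (h₂ : Represents k s₂ g₂) (hu : IsUnion s₁ s₂ u)
    (ht : IsTrim k u t) : Represents k t (fun x => min (g₁ x) (g₂ x)) := by
  have key : ∀ x ∈ t.keys, ENNReal.ofReal (t.val x) = min (g₁ x) (g₂ x) := by
    intro x hx
    have hxu := ht.subset hx
    by_cases hx₁ : x ∈ s₁.keys <;> by_cases hx₂ : x ∈ s₂.keys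
    · rw [ht.val_eq x hx, hu.val_both x hx₁ hx₂, ENNReal.ofReal_min, h₁.val_eq x hx₁,
        h₂.val_eq x hx₂]
    · have e : ENNReal.ofReal (t.val x) = g₁ x := by
        rw [ht.val_eq x hx, hu.val_left x hx₁ hx₂, h₁.val_eq x hx₁]
      -- The key may have been cut from `s₂`. Then `s₂` is full of values at most `g₂ x`, and since
      -- `x` survives the trimming, `g₁ x` is at most `g₂ x` as well.
      rw [e, eq_comm, min_eq_left]
      rcases h₂.outside x hx₂ with h' | ⟨h', h''⟩
      · simp [h']
      · exact e ▸ h₂.le_of_isTrim hu.symm ht h' h'' x hx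
    · have e : ENNReal.ofReal (t.val x) = g₂ x := by
        rw [ht.val_eq x hx, hu.val_right x hx₁ hx₂, h₂.val_eq x hx₂]
      rw [e, eq_comm, min_eq_right]
      rcases h₁.outside x hx₁ with h' | ⟨h', h''⟩
      · simp [h']
      · exact e ▸ h₁.le_of_isTrim hu ht h' h'' x hx
    · exact absurd ((hu.mem_iff x).1 hxu) (by tauto)
  refine ⟨key, ht.card_eq.trans_le (min_le_left _ _), fun x hx => ?_⟩
  by_cases hg : min (g₁ x) (g₂ x) = ∞
  · exact Or.inl hg
  refine Or.inr ⟨?_, fun y hy => key y hy ▸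
    le_min (h₁.le_outside hu ht hx y hy) (h₂.le_outside hu.symm ht hx y hy)⟩
  by_cases hg₁ : g₁ x = ∞
  · exact h₂.card_eq_of_isTrim hu.symm ht hx (by simpa [hg₁] using hg)
  · exact h₁.card_eq_of_isTrim hu ht hx hg₁

lemma Represents.trim_of_isTrim {k j : ℕ} {s t : Store K} {g : K → ℝ≥0∞}
    (h : Represents k s g) (ht : IsTrim j s t) (hj : j ≤ k) : Represents j t g := by
  have key : ∀ x ∈ t.keys, ENNReal.ofReal (t.val x) = g x := fun x hx => by
    rw [ht.val_eq x hx, h.val_eq x (ht.subset hx)]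
  refine ⟨key, ht.card_eq.trans_le (min_le_left _ _), fun x hx => ?_⟩
  by_cases hxs : x ∈ s.keys
  · have := Finset.card_lt_card (Finset.ssubset_iff_subset_ne.2
      ⟨ht.subset, fun e => hx (e ▸ hxs)⟩)
    have := ht.card_eq
    refine Or.inr ⟨by omega, fun y hy => ?_⟩
    rw [← key y hy, ← h.val_eq x hxs, ht.val_eq y hy]
    exact ENNReal.ofReal_le_ofReal (ht.le y hy x hxs hx)
  · rcases h.outside x hxs with h' | ⟨h', h''⟩
    · exact Or.inl h'
    · exact Or.inr ⟨by rw [ht.card_eq, h']; omega, fun y hy => h'' y (ht.subset hy)⟩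

lemma Represents.scale {k : ℕ} {s : Store K} {g : K → ℝ≥0∞} (h : Represents k s g) {c : ℝ}
    (hc : 0 < c) : Represents k (s.scale c) (fun x => ENNReal.ofReal c * g x) where
  val_eq x hx := by
    show ENNReal.ofReal (c * s.val x) = _
    rw [ENNReal.ofReal_mul hc.le, h.val_eq x hx]
  card_le := h.card_le
  outside x hx := by
    rcases h.outside x hx with h' | ⟨h', h''⟩
    · left; rw [h', ENNReal.mul_top]; simpa using hc
    · exact Or.inr ⟨h', fun y hy => mul_le_mul_right (h'' y hy) _⟩

lemma represents_empty (k : ℕ) : Represents k (empty : Store K) (fun _ => ∞) :=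
  ⟨fun x hx => by simp [empty] at hx, by simp [empty], fun x _ => Or.inl rfl⟩

/-- The number of stored keys does not depend on how ties are broken; this makes the space
measurable. -/
lemma Represents.card_eq {k : ℕ} {s : Store K} {g : K → ℝ≥0∞} (h : Represents k s g)
    {F : Finset K} (hF : ∀ x, x ∈ F ↔ g x ≠ ∞) : s.keys.card = min k F.card := by
  have hsub : s.keys ⊆ F := fun x hx => (hF x).2 (by rw [← h.val_eq x hx]; simp)
  have h1 := Finset.card_le_card hsub
  have h2 := h.card_le
  by_cases hk : s.keys.card = k
  · omega
  have : F ⊆ s.keys := fun x hx => by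
    by_contra hxs
    rcases h.outside x hxs with h' | ⟨h', -⟩
    · exact (hF x).1 hx h'
    · exact hk h'
  have := Finset.card_le_card this
  omega

/-- Without ties among finite values the contents are forced, so the choices made by `removeMax`
become irrelevant. -/
lemma Represents.isBottomK {k : ℕ} {s : Store K} {g : K → ℝ≥0∞} (h : Represents k s g)
    (hg : ∀ x z, x ≠ z → g x = g z → g x = ∞) : IsBottomK k g s := by
  classical
  refine ⟨fun x => ⟨fun hx => ⟨by rw [← h.val_eq x hx]; simp, ?_⟩, fun ⟨hx, hc⟩ => ?_⟩, h.val_eq⟩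
  · have : {z | g z < g x} ⊆ (s.keys.erase x : Finset K) := by
      intro z hz
      have hz : g z < g x := hz
      rw [Finset.coe_erase, Set.mem_sdiff, Set.mem_singleton_iff]
      refine ⟨?_, fun e => absurd hz (by simp [e])⟩
      by_contra hzs
      rcases h.outside z hzs with h' | ⟨-, h'⟩
      · simp [h'] at hz
      · exact absurd hz (not_lt.2 (h' x hx))
    refine (Set.encard_le_encard this).trans_lt ?_
    rw [Set.encard_coe_eq_coe_finsetCard, Finset.card_erase_of_mem hx]
    have := h.card_le
    have := Finset.card_pos.2 ⟨x, hx⟩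
    exact_mod_cast (by omega : s.keys.card - 1 < k)
  · by_contra hxs
    rcases h.outside x hxs with h' | ⟨h', h''⟩
    · exact hx.ne h'
    have : (s.keys : Set K) ⊆ {z | g z < g x} := fun y hy => by
      refine lt_of_le_of_ne (h'' y hy) fun e => ?_
      have hyx : y ≠ x := by rintro rfl; exact hxs hy
      have := hg y x hyx e
      rw [e] at this
      exact hx.ne this
    have := Set.encard_le_encard this
    rw [Set.encard_coe_eq_coe_finsetCard, h'] at this
    exact absurd hc (not_lt.2 this)

variable [DecidableEq K]

lemma isTrim_removeMax (s : Store K) : IsTrim (s.keys.card - 1) s s.removeMax := by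
  unfold removeMax
  split_ifs with h
  · have hs := Classical.choose_spec (s.keys.exists_max_image s.val h)
    set c := Classical.choose (s.keys.exists_max_image s.val h)
    refine ⟨Finset.erase_subset _ _, fun _ _ => rfl, ?_, fun y hy x hx hx' => ?_⟩
    · show (s.keys.erase c).card = _
      rw [Finset.card_erase_of_mem hs.1]; omega
    · have : x = c := by
        by_contra hne
        exact hx' (Finset.mem_erase.2 ⟨hne, hx⟩)
      rw [this]
      exact hs.2 y (Finset.mem_of_mem_erase hy)
  · have : s.keys.card = 0 := by simpa [Finset.not_nonempty_iff_eq_empty] using h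
    exact ⟨subset_rfl, fun _ _ => rfl, by omega, fun _ _ _ hx hx' => absurd hx hx'⟩

lemma isTrim_iterate_removeMax (n : ℕ) (s : Store K) :
    IsTrim (s.keys.card - n) s (removeMax^[n] s) := by
  induction n with
  | zero => exact IsTrim.refl (by simp)
  | succ n ih =>
    rw [Function.iterate_succ_apply']
    have := ih.trans (isTrim_removeMax _)
    have e : min ((removeMax^[n] s).keys.card - 1) (s.keys.card - n) = s.keys.card - (n + 1) := by
      have := ih.card_eq
      omega
    rwa [e] at this

lemma isTrim_trim (k : ℕ) (s : Store K) : IsTrim k s (s.trim k) := by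
  have h := isTrim_iterate_removeMax (s.keys.card - k) s
  refine ⟨h.subset, h.val_eq, ?_, h.le⟩
  have := h.card_eq
  show (removeMax^[s.keys.card - k] s).keys.card = _
  omega

lemma Represents.trim {k j : ℕ} {s : Store K} {g : K → ℝ≥0∞}
    (h : Represents k s g) (hj : j ≤ k) : Represents j (s.trim j) g :=
  h.trim_of_isTrim (isTrim_trim j s) hj

lemma isUnion_union (s₁ s₂ : Store K) : IsUnion s₁ s₂ (s₁.union s₂) := by
  refine ⟨fun x => ?_, fun x h₁ h₂ => ?_, fun x h₁ h₂ => ?_, fun x h₁ h₂ => ?_⟩ <;>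
    simp_all [Store.union]

lemma Represents.mergeBottomK {k : ℕ} {s₁ s₂ : Store K} {g₁ g₂ : K → ℝ≥0∞}
    (h₁ : Represents k s₁ g₁) (h₂ : Represents k s₂ g₂) :
    Represents k (s₁.mergeBottomK k s₂) (fun x => min (g₁ x) (g₂ x)) :=
  h₁.merge h₂ (isUnion_union s₁ s₂) (isTrim_trim k _)

lemma isUnion_insertMin (s : Store K) (x : K) (v : ℝ) :
    IsUnion s ⟨{x}, fun _ => v⟩ (s.insertMin x v) := by
  refine ⟨fun z => ?_, fun z h₁ h₂ => ?_, fun z h₁ h₂ => ?_, fun z h₁ h₂ => ?_⟩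
  · simp [insertMin, or_comm]
  · simp only [Finset.mem_singleton] at h₂; simp [insertMin, h₂]
  · simp only [Finset.mem_singleton] at h₂; subst h₂; simp [insertMin, h₁]
  · simp only [Finset.mem_singleton] at h₂; subst h₂; simp [insertMin, h₁]

lemma isTrim_processBottomK {k : ℕ} {s : Store K} (hs : s.keys.card ≤ k) (x : K) (v : ℝ) :
    IsTrim k (s.insertMin x v) (s.processBottomK k x v) := by
  unfold processBottomK
  split_ifs with h h'
  · refine IsTrim.refl ?_
    simpa [insertMin, h] using hs
  · have := isTrim_removeMax (s.insertMin x v)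
    rwa [h', Nat.add_sub_cancel] at this
  · refine IsTrim.refl ?_
    have : (s.insertMin x v).keys.card ≤ s.keys.card + 1 := Finset.card_insert_le _ _
    omega

lemma Represents.processBottomK {k : ℕ} (hk : 1 ≤ k) {s : Store K} {g : K → ℝ≥0∞}
    (h : Represents k s g) (x : K) (v : ℝ) :
    Represents k (s.processBottomK k x v)
      (fun z => min (g z) (if z = x then ENNReal.ofReal v else ∞)) := by
  refine h.merge (g₂ := fun z => if z = x then ENNReal.ofReal v else ∞) ⟨?_, ?_, ?_⟩
    (isUnion_insertMin s x v) (isTrim_processBottomK h.card_le x v)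
  · intro z hz; simp only [Finset.mem_singleton] at hz; simp [hz]
  · simpa using hk
  · intro z hz; simp only [Finset.mem_singleton] at hz; simp [hz]

lemma value_empty (x : K) : (empty : Store K).value x = ∞ := by simp [value, empty]

lemma IsUnion.value_eq {s₁ s₂ u : Store K} (h : IsUnion s₁ s₂ u) (x : K) :
    u.value x = min (s₁.value x) (s₂.value x) := by
  unfold value
  have := h.mem_iff x
  by_cases h₁ : x ∈ s₁.keys <;> by_cases h₂ : x ∈ s₂.keys
  · simp [this, h₁, h₂, h.val_both x h₁ h₂, ENNReal.ofReal_min]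
  · simp [this, h₁, h₂, h.val_left x h₁ h₂]
  · simp [this, h₁, h₂, h.val_right x h₁ h₂]
  · simp [this, h₁, h₂]

lemma value_insertMin (s : Store K) (x : K) (v : ℝ) (z : K) :
    (s.insertMin x v).value z = min (s.value z) (if z = x then ENNReal.ofReal v else ∞) := by
  rw [(isUnion_insertMin s x v).value_eq]
  simp [value]

lemma mem_keys_iff_value (s : Store K) (x : K) : x ∈ s.keys ↔ s.value x ≠ ∞ := by
  unfold value; split_ifs with h <;> simp [h]

end Store

/-! ### Tail masses and thresholds -/

/-- The tail masses `A(γ)` are finite for `γ > 0`. -/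
def FiniteTails (a : Measure ℝ) : Prop :=
  ∀ γ : ℝ≥0∞, γ ≠ 0 → a {t : ℝ | 0 < t ∧ γ ≤ ENNReal.ofReal t} ≠ ∞

lemma tailMass_top (a : Measure ℝ) : tailMass a ∞ = 0 := by simp [tailMass]

lemma tailMass_nonneg (a : Measure ℝ) (γ : ℝ≥0∞) : 0 ≤ tailMass a γ := ENNReal.toReal_nonneg

/-- Finiteness matters because `tailMass` is a `toReal`: an infinite mass would be read as 0 and
break monotonicity. -/
lemma FiniteTails.antitone {a : Measure ℝ} (ha : FiniteTails a) {γ γ' : ℝ≥0∞} (h0 : γ ≠ 0)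
    (h : γ ≤ γ') : tailMass a γ' ≤ tailMass a γ :=
  ENNReal.toReal_mono (ha γ h0) (measure_mono fun _ ht => ⟨ht.1, h.trans ht.2⟩)

lemma threshold_ne_zero {ε : ℝ} (hε : 0 < ε) (σ : ℝ) : threshold ε σ ≠ 0 := by
  unfold threshold
  exact ENNReal.div_ne_zero.2 ⟨by simpa using hε, ENNReal.ofReal_ne_top⟩

lemma threshold_anti (ε : ℝ) {σ σ' : ℝ} (h : σ ≤ σ') : threshold ε σ' ≤ threshold ε σ :=
  ENNReal.div_le_div_left (ENNReal.ofReal_le_ofReal h) _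

lemma threshold_zero {ε : ℝ} (hε : 0 < ε) : threshold ε 0 = ∞ := by
  unfold threshold
  rw [ENNReal.ofReal_zero, ENNReal.div_zero]
  simpa using hε

/-! ### SumMax as a minimum over secondary keys -/

section SumMax

variable {𝒳 : Type*} {r : ℕ}

/-- The minimum of `h / w`, over the secondary keys with a positive weight `w`. -/
def passedMin (h w : 𝒳 × Fin r → ℝ) (x : 𝒳) : ℝ≥0∞ :=
  ⨅ i, ⨅ (_ : 0 < w (x, i)), ENNReal.ofReal (h (x, i) / w (x, i))

/-- A nonpositive `h` is no exception, since `ENNReal.ofReal` truncates it to 0. The analysis of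
runs therefore holds for every outcome of the draws, with no null set removed. -/
lemma iInf_pos_div_anti (h : ℝ) {w w' : ℝ} (hw : w ≤ w') :
    (⨅ (_ : 0 < w'), ENNReal.ofReal (h / w')) ≤ ⨅ (_ : 0 < w), ENNReal.ofReal (h / w) := by
  refine le_iInf fun h0 => (iInf_le _ (h0.trans_le hw)).trans ?_
  rcases le_total 0 h with hh | hh
  · exact ENNReal.ofReal_le_ofReal (div_le_div_of_nonneg_left hh h0 hw)
  · rw [ENNReal.ofReal_of_nonpos (div_nonpos_of_nonpos_of_nonneg hh (h0.trans_le hw).le)]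
    exact zero_le

lemma iInf_pos_div_max (h w w' : ℝ) :
    (⨅ (_ : 0 < max w w'), ENNReal.ofReal (h / max w w')) =
      min (⨅ (_ : 0 < w), ENNReal.ofReal (h / w)) (⨅ (_ : 0 < w'), ENNReal.ofReal (h / w')) := by
  rcases le_total w w' with hw | hw
  · rw [min_eq_right (iInf_pos_div_anti h hw), max_eq_right hw]
  · rw [min_eq_left (iInf_pos_div_anti h hw), max_eq_left hw]

/-- Of several weights passed on for one output key only the largest matters, because they all share
the same hash. -/
lemma passedMin_max (h w w' : 𝒳 × Fin r → ℝ) (x : 𝒳) :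
    passedMin h (fun z => max (w z) (w' z)) x = min (passedMin h w x) (passedMin h w' x) := by
  unfold passedMin
  rw [← iInf_inf_eq]
  exact iInf_congr fun i => iInf_pos_div_max _ _ _

lemma passedMin_zero (h : 𝒳 × Fin r → ℝ) (x : 𝒳) : passedMin h (fun _ => 0) x = ∞ := by
  simp [passedMin]

variable [DecidableEq 𝒳]

lemma passedMin_cons (h c : 𝒳 × Fin r → ℝ) (z : 𝒳 × Fin r) (l : List (𝒳 × Fin r)) (x : 𝒳) :
    passedMin h (fun z' => if z' ∈ z :: l then c z' else 0) x =
      min (if 0 < c z then (if x = z.1 then ENNReal.ofReal (h z / c z) else ∞) else ∞)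
        (passedMin h (fun z' => if z' ∈ l then c z' else 0) x) := by
  have h1 : (if 0 < c z then (if x = z.1 then ENNReal.ofReal (h z / c z) else ∞) else ∞) =
      ⨅ i, if (x, i) = z then ⨅ (_ : 0 < c z), ENNReal.ofReal (h z / c z) else ∞ := by
    obtain ⟨z1, z2⟩ := z
    by_cases hx : x = z1
    · subst hx
      have : ∀ i, (if (x, i) = (x, z2) then ⨅ (_ : 0 < c (x, z2)),
          ENNReal.ofReal (h (x, z2) / c (x, z2)) else ∞) = ⨅ (_ : i = z2), ⨅ (_ : 0 < c (x, z2)),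
          ENNReal.ofReal (h (x, z2) / c (x, z2)) := by
        intro i; by_cases hi : i = z2 <;> simp [hi]
      simp only [this, iInf_iInf_eq_left]
      by_cases hc : 0 < c (x, z2) <;> simp [hc]
    · simp [hx]
  rw [h1]
  unfold passedMin
  rw [← iInf_inf_eq]
  refine iInf_congr fun i => ?_
  by_cases hi : (x, i) = z
  · subst hi
    by_cases hl : (x, i) ∈ l <;> simp [hl]
  · by_cases hl : (x, i) ∈ l <;> simp [hl, hi]

lemma Store.Represents.foldl_sumMax {k : ℕ} (hk : 1 ≤ k) (h c : 𝒳 × Fin r → ℝ)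
    (l : List (𝒳 × Fin r)) {s : Store 𝒳} {g : 𝒳 → ℝ≥0∞} (hs : s.Represents k g) :
    (l.foldl (fun t z => if 0 < c z then sumMaxProcess k h t z (c z) else t) s).Represents k
      (fun x => min (g x) (passedMin h (fun z => if z ∈ l then c z else 0) x)) := by
  induction l generalizing s g with
  | nil => simpa [passedMin_zero] using hs
  | cons z l ih =>
    rw [List.foldl_cons]
    have : (if 0 < c z then sumMaxProcess k h s z (c z) else s).Represents k (fun x => min (g x)
        (if 0 < c z then (if x = z.1 then ENNReal.ofReal (h z / c z) else ∞) else ∞)) := by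
      split_ifs with hc
      · exact hs.processBottomK hk z.1 _
      · simpa using hs
    have := ih this
    simpa only [passedMin_cons, min_assoc] using this

lemma value_foldl_insertMin (x : 𝒳) (y : Fin r → ℝ) (l : List (Fin r)) (s : Store (𝒳 × Fin r))
    (z : 𝒳 × Fin r) :
    (l.foldl (fun t i => t.insertMin (x, i) (y i)) s).value z =
      min (s.value z) (if x = z.1 ∧ z.2 ∈ l then ENNReal.ofReal (y z.2) else ∞) := by
  induction l generalizing s with
  | nil => simp
  | cons i l ih =>
    rw [List.foldl_cons, ih, Store.value_insertMin, min_assoc]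
    congr 1
    obtain ⟨z1, z2⟩ := z
    by_cases hx : x = z1
    · subst hx
      by_cases hi : z2 = i
      · subst hi; by_cases hl : z2 ∈ l <;> simp [hl]
      · by_cases hl : z2 ∈ l <;> simp [hl, hi]
    · have : ¬ z1 = x := fun e => hx e.symm
      simp [hx, this]

end SumMax

/-! ### What is pending and what has been passed on, for one output key -/

section Passing

/-- The weight with which a pending value `b` is passed on if the threshold is `γ`. -/
def pass (a : Measure ℝ) (γ b : ℝ≥0∞) : ℝ := if γ ≤ b then tailMass a b else 0

/-- The value that is pending if the minimum output is `M` and the threshold is `γ`. -/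
def pend (γ M : ℝ≥0∞) : ℝ≥0∞ := if M < γ then M else ∞

lemma pend_top (M : ℝ≥0∞) : pend ∞ M = M := by
  unfold pend; split_ifs with h
  · rfl
  · simpa [eq_comm] using h

lemma le_pend (γ M : ℝ≥0∞) : M ≤ pend γ M := by
  unfold pend; split_ifs <;> simp

lemma pend_of_lt {γ M : ℝ≥0∞} (h : M < γ) : pend γ M = M := if_pos h

lemma pend_of_le {γ M : ℝ≥0∞} (h : γ ≤ M) : pend γ M = ∞ := if_neg (not_lt.2 h)

/-- The weight `w` that has been passed on is consistent with the minimum output `M` and the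
threshold `γ`. -/
structure PassSpec (a : Measure ℝ) (γ M : ℝ≥0∞) (w : ℝ) : Prop where
  nonneg : 0 ≤ w
  le : w ≤ tailMass a (max γ M)
  ge : γ ≤ M → tailMass a M ≤ w

/-- A fresh draw counts as a sketch with threshold `∞` from which nothing has been passed on.
Processing an element thus becomes a case of merging. -/
lemma passSpec_top (a : Measure ℝ) (M : ℝ≥0∞) : PassSpec a ∞ M 0 := by
  refine ⟨le_rfl, tailMass_nonneg _ _, fun h => ?_⟩
  rw [top_le_iff.1 h, tailMass_top]

/-- A minimum below the new `γ` is below the old threshold too, so it was never removed. If both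
minima are at least `γ`, then so is all that is still pending. -/
lemma pend_combine {γ γ₁ γ₂ : ℝ≥0∞} (h₁ : γ ≤ γ₁) (h₂ : γ ≤ γ₂) (M₁ M₂ : ℝ≥0∞) :
    (if γ ≤ min (pend γ₁ M₁) (pend γ₂ M₂) then ∞ else min (pend γ₁ M₁) (pend γ₂ M₂)) =
      pend γ (min M₁ M₂) := by
  by_cases h : γ ≤ min M₁ M₂
  · rw [pend_of_le h, if_pos (h.trans (min_le_min (le_pend _ _) (le_pend _ _)))]
  · rw [not_le] at h
    rw [pend_of_lt h]
    have : min (pend γ₁ M₁) (pend γ₂ M₂) = min M₁ M₂ := by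
      rcases le_total M₁ M₂ with hM | hM
      · rw [min_eq_left hM] at h ⊢
        rw [pend_of_lt (h.trans_le h₁), min_eq_left (hM.trans (le_pend _ _))]
      · rw [min_eq_right hM] at h ⊢
        rw [pend_of_lt (h.trans_le h₂), min_eq_right (hM.trans (le_pend _ _))]
    rw [this, if_neg (not_le.2 h)]

lemma PassSpec.le_of_le {a : Measure ℝ} (ha : FiniteTails a) {γ γ' M M' : ℝ≥0∞} {w : ℝ}
    (h : PassSpec a γ' M' w) (h0 : γ ≠ 0) (hγ : γ ≤ γ') (hM : M ≤ M') :
    w ≤ tailMass a (max γ M) := by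
  refine h.le.trans (ha.antitone (fun e => h0 ?_) (max_le_max hγ hM))
  exact le_zero_iff.1 ((le_max_left _ _).trans_eq e)

lemma PassSpec.ge_or {a : Measure ℝ} {γ M : ℝ≥0∞} {w : ℝ} (h : PassSpec a γ M w) :
    pend γ M = M ∨ tailMass a M ≤ w := by
  rcases lt_or_ge M γ with h' | h'
  · exact Or.inl (pend_of_lt h')
  · exact Or.inr (h.ge h')

/-- Upper bound: thresholds and minima only decrease and `A` is antitone, so weights passed on
earlier stay below `A(max γ M)`. Lower bound: the side that attains the minimum has either passed it
on already or still holds it, and then passes it on now. -/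
lemma PassSpec.combine {a : Measure ℝ} (ha : FiniteTails a) {γ γ₁ γ₂ M₁ M₂ : ℝ≥0∞} {w₁ w₂ : ℝ}
    (h0 : γ ≠ 0) (hγ₁ : γ ≤ γ₁) (hγ₂ : γ ≤ γ₂) (h₁ : PassSpec a γ₁ M₁ w₁)
    (h₂ : PassSpec a γ₂ M₂ w₂) :
    PassSpec a γ (min M₁ M₂)
      (max (max w₁ w₂) (pass a γ (min (pend γ₁ M₁) (pend γ₂ M₂)))) := by
  refine ⟨le_max_of_le_left (le_max_of_le_left h₁.nonneg), max_le (max_le ?_ ?_) ?_, fun h => ?_⟩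
  · exact h₁.le_of_le ha h0 hγ₁ (min_le_left _ _)
  · exact h₂.le_of_le ha h0 hγ₂ (min_le_right _ _)
  · unfold pass
    split_ifs with h
    · refine ha.antitone (fun e => h0 ?_) (max_le h (min_le_min (le_pend _ _) (le_pend _ _)))
      exact le_zero_iff.1 ((le_max_left _ _).trans_eq e)
    · exact tailMass_nonneg _ _
  · rcases le_total M₁ M₂ with hM | hM
    · rw [min_eq_left hM] at h ⊢
      rcases h₁.ge_or with h' | h'
      · rw [h', min_eq_left (hM.trans (le_pend _ _)), pass, if_pos h]
        exact le_max_right _ _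
      · exact le_max_of_le_left (le_max_of_le_left h')
    · rw [min_eq_right hM] at h ⊢
      rcases h₂.ge_or with h' | h'
      · rw [h', min_eq_right (hM.trans (le_pend _ _)), pass, if_pos h]
        exact le_max_right _ _
      · exact le_max_of_le_left (le_max_of_le_right h')

/-- The final sample adds `A(γ)` exactly for the output keys whose minimum is still pending. After
this the weight no longer depends on the history. -/
lemma PassSpec.max_eq {a : Measure ℝ} {γ M : ℝ≥0∞} {w : ℝ} (h : PassSpec a γ M w) :
    max w (if pend γ M ≠ ∞ then tailMass a γ else 0) = tailMass a (max γ M) := by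
  rcases lt_or_ge M γ with h' | h'
  · have := h.le
    rw [max_eq_left h'.le] at this ⊢
    rw [pend_of_lt h', if_pos (h'.trans_le le_top).ne, max_eq_right this]
  · have h1 := h.le
    have h2 := h.ge h'
    rw [max_eq_right h'] at h1 ⊢
    rw [pend_of_le h']
    simp only [ne_eq, not_true_eq_false, if_false, max_eq_left h.nonneg]
    exact le_antisymm h1 h2

end Passing

/-! ### The sketch produced by an arbitrary merge tree -/

section Runs

variable {𝒳 : Type*} [DecidableEq 𝒳] {m r : ℕ}

lemma Sketch.summax_flush {k : ℕ} (hk : 1 ≤ k) (a : Measure ℝ) (h : 𝒳 × Fin r → ℝ)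
    (s : Sketch 𝒳 r) {g : 𝒳 → ℝ≥0∞} (hs : s.summax.Represents k g) :
    (s.flush k a h).summax.Represents k (fun x => min (g x)
      (passedMin h (fun z => pass a s.γ (s.sideline.value z)) x)) := by
  have := hs.foldl_sumMax hk h
    (fun z => tailMass a (ENNReal.ofReal (s.sideline.val z))) s.overflow.toList
  suffices e : (fun z => pass a s.γ (s.sideline.value z)) = fun z => if z ∈ s.overflow.toList then
      tailMass a (ENNReal.ofReal (s.sideline.val z)) else 0 by
    rw [e]; exact this
  funext z
  simp only [Finset.mem_toList, overflow, Finset.mem_filter, pass, Store.value]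
  by_cases hz : z ∈ s.sideline.keys
  · simp [hz]
  · simp [hz, tailMass_top]

lemma Sketch.value_sideline_flush (k : ℕ) (a : Measure ℝ) (h : 𝒳 × Fin r → ℝ) (s : Sketch 𝒳 r)
    (z : 𝒳 × Fin r) :
    (s.flush k a h).sideline.value z =
      if s.γ ≤ s.sideline.value z then ∞ else s.sideline.value z := by
  by_cases hz : z ∈ s.sideline.keys
  · by_cases hγ : s.γ ≤ ENNReal.ofReal (s.sideline.val z) <;>
      simp [flush, Store.value, overflow, hz, hγ]
  · simp [flush, Store.value, hz]

/-- The minimum value generated with key `z` for the elements in `J`. -/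
def minOutputOn (D : Fin m → Element 𝒳) (u : Draw 𝒳 m r → ℝ) (J : Finset (Fin m))
    (z : 𝒳 × Fin r) : ℝ≥0∞ :=
  ⨅ j ∈ J, ⨅ (_ : (D j).key = z.1), ENNReal.ofReal (u (.output j z.2))

/-- The minimum value drawn by the PPSWOR sketch for the elements in `J` with key `x`. -/
def minPpswor (D : Fin m → Element 𝒳) (u : Draw 𝒳 m r → ℝ) (J : Finset (Fin m)) (x : 𝒳) :
    ℝ≥0∞ :=
  ⨅ j ∈ J, ⨅ (_ : (D j).key = x), ENNReal.ofReal (u (.ppswor j))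

namespace Plan

/-- The sum of the values of the processed elements. -/
def total (D : Fin m → Element 𝒳) (p : Plan m) : ℝ := (p.elements.map fun j => (D j).val).sum

/-- The maximum weight that has been passed on to SumMax for each key. -/
def passed (ε : ℝ) (a : Measure ℝ) (D : Fin m → Element 𝒳) (u : Draw 𝒳 m r → ℝ) :
    Plan m → 𝒳 × Fin r → ℝ
  | init, _ => 0
  | process p j, z => max (max (passed ε a D u p z) 0)
      (pass a (threshold ε ((process p j).total D))
        (min (pend (threshold ε (p.total D)) (minOutputOn D u p.elements.toFinset z))
          (pend ∞ (if (D j).key = z.1 then ENNReal.ofReal (u (.output j z.2)) else ∞))))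
  | merge p q, z => max (max (passed ε a D u p z) (passed ε a D u q z))
      (pass a (threshold ε ((merge p q).total D))
        (min (pend (threshold ε (p.total D)) (minOutputOn D u p.elements.toFinset z))
          (pend (threshold ε (q.total D)) (minOutputOn D u q.elements.toFinset z))))

lemma total_process (D : Fin m → Element 𝒳) (p : Plan m) (j : Fin m) :
    (process p j).total D = p.total D + (D j).val := by
  simp [total, elements]

lemma total_merge (D : Fin m → Element 𝒳) (p q : Plan m) :
    (merge p q).total D = p.total D + q.total D := by
  simp [total, elements]

lemma total_nonneg {D : Fin m → Element 𝒳} (hD : ∀ j, 0 < (D j).val) (p : Plan m) :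
    0 ≤ p.total D := by
  refine List.sum_nonneg fun x hx => ?_
  obtain ⟨j, -, rfl⟩ := List.mem_map.1 hx
  exact (hD j).le

lemma minOutputOn_process (D : Fin m → Element 𝒳) (u : Draw 𝒳 m r → ℝ) (p : Plan m) (j : Fin m)
    (z : 𝒳 × Fin r) :
    minOutputOn D u (process p j).elements.toFinset z = min (minOutputOn D u p.elements.toFinset z)
      (if (D j).key = z.1 then ENNReal.ofReal (u (.output j z.2)) else ∞) := by
  simp only [minOutputOn, elements, List.toFinset_append, Finset.iInf_union, List.toFinset_cons,
    List.toFinset_nil, insert_empty_eq, Finset.mem_singleton, iInf_iInf_eq_left]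
  congr 1
  split_ifs with h <;> simp [h]

lemma minPpswor_process (D : Fin m → Element 𝒳) (u : Draw 𝒳 m r → ℝ) (p : Plan m) (j : Fin m)
    (x : 𝒳) :
    minPpswor D u (process p j).elements.toFinset x = min (minPpswor D u p.elements.toFinset x)
      (if x = (D j).key then ENNReal.ofReal (u (.ppswor j)) else ∞) := by
  simp only [minPpswor, elements, List.toFinset_append, Finset.iInf_union, List.toFinset_cons,
    List.toFinset_nil, insert_empty_eq, Finset.mem_singleton, iInf_iInf_eq_left]
  congr 1
  by_cases h : x = (D j).key
  · simp [h]
  · simp [h, Ne.symm h]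

lemma minOutputOn_merge (D : Fin m → Element 𝒳) (u : Draw 𝒳 m r → ℝ) (p q : Plan m)
    (z : 𝒳 × Fin r) :
    minOutputOn D u (merge p q).elements.toFinset z =
      min (minOutputOn D u p.elements.toFinset z) (minOutputOn D u q.elements.toFinset z) := by
  simp only [minOutputOn, elements, List.toFinset_append, Finset.iInf_union]

lemma minPpswor_merge (D : Fin m → Element 𝒳) (u : Draw 𝒳 m r → ℝ) (p q : Plan m) (x : 𝒳) :
    minPpswor D u (merge p q).elements.toFinset x =
      min (minPpswor D u p.elements.toFinset x) (minPpswor D u q.elements.toFinset x) := by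
  simp only [minPpswor, elements, List.toFinset_append, Finset.iInf_union]

lemma passSpec_passed {ε : ℝ} (hε : 0 < ε) {a : Measure ℝ} (ha : FiniteTails a)
    {D : Fin m → Element 𝒳} (hD : ∀ j, 0 < (D j).val) (u : Draw 𝒳 m r → ℝ) (p : Plan m)
    (z : 𝒳 × Fin r) :
    PassSpec a (threshold ε (p.total D)) (minOutputOn D u p.elements.toFinset z)
      (passed ε a D u p z) := by
  induction p with
  | init =>
    have : (init : Plan m).total D = 0 := by simp [total, elements]
    rw [this, threshold_zero hε]
    exact passSpec_top a _
  | process p j ih =>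
    rw [minOutputOn_process]
    refine PassSpec.combine ha (threshold_ne_zero hε _) (threshold_anti ε ?_) le_top ih
      (passSpec_top a _)
    rw [total_process]
    linarith [hD j]
  | merge p q ihp ihq =>
    rw [minOutputOn_merge]
    refine PassSpec.combine ha (threshold_ne_zero hε _) (threshold_anti ε ?_)
      (threshold_anti ε ?_) ihp ihq <;>
    · rw [total_merge]
      linarith [total_nonneg hD p, total_nonneg hD q]

/-- The sketch `s` is the one that is expected after the computation `p`. -/
structure RunSpec (k : ℕ) (ε : ℝ) (a : Measure ℝ) (D : Fin m → Element 𝒳) (u : Draw 𝒳 m r → ℝ)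
    (p : Plan m) (s : Sketch 𝒳 r) : Prop where
  sum_eq : s.sum = p.total D
  threshold_eq : s.γ = threshold ε (p.total D)
  sideline_eq : ∀ z, s.sideline.value z =
    pend (threshold ε (p.total D)) (minOutputOn D u p.elements.toFinset z)
  ppswor : s.ppswor.Represents k (minPpswor D u p.elements.toFinset)
  summax : s.summax.Represents k (passedMin (fun z => u (.hash z.1 z.2)) (passed ε a D u p))

/-- Each component is a sum or a minimum over the processed elements, except that SumMax depends on
`passed`. That function does see the merge tree, but only within the limits set by
`passSpec_passed`. -/
lemma runSpec_run {k : ℕ} (hk : 1 ≤ k) {ε : ℝ} (hε : 0 < ε) (a : Measure ℝ)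
    {D : Fin m → Element 𝒳} (hD : ∀ j, 0 < (D j).val) (u : Draw 𝒳 m r → ℝ) (p : Plan m) :
    RunSpec k ε a D u p (run k ε a D u p) := by
  induction p with
  | init =>
    have h0 : (init : Plan m).total D = 0 := by simp [total, elements]
    refine ⟨h0.symm, ?_, fun z => ?_, ?_, ?_⟩
    · rw [h0, threshold_zero hε]; rfl
    · show Store.empty.value z = _
      rw [Store.value_empty]
      simp [pend, minOutputOn, elements]
    · have : minPpswor D u (init : Plan m).elements.toFinset = fun _ => ∞ := by
        funext x; simp [minPpswor, elements]
      rw [this]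
      exact Store.represents_empty k
    · have : passed ε a D u (init : Plan m) = fun _ => 0 := by funext z; rfl
      rw [this, funext (passedMin_zero _)]
      exact Store.represents_empty k
  | process p j ih =>
    have hsum : (run k ε a D u p).sum + (D j).val = (process p j).total D := by
      rw [ih.sum_eq, total_process]
    have hγ : threshold ε ((process p j).total D) ≤ threshold ε (p.total D) := by
      refine threshold_anti ε ?_
      rw [total_process]; linarith [hD j]
    have hval : ∀ z, ((List.finRange r).foldl
        (fun t i => t.insertMin ((D j).key, i) (u (.output j i)))
        (run k ε a D u p).sideline).value z =
        min (pend (threshold ε (p.total D)) (minOutputOn D u p.elements.toFinset z))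
          (pend ∞ (if (D j).key = z.1 then ENNReal.ofReal (u (.output j z.2)) else ∞)) := by
      intro z
      rw [value_foldl_insertMin (D j).key (fun i => u (.output j i)), ih.sideline_eq, pend_top]
      simp [List.mem_finRange]
    refine ⟨hsum, ?_, fun z => ?_, ?_, ?_⟩
    · show threshold ε _ = _
      rw [hsum]
    · rw [run, Sketch.process, Sketch.value_sideline_flush]
      dsimp only
      rw [hval, hsum, pend_combine hγ le_top, minOutputOn_process]
    · rw [funext (minPpswor_process D u p j)]
      exact ih.ppswor.processBottomK hk _ _
    · have := Sketch.summax_flush hk a (fun z => u (.hash z.1 z.2))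
        { summax := (run k ε a D u p).summax
          ppswor := (run k ε a D u p).ppswor.processBottomK k (D j).key (u (.ppswor j))
          sum := (run k ε a D u p).sum + (D j).val
          γ := threshold ε ((run k ε a D u p).sum + (D j).val)
          sideline := (List.finRange r).foldl
            (fun t i => t.insertMin ((D j).key, i) (u (.output j i)))
            (run k ε a D u p).sideline } ih.summax
      simp only [hval, hsum] at this
      convert this using 1
      · rw [run, Sketch.process, hsum]
      funext x
      have e : passed ε a D u (process p j) = fun z => max (max (passed ε a D u p z) 0)
          (pass a (threshold ε ((process p j).total D))
            (min (pend (threshold ε (p.total D)) (minOutputOn D u p.elements.toFinset z))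
              (pend ∞ (if (D j).key = z.1 then ENNReal.ofReal (u (.output j z.2)) else ∞)))) := rfl
      rw [e, passedMin_max, passedMin_max, passedMin_zero, min_eq_left le_top]
  | merge p q ihp ihq =>
    have hsum : (run k ε a D u p).sum + (run k ε a D u q).sum = (merge p q).total D := by
      rw [ihp.sum_eq, ihq.sum_eq, total_merge]
    have hγp : threshold ε ((merge p q).total D) ≤ threshold ε (p.total D) := by
      refine threshold_anti ε ?_
      rw [total_merge]; linarith [total_nonneg hD q]
    have hγq : threshold ε ((merge p q).total D) ≤ threshold ε (q.total D) := by
      refine threshold_anti ε ?_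
      rw [total_merge]; linarith [total_nonneg hD p]
    have hval : ∀ z, ((run k ε a D u p).sideline.union (run k ε a D u q).sideline).value z =
        min (pend (threshold ε (p.total D)) (minOutputOn D u p.elements.toFinset z))
          (pend (threshold ε (q.total D)) (minOutputOn D u q.elements.toFinset z)) := by
      intro z
      rw [(Store.isUnion_union _ _).value_eq, ihp.sideline_eq, ihq.sideline_eq]
    refine ⟨hsum, ?_, fun z => ?_, ?_, ?_⟩
    · show threshold ε _ = _
      rw [hsum]
    · rw [run, Sketch.merge, Sketch.value_sideline_flush]
      dsimp only
      rw [hval, hsum, pend_combine hγp hγq, minOutputOn_merge]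
    · rw [funext (minPpswor_merge D u p q)]
      exact ihp.ppswor.mergeBottomK ihq.ppswor
    · have := Sketch.summax_flush hk a (fun z => u (.hash z.1 z.2))
        { summax := (run k ε a D u p).summax.mergeBottomK k (run k ε a D u q).summax
          ppswor := (run k ε a D u p).ppswor.mergeBottomK k (run k ε a D u q).ppswor
          sum := (run k ε a D u p).sum + (run k ε a D u q).sum
          γ := threshold ε ((run k ε a D u p).sum + (run k ε a D u q).sum)
          sideline := (run k ε a D u p).sideline.union (run k ε a D u q).sideline }
        (ihp.summax.mergeBottomK ihq.summax)
      simp only [hval, hsum] at this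
      convert this using 1
      · rw [run, Sketch.merge, hsum]
      funext x
      have e : passed ε a D u (merge p q) =
          fun z => max (max (passed ε a D u p z) (passed ε a D u q z))
            (pass a (threshold ε ((merge p q).total D))
              (min (pend (threshold ε (p.total D)) (minOutputOn D u p.elements.toFinset z))
                (pend (threshold ε (q.total D)) (minOutputOn D u q.elements.toFinset z)))) := rfl
      rw [e, passedMin_max, passedMin_max]

lemma minOutputOn_univ (D : Fin m → Element 𝒳) (u : Draw 𝒳 m r → ℝ) (z : 𝒳 × Fin r) :
    minOutputOn D u Finset.univ z = minOutput D u z.1 z.2 := by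
  simp [minOutputOn, minOutput]

lemma seed_eq (ε : ℝ) (a : Measure ℝ) (D : Fin m → Element 𝒳) (u : Draw 𝒳 m r → ℝ) (hr : 0 < r)
    (x : 𝒳) :
    seed ε a D u x = min
      (ENNReal.ofReal r * passedMin (fun z => u (.hash z.1 z.2))
        (fun z => maxPassed ε a D u z.1 z.2) x)
      (if 0 < headMoment a (threshold ε (sumVal D)) then
        ENNReal.ofReal (headMoment a (threshold ε (sumVal D)))⁻¹ * minPpswor D u Finset.univ x
        else ∞) := by
  have key' : ∀ (c : ℝ) (hc : 0 < c) {p : Prop} (g : p → ℝ≥0∞),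
      ENNReal.ofReal c * ⨅ i, g i = ⨅ i, ENNReal.ofReal c * g i := fun c hc p g =>
    ENNReal.mul_iInf_of_ne (by simpa using hc) ENNReal.ofReal_ne_top
  have key : ∀ (c : ℝ) (hc : 0 < c) {ι : Type} (g : ι → ℝ≥0∞),
      ENNReal.ofReal c * ⨅ i, g i = ⨅ i, ENNReal.ofReal c * g i := fun c hc ι g =>
    ENNReal.mul_iInf_of_ne (by simpa using hc) ENNReal.ofReal_ne_top
  have hr' : (0 : ℝ) < r := by exact_mod_cast hr
  unfold seed
  congr 1
  · unfold passedMin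
    rw [key _ hr']
    refine iInf_congr fun i => ?_
    dsimp only
    rw [key' _ hr']
    simp only [ENNReal.ofReal_mul hr'.le]
  · split_ifs with hB
    · unfold minPpswor
      simp only [key _ (inv_pos.2 hB), key' _ (inv_pos.2 hB), hB, Finset.mem_univ, iInf_pos,
        div_eq_inv_mul, ENNReal.ofReal_mul (inv_pos.2 hB).le]
    · simp [hB]

/-- Here it matters that each element is processed exactly once: the total becomes `sumVal D` and
the minima range over all elements. The pending keys complete `passed` to `maxPassed`, which does
not involve `p`. -/
lemma represents_sample {k : ℕ} (hk : 1 ≤ k) {ε : ℝ} (hε : 0 < ε) {a : Measure ℝ}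
    (ha : FiniteTails a) {D : Fin m → Element 𝒳} (hD : ∀ j, 0 < (D j).val)
    (u : Draw 𝒳 m r → ℝ) (hr : 0 < r) {p : Plan m} (hp : p.elements.Nodup)
    (hp' : ∀ j, j ∈ p.elements) :
    (sample k ε a D u p).Represents k (seed ε a D u) := by
  have hr' : (0 : ℝ) < r := by exact_mod_cast hr
  have hu : p.elements.toFinset = Finset.univ := by ext j; simp [hp']
  have ht : p.total D = sumVal D := by
    rw [total, ← List.sum_toFinset _ hp, hu]; rfl
  have h := runSpec_run hk hε a hD u p
  have hs := passSpec_passed hε ha hD u p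
  have hside := h.sideline_eq
  have hpp := h.ppswor
  have hγ := h.threshold_eq
  rw [ht] at hγ
  simp only [ht, hu] at hside hs hpp
  have hsm : (if 0 < tailMass a (run k ε a D u p).γ then
      (run k ε a D u p).sideline.keys.toList.foldl (fun t z => sumMaxProcess k
        (fun z => u (.hash z.1 z.2)) t z (tailMass a (run k ε a D u p).γ)) (run k ε a D u p).summax
      else (run k ε a D u p).summax).Represents k (passedMin (fun z => u (.hash z.1 z.2))
        (fun z => maxPassed ε a D u z.1 z.2)) := by
    have e : (fun z : 𝒳 × Fin r => maxPassed ε a D u z.1 z.2) = fun z =>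
        max (passed ε a D u p z) (if z ∈ (run k ε a D u p).sideline.keys.toList then
          tailMass a (run k ε a D u p).γ else 0) := by
      funext z
      simp only [Finset.mem_toList, Store.mem_keys_iff_value]
      rw [hside, hγ, (hs z).max_eq, minOutputOn_univ]
      rfl
    rw [e, funext (passedMin_max _ _ _)]
    split_ifs with hA
    · have := h.summax.foldl_sumMax hk (fun z => u (.hash z.1 z.2))
        (fun _ => tailMass a (run k ε a D u p).γ) (run k ε a D u p).sideline.keys.toList
      simpa only [hA, if_true] using this
    · have hA0 : tailMass a (run k ε a D u p).γ = 0 :=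
        le_antisymm (not_lt.1 hA) (tailMass_nonneg _ _)
      simp only [hA0, ite_self, passedMin_zero, min_eq_left le_top]
      exact h.summax
  rw [funext (seed_eq ε a D u hr)]
  unfold sample Sketch.finalSample
  dsimp only
  rw [hγ] at hsm ⊢
  by_cases hB : 0 < headMoment a (threshold ε (sumVal D))
  · simp only [if_pos hB]
    exact (hsm.scale hr').mergeBottomK (hpp.scale (inv_pos.2 hB))
  · simp only [if_neg hB, min_top_right]
    exact hsm.scale hr'

end Plan

end Runs

/-! ### Functions of disjoint blocks of independent draws -/

section Independence

variable {ι Ω : Type*} [mΩ : MeasurableSpace Ω] {P : Measure Ω} {U : ι → Ω → ℝ}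

/-- The σ-algebra generated by the random variables with index in `s`. -/
abbrev sigmaOn (U : ι → Ω → ℝ) (s : Set ι) : MeasurableSpace Ω :=
  ⨆ d ∈ s, MeasurableSpace.comap (U d) inferInstance

lemma sigmaOn_le (hU : ∀ d, Measurable (U d)) (s : Set ι) : sigmaOn U s ≤ mΩ :=
  iSup₂_le fun d _ => (hU d).comap_le

lemma measurable_sigmaOn {s : Set ι} {d : ι} (hd : d ∈ s) : Measurable[sigmaOn U s] (U d) :=
  (comap_measurable (U d)).mono (le_iSup₂_of_le d hd le_rfl) le_rfl

lemma sigmaOn_mono {s t : Set ι} (h : s ⊆ t) : sigmaOn U s ≤ sigmaOn U t :=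
  biSup_mono fun _ hd => h hd

lemma indep_sigmaOn (hU : ∀ d, Measurable (U d)) (hi : iIndepFun U P) {s t : Set ι}
    (h : Disjoint s t) : Indep (sigmaOn U s) (sigmaOn U t) P :=
  indep_iSup_of_disjoint (fun d => (hU d).comap_le) hi.iIndep h

/-- Splitting off one block at a time reduces the claim to the independence of two σ-algebras, that
of one block and that of the union of the others. -/
lemma iIndepFun_of_sigmaOn [IsProbabilityMeasure P] {κ β : Type*} [MeasurableSpace β]
    (hU : ∀ d, Measurable (U d))
    (hi : iIndepFun U P) {b : κ → Set ι} (hb : ∀ q q', q ≠ q' → Disjoint (b q) (b q'))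
    {X : κ → Ω → β} (hX : ∀ q, Measurable[sigmaOn U (b q)] (X q)) : iIndepFun X P := by
  classical
  rw [iIndepFun_iff_measure_inter_preimage_eq_mul]
  intro S sets hsets
  induction S using Finset.induction_on with
  | empty => simp
  | insert q S hq ih =>
    have ih := ih fun i hi => hsets i (Finset.mem_insert_of_mem hi)
    rw [Finset.prod_insert hq, ← ih, Finset.set_biInter_insert]
    have hd : Disjoint (b q) (⋃ i ∈ S, b i) := by
      rw [Set.disjoint_iUnion₂_right]
      exact fun i hi => hb q i (by rintro rfl; exact hq hi)
    refine (Indep_iff _ _ _).1 (indep_sigmaOn hU hi hd) _ _ ?_ ?_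
    · exact hX q (hsets q (Finset.mem_insert_self _ _))
    · refine Finset.measurableSet_biInter S fun i hi => ?_
      exact sigmaOn_mono (Set.subset_iUnion₂_of_subset i hi subset_rfl) _
        (hX i (hsets i (Finset.mem_insert_of_mem hi)))

end Independence

/-! ### Integrating out exponential draws -/

section Exponential

variable {Ω : Type*} [mΩ : MeasurableSpace Ω] {P : Measure Ω}

lemma expMeasure_Ioi {l t : ℝ} (hl : 0 < l) (ht : 0 ≤ t) :
    expMeasure l (Set.Ioi t) = ENNReal.ofReal (Real.exp (-(l * t))) := by
  have := isProbabilityMeasure_expMeasure hl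
  rw [← Set.compl_Iic, prob_compl_eq_one_sub measurableSet_Iic, ← ofReal_cdf,
    cdf_expMeasure_eq hl, if_pos ht, ← ENNReal.ofReal_one, ← ENNReal.ofReal_sub]
  · congr 1; ring
  · rw [sub_nonneg, Real.exp_le_one_iff]; nlinarith

/-- Fubini over the law of `Y` with the pair `(W, c)` frozen. The weight `W` is carried along so
that the result can be tested against events, as a conditional expectation requires. -/
lemma lintegral_mul_lt_of_indep {Ω : Type*} {m mΩ : MeasurableSpace Ω} {P : Measure Ω}
    [IsProbabilityMeasure P] (hm : m ≤ mΩ)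
    {W : Ω → ℝ≥0∞} {c Y : Ω → ℝ} (hW : Measurable[m] W) (hc : Measurable[m] c)
    (hc0 : ∀ ω, 0 ≤ c ω) (hY : Measurable Y) {l : ℝ} (hl : 0 < l) (hlaw : P.map Y = expMeasure l)
    (hi : Indep m (MeasurableSpace.comap Y inferInstance) P) :
    ∫⁻ ω, W ω * (if c ω < Y ω then 1 else 0) ∂P =
      ∫⁻ ω, W ω * ENNReal.ofReal (Real.exp (-(l * c ω))) ∂P := by
  have := isProbabilityMeasure_expMeasure hl
  have hpm : Measurable[m] (fun ω => (W ω, c ω)) := hW.prodMk hc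
  have hpair : Measurable (fun ω => (W ω, c ω)) := hpm.mono hm le_rfl
  have hI : IndepFun (fun ω => (W ω, c ω)) Y P := by
    rw [IndepFun_iff_Indep]
    exact indep_of_indep_of_le_left hi hpm.comap_le
  have hmap := (indepFun_iff_map_prod_eq_prod_map_map hpair.aemeasurable hY.aemeasurable).1 hI
  have hF : Measurable (fun p : (ℝ≥0∞ × ℝ) × ℝ => p.1.1 * (if p.1.2 < p.2 then 1 else 0)) := by
    refine (by fun_prop : Measurable fun p : (ℝ≥0∞ × ℝ) × ℝ => p.1.1).mul ?_
    exact Measurable.ite (measurableSet_lt (by fun_prop) (by fun_prop)) measurable_const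
      measurable_const
  have e1 : ∫⁻ ω, W ω * (if c ω < Y ω then 1 else 0) ∂P =
      ∫⁻ p, p.1.1 * (if p.1.2 < p.2 then 1 else 0) ∂(P.map fun ω => ((W ω, c ω), Y ω)) := by
    rw [lintegral_map hF (hpair.prodMk hY)]
  rw [e1, hmap, hlaw, lintegral_prod _ hF.aemeasurable,
    lintegral_map hF.lintegral_prod_right' hpair]
  refine lintegral_congr fun ω => ?_
  dsimp only
  rw [lintegral_const_mul _ (Measurable.ite measurableSet_Ioi measurable_const measurable_const)]
  congr 1
  rw [← expMeasure_Ioi hl (hc0 ω), ← lintegral_indicator_one measurableSet_Ioi]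
  refine lintegral_congr fun y => ?_
  simp [Set.indicator_apply]

/-- When draw `i` is integrated out, the indicators of the other draws belong to the weight, which
is measurable for `T ∪ s`. The resulting factor `exp (-(l i * c i))` then joins `W`. -/
lemma lintegral_mul_prod_lt [IsProbabilityMeasure P] {ι : Type*} {U : ι → Ω → ℝ}
    (hU : ∀ d, Measurable (U d)) (hi : iIndepFun U P) {l : ι → ℝ} {T : Set ι} {s : Finset ι}
    (hl : ∀ d ∈ s, 0 < l d) (hlaw : ∀ d ∈ s, P.map (U d) = expMeasure (l d))
    (hsT : ∀ d ∈ s, d ∉ T) {c : ι → Ω → ℝ} (hc : ∀ d ∈ s, Measurable[sigmaOn U T] (c d))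
    (hc0 : ∀ d ∈ s, ∀ ω, 0 ≤ c d ω) {W : Ω → ℝ≥0∞} (hW : Measurable[sigmaOn U T] W) :
    ∫⁻ ω, W ω * ∏ d ∈ s, (if c d ω < U d ω then 1 else 0) ∂P =
      ∫⁻ ω, W ω * ∏ d ∈ s, ENNReal.ofReal (Real.exp (-(l d * c d ω))) ∂P := by
  classical
  induction s using Finset.induction_on generalizing W with
  | empty => simp
  | insert i s his ih =>
    simp only [Finset.forall_mem_insert] at hl hlaw hsT hc hc0
    have hT' : T ⊆ T ∪ s := Set.subset_union_left
    have hprod : Measurable[sigmaOn U (T ∪ s)]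
        fun ω => W ω * ∏ d ∈ s, (if c d ω < U d ω then (1 : ℝ≥0∞) else 0) := by
      refine (hW.mono (sigmaOn_mono hT') le_rfl).mul ?_
      refine Finset.measurable_fun_prod s fun d hd => ?_
      refine Measurable.ite ?_ measurable_const measurable_const
      exact measurableSet_lt ((hc.2 d hd).mono (sigmaOn_mono hT') le_rfl)
        (measurable_sigmaOn (Or.inr hd))
    have hdis : Disjoint (T ∪ s) {i} := by
      rw [Set.disjoint_singleton_right]
      rintro (h | h)
      · exact hsT.1 h
      · exact his h
    have hind : Indep (sigmaOn U (T ∪ s)) (MeasurableSpace.comap (U i) inferInstance) P := by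
      have := indep_sigmaOn hU hi hdis
      simpa [sigmaOn] using this
    have h1 := lintegral_mul_lt_of_indep (sigmaOn_le hU _) hprod
      (hc.1.mono (sigmaOn_mono hT') le_rfl) hc0.1 (hU i) hl.1 hlaw.1 hind
    have h2 := ih hl.2 hlaw.2 hsT.2 hc.2 hc0.2
      (W := fun ω => W ω * ENNReal.ofReal (Real.exp (-(l i * c i ω))))
      (hW.mul (ENNReal.measurable_ofReal.comp
        (Real.measurable_exp.comp ((measurable_const.mul hc.1).neg))))
    simp only [Finset.prod_insert his]
    calc _ = ∫⁻ ω, (W ω * ∏ d ∈ s, (if c d ω < U d ω then (1 : ℝ≥0∞) else 0)) *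
          (if c i ω < U i ω then 1 else 0) ∂P := lintegral_congr fun ω => by ring
      _ = _ := h1
      _ = ∫⁻ ω, (W ω * ENNReal.ofReal (Real.exp (-(l i * c i ω)))) *
          ∏ d ∈ s, (if c d ω < U d ω then (1 : ℝ≥0∞) else 0) ∂P :=
          lintegral_congr fun ω => by ring
      _ = _ := h2
      _ = _ := lintegral_congr fun ω => by ring

end Exponential

/-! ### Moment generating functions and a Chernoff bound -/

section Concentration

variable {Ω : Type*} [mΩ : MeasurableSpace Ω] {P : Measure Ω} [IsProbabilityMeasure P]

/-- By convexity the exponential lies below its chord between 0 and `t * T`. The bound is linear in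
`x`, so after integration only the mean remains. -/
lemma exp_mul_le_of_mem_Icc {T x : ℝ} (hT : 0 < T) (hx : x ∈ Set.Icc 0 T) (t : ℝ) :
    Real.exp (t * x) ≤ 1 + x * ((Real.exp (t * T) - 1) / T) := by
  have h := convexOn_exp.2 (Set.mem_univ 0) (Set.mem_univ (t * T))
    (sub_nonneg.2 ((div_le_one hT).2 hx.2)) (div_nonneg hx.1 hT.le) (sub_add_cancel 1 (x / T))
  simp only [smul_eq_mul, mul_zero, zero_add, Real.exp_zero, mul_one] at h
  have e : x / T * (t * T) = t * x := by field_simp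
  rw [e] at h
  refine h.trans_eq ?_
  field_simp
  ring

lemma mgf_le_of_mem_Icc {X : Ω → ℝ} (hX : Measurable X) {T : ℝ} (hT : 0 < T)
    (hXT : ∀ ω, X ω ∈ Set.Icc 0 T) (t : ℝ) :
    mgf X P t ≤ Real.exp ((∫ ω, X ω ∂P) * ((Real.exp (t * T) - 1) / T)) := by
  have hi : Integrable X P := Integrable.of_mem_Icc 0 T hX.aemeasurable (ae_of_all _ hXT)
  have : mgf X P t ≤ ∫ ω, (1 + X ω * ((Real.exp (t * T) - 1) / T)) ∂P := by
    refine integral_mono_of_nonneg (ae_of_all _ fun ω => (Real.exp_pos _).le)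
      ((integrable_const _).add (hi.mul_const _))
      (ae_of_all _ fun ω => exp_mul_le_of_mem_Icc hT (hXT ω) t)
  refine this.trans ?_
  rw [integral_add (integrable_const _) (hi.mul_const _), integral_mul_const]
  simp only [integral_const, probReal_univ, smul_eq_mul, mul_one]
  rw [add_comm]
  exact Real.add_one_le_exp _

/-- Both signs of `t` are used: positive ones in the Chernoff bound, negative ones for the Laplace
transform of a weight. -/
lemma mgf_sum_le_of_mem_Icc {ι : Type*} {X : ι → Ω → ℝ} (hX : ∀ i, Measurable (X i))
    (hi : iIndepFun X P) {T : ℝ} (hT : 0 < T) (hXT : ∀ i ω, X i ω ∈ Set.Icc 0 T) (s : Finset ι)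
    (t : ℝ) : mgf (fun ω => ∑ i ∈ s, X i ω) P t ≤
      Real.exp ((∑ i ∈ s, ∫ ω, X i ω ∂P) * ((Real.exp (t * T) - 1) / T)) := by
  have : (fun ω => ∑ i ∈ s, X i ω) = ∑ i ∈ s, X i := by ext ω; simp
  rw [this, hi.mgf_sum hX, Finset.sum_mul, Real.exp_sum]
  exact Finset.prod_le_prod (fun i _ => mgf_nonneg) fun i _ => mgf_le_of_mem_Icc (hX i) hT (hXT i) t

/-- A Chernoff bound for sums of independent random variables with values in `[0,1]`. -/
lemma measureReal_le_sum_le {ι : Type*} {X : ι → Ω → ℝ} (hX : ∀ i, Measurable (X i))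
    (hi : iIndepFun X P) (hX1 : ∀ i ω, X i ω ∈ Set.Icc (0 : ℝ) 1) (s : Finset ι) {μ θ : ℝ}
    (hμ : ∑ i ∈ s, ∫ ω, X i ω ∂P ≤ μ) (hθ : 0 ≤ θ) (b : ℝ) :
    P.real {ω | b ≤ ∑ i ∈ s, X i ω} ≤ Real.exp (-θ * b + μ * (Real.exp θ - 1)) := by
  have hbd : ∀ ω, (∑ i ∈ s, X i ω) ∈ Set.Icc (0 : ℝ) s.card := fun ω =>
    ⟨Finset.sum_nonneg fun i _ => (hX1 i ω).1, by
      simpa using Finset.sum_le_sum (s := s) fun i _ => (hX1 i ω).2⟩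
  have hm : Measurable fun ω => ∑ i ∈ s, X i ω := Finset.measurable_fun_sum s fun i _ => hX i
  refine (measure_ge_le_exp_mul_mgf b hθ ?_).trans ?_
  · refine Integrable.of_mem_Icc 0 (Real.exp (θ * s.card)) (by fun_prop) (ae_of_all _ fun ω => ?_)
    exact ⟨(Real.exp_pos _).le, Real.exp_le_exp.2 (mul_le_mul_of_nonneg_left (hbd ω).2 hθ)⟩
  · rw [Real.exp_add]
    refine mul_le_mul_of_nonneg_left ?_ (Real.exp_pos _).le
    refine (mgf_sum_le_of_mem_Icc hX hi one_pos hX1 s θ).trans ?_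
    rw [mul_one, div_one, Real.exp_le_exp]
    exact mul_le_mul_of_nonneg_right hμ (sub_nonneg.2 (Real.one_le_exp hθ))

end Concentration

/-! ### Finite tails, finite infima and blocks of draws -/

/-- Markov's inequality for `1 - e^{-t}`, whose integral is `f 1`; on `t ≥ γ` this function is at
least `1 - e^{-γ}`. -/
lemma IsSoftConcaveSublinear.finiteTails {a : Measure ℝ} {f : ℝ → ℝ}
    (hf : IsSoftConcaveSublinear a f) : FiniteTails a := by
  intro γ hγ
  by_cases htop : γ = ∞
  · simp [htop]
  have hg : 0 < γ.toReal := ENNReal.toReal_pos hγ htop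
  have hpos : 0 < 1 - Real.exp (-γ.toReal) := by
    rw [sub_pos, Real.exp_lt_one_iff]; linarith
  have h1 := (hf 1 zero_le_one).2
  have hmeas : Measurable fun t : ℝ => ENNReal.ofReal (1 - Real.exp (-(1 * t))) := by fun_prop
  have h2 := meas_ge_le_lintegral_div (μ := a.restrict (Set.Ioi 0)) hmeas.aemeasurable
    (ENNReal.ofReal_pos.2 hpos).ne' ENNReal.ofReal_ne_top
  rw [← h1] at h2
  refine ne_top_of_le_ne_top (ENNReal.div_ne_top ENNReal.ofReal_ne_top
    (ENNReal.ofReal_pos.2 hpos).ne') (le_trans ?_ h2)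
  rw [Measure.restrict_apply' measurableSet_Ioi]
  refine measure_mono fun t ht => ⟨?_, ht.1⟩
  have : γ.toReal ≤ t := (ENNReal.le_ofReal_iff_toReal_le htop ht.1.le).1 ht.2
  refine ENNReal.ofReal_le_ofReal (sub_le_sub_left (Real.exp_le_exp.2 ?_) _)
  linarith

lemma measurable_tailMass (a : Measure ℝ) : Measurable (tailMass a) := by
  -- Monotonicity is used before `toReal`, where it needs no finiteness.
  refine Measurable.ennreal_toReal ?_
  refine Antitone.measurable fun γ γ' h => measure_mono fun t ht => ⟨ht.1, h.trans ht.2⟩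

lemma lt_iInf_prop_iff {p : Prop} {t : ℝ≥0∞} (ht : t ≠ ∞) (g : p → ℝ≥0∞) :
    t < ⨅ i, g i ↔ ∀ i, t < g i := by
  by_cases h : p
  · simp [h]
  · simp [h, ht.lt_top]

lemma lt_iInf_iff_of_finite {ι : Type*} [Finite ι] {t : ℝ≥0∞} (ht : t ≠ ∞) (g : ι → ℝ≥0∞) :
    t < ⨅ i, g i ↔ ∀ i, t < g i := by
  refine ⟨fun h i => h.trans_le (iInf_le _ i), fun h => ?_⟩
  cases isEmpty_or_nonempty ι
  · rw [iInf_of_empty]; exact ht.lt_top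
  · obtain ⟨i, hi⟩ := exists_eq_ciInf_of_finite (f := g)
    rw [← hi]; exact h i

/-- The key of a draw. -/
def Draw.key {𝒳 : Type*} {m r : ℕ} (D : Fin m → Element 𝒳) : Draw 𝒳 m r → 𝒳
  | .ppswor j => (D j).key
  | .output j _ => (D j).key
  | .hash x _ => x

/-- The draws of outputs. -/
def Draw.outputs (𝒳 : Type*) (m r : ℕ) : Set (Draw 𝒳 m r) := {d | ∃ j i, d = .output j i}

/-- The draws of outputs with key `z`. -/
def Draw.outputsOf {𝒳 : Type*} {m r : ℕ} (D : Fin m → Element 𝒳) (z : 𝒳 × Fin r) :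
    Set (Draw 𝒳 m r) := {d | ∃ j, (D j).key = z.1 ∧ d = .output j z.2}

lemma Draw.outputsOf_subset {𝒳 : Type*} {m r : ℕ} (D : Fin m → Element 𝒳) (z : 𝒳 × Fin r) :
    outputsOf D z ⊆ outputs 𝒳 m r := by
  rintro d ⟨j, -, rfl⟩; exact ⟨j, _, rfl⟩

lemma Draw.outputsOf_subset_key {𝒳 : Type*} {m r : ℕ} (D : Fin m → Element 𝒳) (z : 𝒳 × Fin r) :
    outputsOf D z ⊆ {d | d.key D = z.1} := by
  rintro d ⟨j, hj, rfl⟩; exact hj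

lemma Draw.disjoint_outputsOf {𝒳 : Type*} {m r : ℕ} (D : Fin m → Element 𝒳) (z z' : 𝒳 × Fin r)
    (h : z ≠ z') : Disjoint (outputsOf D z) (outputsOf D z') := by
  rw [Set.disjoint_left]
  rintro d ⟨j, hj, rfl⟩ ⟨j', hj', e⟩
  rw [Draw.output.injEq] at e
  obtain ⟨rfl, e⟩ := e
  exact h (Prod.ext (hj.symm.trans hj') e)

lemma Draw.disjoint_key {𝒳 : Type*} {m r : ℕ} (D : Fin m → Element 𝒳) (x x' : 𝒳) (h : x ≠ x') :
    Disjoint {d : Draw 𝒳 m r | d.key D = x} {d | d.key D = x'} := by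
  rw [Set.disjoint_left]
  exact fun d hd hd' => h (hd.symm.trans hd')

/-! ### Independence and conditional law of the seeds -/

section Model

variable {𝒳 : Type*} [DecidableEq 𝒳] {m r : ℕ} {Ω : Type*} [mΩ : MeasurableSpace Ω]
  {P : Measure Ω} {D : Fin m → Element 𝒳} {U : Draw 𝒳 m r → Ω → ℝ}

lemma measurable_minOutputOn (D : Fin m → Element 𝒳) (U : Draw 𝒳 m r → Ω → ℝ)
    (J : Finset (Fin m)) (z : 𝒳 × Fin r) :
    Measurable[sigmaOn U (Draw.outputsOf D z)] fun ω => minOutputOn D (fun d => U d ω) J z := by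
  unfold minOutputOn
  refine Measurable.iInf fun j => Measurable.iInf fun _ => Measurable.iInf fun hj => ?_
  exact ENNReal.measurable_ofReal.comp (measurable_sigmaOn ⟨j, hj, rfl⟩)

lemma iIndepFun_minOutputOn [IsProbabilityMeasure P] (hR : IsRandomness P D U)
    (J : Finset (Fin m)) :
    iIndepFun (fun (z : 𝒳 × Fin r) ω => minOutputOn D (fun d => U d ω) J z) P :=
  iIndepFun_of_sigmaOn hR.measurable hR.indep (Draw.disjoint_outputsOf D)
    (measurable_minOutputOn D U J)

lemma maxPassed_eq (ε : ℝ) (a : Measure ℝ) (D : Fin m → Element 𝒳) (u : Draw 𝒳 m r → ℝ) (x : 𝒳)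
    (i : Fin r) : maxPassed ε a D u x i =
      tailMass a (max (threshold ε (sumVal D)) (minOutputOn D u Finset.univ (x, i))) := by
  rw [Plan.minOutputOn_univ]; rfl

lemma measurable_maxPassed (ε : ℝ) (a : Measure ℝ) (D : Fin m → Element 𝒳)
    (U : Draw 𝒳 m r → Ω → ℝ) (x : 𝒳) (i : Fin r) :
    Measurable[sigmaOn U (Draw.outputsOf D (x, i))]
      fun ω => maxPassed ε a D (fun d => U d ω) x i := by
  simp only [maxPassed_eq]
  exact (measurable_tailMass a).comp
    (measurable_const.max (measurable_minOutputOn D U Finset.univ (x, i)))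

lemma maxPassed_nonneg (ε : ℝ) (a : Measure ℝ) (D : Fin m → Element 𝒳) (u : Draw 𝒳 m r → ℝ)
    (x : 𝒳) (i : Fin r) : 0 ≤ maxPassed ε a D u x i := tailMass_nonneg _ _

lemma maxPassed_le {ε : ℝ} (hε : 0 < ε) {a : Measure ℝ} (ha : FiniteTails a)
    (D : Fin m → Element 𝒳) (u : Draw 𝒳 m r → ℝ) (x : 𝒳) (i : Fin r) :
    maxPassed ε a D u x i ≤ tailMass a (threshold ε (sumVal D)) :=
  ha.antitone (threshold_ne_zero hε _) (le_max_left _ _)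

lemma headMoment_nonneg (a : Measure ℝ) (γ : ℝ≥0∞) : 0 ≤ headMoment a γ := ENNReal.toReal_nonneg

lemma freq_nonneg (hD : ∀ j, 0 < (D j).val) (x : 𝒳) : 0 ≤ freq D x :=
  Finset.sum_nonneg fun j _ => (hD j).le

/-- The weights depend on the output draws alone, so the hash and PPSWOR draws are independent of
them. -/
lemma measurable_weight_outputs (ε : ℝ) (a : Measure ℝ) (D : Fin m → Element 𝒳)
    (U : Draw 𝒳 m r → Ω → ℝ) (x : 𝒳) :
    Measurable[sigmaOn U (Draw.outputs 𝒳 m r)] fun ω => weight ε a D (fun d => U d ω) x := by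
  unfold weight
  refine Measurable.add_const (Measurable.div_const ?_ _) _
  refine Finset.measurable_fun_sum _ fun i _ => ?_
  exact (measurable_maxPassed ε a D U x i).mono (sigmaOn_mono (Draw.outputsOf_subset D _)) le_rfl

lemma measurable_weight (hR : IsRandomness P D U) (ε : ℝ) (a : Measure ℝ) (x : 𝒳) :
    Measurable fun ω => weight ε a D (fun d => U d ω) x :=
  (measurable_weight_outputs ε a D U x).mono (sigmaOn_le hR.measurable _) le_rfl

lemma weight_mem_Icc {ε : ℝ} (hε : 0 < ε) {a : Measure ℝ} (ha : FiniteTails a)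
    (hD : ∀ j, 0 < (D j).val) (hr : 0 < r) (u : Draw 𝒳 m r → ℝ) (x : 𝒳) :
    weight ε a D u x ∈ Set.Icc 0 (tailMass a (threshold ε (sumVal D)) +
      freq D x * headMoment a (threshold ε (sumVal D))) := by
  have h0 : 0 ≤ freq D x * headMoment a (threshold ε (sumVal D)) :=
    mul_nonneg (freq_nonneg hD x) (headMoment_nonneg _ _)
  have hr' : (0 : ℝ) < r := by exact_mod_cast hr
  refine ⟨add_nonneg (div_nonneg (Finset.sum_nonneg fun i _ => maxPassed_nonneg _ _ _ _ _ _)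
    hr'.le) h0, add_le_add_left ?_ _⟩
  rw [div_le_iff₀ hr']
  have := Finset.sum_le_sum (s := Finset.univ) fun i _ => maxPassed_le hε ha D u x i
  simpa [mul_comm] using this

lemma measurable_seed_key (ε : ℝ) (a : Measure ℝ) (D : Fin m → Element 𝒳)
    (U : Draw 𝒳 m r → Ω → ℝ) (x : 𝒳) :
    Measurable[sigmaOn U {d | d.key D = x}] fun ω => seed ε a D (fun d => U d ω) x := by
  have hM : ∀ i, Measurable[sigmaOn U {d | d.key D = x}]
      fun ω => maxPassed ε a D (fun d => U d ω) x i := fun i =>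
    (measurable_maxPassed ε a D U x i).mono
      (sigmaOn_mono (Draw.outputsOf_subset_key D (x, i))) le_rfl
  unfold seed
  refine Measurable.min (Measurable.iInf fun i => ?_) (Measurable.iInf fun j =>
    Measurable.iInf fun hj => Measurable.iInf fun _ => ENNReal.measurable_ofReal.comp
      (Measurable.div_const (measurable_sigmaOn (d := Draw.ppswor j) hj) _))
  have : (fun ω => ⨅ (_ : 0 < maxPassed ε a D (fun d => U d ω) x i),
      ENNReal.ofReal (r * (U (.hash x i) ω / maxPassed ε a D (fun d => U d ω) x i))) =
      fun ω => if 0 < maxPassed ε a D (fun d => U d ω) x i then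
        ENNReal.ofReal (r * (U (.hash x i) ω / maxPassed ε a D (fun d => U d ω) x i)) else ∞ := by
    funext ω; split_ifs with h <;> simp [h]
  rw [this]
  refine Measurable.ite (measurableSet_lt measurable_const (hM i)) ?_ measurable_const
  exact ENNReal.measurable_ofReal.comp
    (((measurable_sigmaOn (by exact rfl)).div (hM i)).const_mul _)

lemma measurable_seed (hR : IsRandomness P D U) (ε : ℝ) (a : Measure ℝ) (x : 𝒳) :
    Measurable fun ω => seed ε a D (fun d => U d ω) x :=
  (measurable_seed_key ε a D U x).mono (sigmaOn_le hR.measurable _) le_rfl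

lemma iIndepFun_seed [IsProbabilityMeasure P] (hR : IsRandomness P D U) (ε : ℝ) (a : Measure ℝ) :
    iIndepFun (fun x ω => seed ε a D (fun d => U d ω) x) P :=
  iIndepFun_of_sigmaOn hR.measurable hR.indep (Draw.disjoint_key D) (measurable_seed_key ε a D U)

lemma lt_seed_iff (ε : ℝ) (a : Measure ℝ) (D : Fin m → Element 𝒳) (u : Draw 𝒳 m r → ℝ)
    (hr : 0 < r) (x : 𝒳) (t : ℝ≥0) :
    (t : ℝ≥0∞) < seed ε a D u x ↔
      (∀ i, 0 < maxPassed ε a D u x i → t * maxPassed ε a D u x i / r < u (.hash x i)) ∧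
      ∀ j, (D j).key = x → 0 < headMoment a (threshold ε (sumVal D)) →
        t * headMoment a (threshold ε (sumVal D)) < u (.ppswor j) := by
  have hr' : (0 : ℝ) < r := by exact_mod_cast hr
  unfold seed
  simp only [lt_min_iff, lt_iInf_iff_of_finite ENNReal.coe_ne_top,
    lt_iInf_prop_iff ENNReal.coe_ne_top]
  rw [← ENNReal.ofReal_coe_nnreal]
  simp only [ENNReal.ofReal_lt_ofReal_iff_of_nonneg t.coe_nonneg]
  refine and_congr (forall_congr' fun i => forall_congr' fun h => ?_)
    (forall_congr' fun i => forall_congr' fun _ => forall_congr' fun h => ?_)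
  · rw [div_lt_iff₀ hr', ← mul_div_assoc, lt_div_iff₀ h, mul_comm (u _)]
  · rw [lt_div_iff₀ h]

lemma rate_pos (hD : ∀ j, 0 < (D j).val) (d : Draw 𝒳 m r) : 0 < d.rate D := by
  cases d with
  | ppswor j => exact hD j
  | output j i => exact hD j
  | hash x i => exact one_pos

lemma ae_pos [IsProbabilityMeasure P] (hR : IsRandomness P D U) (hD : ∀ j, 0 < (D j).val)
    (d : Draw 𝒳 m r) : ∀ᵐ ω ∂P, 0 < U d ω := by
  have := isProbabilityMeasure_expMeasure (rate_pos hD d)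
  have h1 : P (U d ⁻¹' Set.Ioi 0) = 1 := by
    rw [← Measure.map_apply (hR.measurable d) measurableSet_Ioi, hR.law,
      expMeasure_Ioi (rate_pos hD d) le_rfl]
    simp
  exact (prob_compl_eq_zero_iff ((hR.measurable d) measurableSet_Ioi)).2 h1

/-- The hash draws as an embedding. -/
def hashEmbedding (𝒳 : Type*) (m r : ℕ) : 𝒳 × Fin r ↪ Draw 𝒳 m r where
  toFun z := .hash z.1 z.2
  inj' z z' h := by
    simp only [Draw.hash.injEq] at h
    exact Prod.ext h.1 h.2

/-- The PPSWOR draws as an embedding. -/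
def ppsworEmbedding (𝒳 : Type*) (m r : ℕ) : Fin m ↪ Draw 𝒳 m r where
  toFun j := .ppswor j
  inj' j j' h := by simpa using h

lemma hashEmbedding_apply (z : 𝒳 × Fin r) : hashEmbedding 𝒳 m r z = .hash z.1 z.2 := rfl

lemma ppsworEmbedding_apply (j : Fin m) : ppsworEmbedding 𝒳 m r j = .ppswor j := rfl

/-- The draws that determine the seeds of the keys in `F`, given the outputs. -/
def seedDraws (D : Fin m → Element 𝒳) (r : ℕ) (F : Finset 𝒳) : Finset (Draw 𝒳 m r) :=
  ((F ×ˢ (Finset.univ : Finset (Fin r))).map (hashEmbedding 𝒳 m r)).disjUnion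
    ((Finset.univ.filter fun j => (D j).key ∈ F).map (ppsworEmbedding 𝒳 m r)) (by
      rw [Finset.disjoint_left]
      intro d hd hd'
      obtain ⟨z, -, rfl⟩ := Finset.mem_map.1 hd
      obtain ⟨j, -, h⟩ := Finset.mem_map.1 hd'
      simp [hashEmbedding_apply, ppsworEmbedding_apply] at h)

/-- The value that a draw has to exceed for the seed to exceed `t`. -/
def seedBound (ε : ℝ) (a : Measure ℝ) (D : Fin m → Element 𝒳) (t : 𝒳 → ℝ≥0)
    (u : Draw 𝒳 m r → ℝ) : Draw 𝒳 m r → ℝ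
  | .hash x i => t x * maxPassed ε a D u x i / r
  | .ppswor j => t (D j).key * headMoment a (threshold ε (sumVal D))
  | .output _ _ => 0

lemma forall_seedDraws (D : Fin m → Element 𝒳) (F : Finset 𝒳) (p : Draw 𝒳 m r → Prop) :
    (∀ d ∈ seedDraws D r F, p d) ↔
      (∀ x ∈ F, ∀ i, p (.hash x i)) ∧ ∀ j, (D j).key ∈ F → p (.ppswor j) := by
  simp only [seedDraws, Finset.mem_disjUnion, Finset.mem_map, Finset.mem_product, Finset.mem_univ,
    and_true, hashEmbedding_apply, ppsworEmbedding_apply, Prod.exists, Finset.mem_filter, true_and]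
  constructor
  · exact fun h => ⟨fun x hx i => h _ (Or.inl ⟨x, i, hx, rfl⟩),
      fun j hj => h _ (Or.inr ⟨j, hj, rfl⟩)⟩
  · rintro ⟨h1, h2⟩ d (⟨x, i, hx, rfl⟩ | ⟨j, hj, rfl⟩)
    · exact h1 x hx i
    · exact h2 j hj

/-- The exponents behind one seed add up to the weight: `maxPassed / r` from each hash draw, and `(D
j).val * B(γ)` from each PPSWOR draw, the latter summing to `ν_x B(γ)`. -/
lemma prod_seedDraws (ε : ℝ) (a : Measure ℝ) (D : Fin m → Element 𝒳) (t : 𝒳 → ℝ≥0)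
    (u : Draw 𝒳 m r → ℝ) (F : Finset 𝒳) :
    ∏ d ∈ seedDraws D r F, Real.exp (-(d.rate D * seedBound ε a D t u d)) =
      ∏ x ∈ F, Real.exp (-(weight ε a D u x * t x)) := by
  rw [seedDraws, Finset.prod_disjUnion, Finset.prod_map, Finset.prod_map, Finset.prod_product,
    ← Finset.prod_fiberwise_of_maps_to (s := Finset.univ.filter fun j => (D j).key ∈ F) (t := F)
      (g := fun j => (D j).key) (by simp), ← Finset.prod_mul_distrib]
  refine Finset.prod_congr rfl fun x hx => ?_
  rw [← Real.exp_sum, ← Real.exp_sum, ← Real.exp_add]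
  congr 1
  simp only [hashEmbedding_apply, ppsworEmbedding_apply, Draw.rate, seedBound, one_mul, Finset.sum_neg_distrib]
  rw [← neg_add, neg_inj, weight, add_mul, freq, ← Finset.sum_div, ← Finset.mul_sum,
    Finset.filter_filter]
  congr 1
  · ring
  · rw [Finset.sum_mul, Finset.sum_mul]
    have : (Finset.univ.filter fun j => (D j).key ∈ F ∧ (D j).key = x) =
        Finset.univ.filter fun j => (D j).key = x := by
      ext j; simp only [Finset.mem_filter, Finset.mem_univ, true_and]
      exact ⟨fun h => h.2, fun h => ⟨h ▸ hx, h⟩⟩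
    rw [this]
    refine Finset.sum_congr rfl fun j hj => ?_
    rw [(Finset.mem_filter.1 hj).2]; ring

lemma lintegral_mul_lt_seed [IsProbabilityMeasure P] (hR : IsRandomness P D U)
    (hD : ∀ j, 0 < (D j).val) (ε : ℝ) (a : Measure ℝ) (hr : 0 < r) (F : Finset 𝒳) (t : 𝒳 → ℝ≥0)
    {W : Ω → ℝ≥0∞} (hW : Measurable[sigmaOn U (Draw.outputs 𝒳 m r)] W) :
    ∫⁻ ω, W ω * {ω | ∀ x ∈ F, (t x : ℝ≥0∞) < seed ε a D (fun d => U d ω) x}.indicator 1 ω ∂P =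
      ∫⁻ ω, W ω * ENNReal.ofReal
        (∏ x ∈ F, Real.exp (-(weight ε a D (fun d => U d ω) x * t x))) ∂P := by
  have hB := headMoment_nonneg a (threshold ε (sumVal D))
  have hr' : (0 : ℝ) < r := by exact_mod_cast hr
  have hc0 : ∀ (d : Draw 𝒳 m r) u, 0 ≤ seedBound ε a D t u d := by
    intro d u
    cases d with
    | ppswor j => exact mul_nonneg (t _).2 hB
    | output j i => exact le_rfl
    | hash x i => exact div_nonneg (mul_nonneg (t x).2 (maxPassed_nonneg _ _ _ _ _ _)) hr'.le
  have key := lintegral_mul_prod_lt (P := P) hR.measurable hR.indep (l := fun d => d.rate D)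
    (T := Draw.outputs 𝒳 m r) (s := seedDraws D r F)
    (c := fun d ω => seedBound ε a D t (fun d => U d ω) d)
    (fun d _ => rate_pos hD d) (fun d _ => hR.law d)
    ((forall_seedDraws D F _).2 ⟨fun x _ i => by simp [Draw.outputs],
      fun j _ => by simp [Draw.outputs]⟩)
    ((forall_seedDraws D F _).2 ⟨fun x _ i => by
        simp only [seedBound]
        exact (((measurable_maxPassed ε a D U x i).mono
          (sigmaOn_mono (Draw.outputsOf_subset D _)) le_rfl).const_mul _).div_const _,
      fun j _ => by simp only [seedBound]; exact measurable_const⟩)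
    (fun d _ ω => hc0 d _) hW
  simp only [← ENNReal.ofReal_prod_of_nonneg fun _ _ => (Real.exp_pos _).le,
    prod_seedDraws, Finset.prod_boole] at key
  rw [← key]
  -- Where a weight is zero, `lt_seed_iff` imposes no condition, while `seedBound` asks the draw to
  -- exceed 0. The two agree almost surely.
  have hpos : ∀ᵐ ω ∂P, ∀ d ∈ seedDraws D r F, 0 < U d ω :=
    (Finset.eventually_all _).2 fun d _ => ae_pos hR hD d
  refine lintegral_congr_ae (hpos.mono fun ω hω => ?_)
  dsimp only
  congr 1
  rw [Set.indicator_apply]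
  simp only [Set.mem_ofPred_eq, Pi.one_apply]
  refine if_congr ?_ rfl rfl
  simp only [lt_seed_iff ε a D _ hr]
  rw [forall_seedDraws] at hω ⊢
  simp only [seedBound]
  constructor
  · refine fun h => ⟨fun x hx i => ?_, fun j hj => ?_⟩
    · rcases (maxPassed_nonneg ε a D (fun d => U d ω) x i).eq_or_lt with h0 | h0
      · rw [← h0]; simpa using hω.1 x hx i
      · exact (h x hx).1 i h0
    · rcases hB.eq_or_lt with h0 | h0
      · rw [← h0]; simpa using hω.2 j hj
      · exact (h _ hj).2 j rfl h0
  · rintro ⟨h1, h2⟩ x hx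
    exact ⟨fun i _ => h1 x hx i, fun j hj _ => by subst hj; exact h2 j hx⟩

lemma measure_lt_seed [IsProbabilityMeasure P] (hR : IsRandomness P D U)
    (hD : ∀ j, 0 < (D j).val) (ε : ℝ) (a : Measure ℝ) (hr : 0 < r) (x : 𝒳) (t : ℝ≥0) :
    P {ω | (t : ℝ≥0∞) < seed ε a D (fun d => U d ω) x} =
      ∫⁻ ω, ENNReal.ofReal (Real.exp (-(weight ε a D (fun d => U d ω) x * t))) ∂P := by
  have := lintegral_mul_lt_seed hR hD ε a hr {x} (fun _ => t) (W := fun _ => 1) measurable_const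
  simp only [one_mul, Finset.mem_singleton, forall_eq, Finset.prod_singleton] at this
  rw [← this, lintegral_indicator_one]
  exact measurableSet_lt measurable_const (measurable_seed hR ε a x)

/-- The right side is measurable for the weights, and events of the weights are events of the output
draws. So `lintegral_mul_lt_seed`, with `W` the indicator of such an event, is the defining property
of the conditional expectation. -/
lemma condExp_lt_seed [IsProbabilityMeasure P] (hR : IsRandomness P D U)
    (hD : ∀ j, 0 < (D j).val) {ε : ℝ} (hε : 0 < ε) {a : Measure ℝ} (ha : FiniteTails a)
    (hr : 0 < r) (F : Finset 𝒳) (t : 𝒳 → ℝ≥0) :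
    P⟦{ω | ∀ x ∈ F, (t x : ℝ≥0∞) < seed ε a D (fun d => U d ω) x} |
      ⨆ x, MeasurableSpace.comap (fun ω => weight ε a D (fun d => U d ω) x) inferInstance⟧
      =ᵐ[P] fun ω => ∏ x ∈ F, Real.exp (-(weight ε a D (fun d => U d ω) x * t x)) := by
  set E := {ω | ∀ x ∈ F, (t x : ℝ≥0∞) < seed ε a D (fun d => U d ω) x} with hE
  set g : Ω → ℝ := fun ω => ∏ x ∈ F, Real.exp (-(weight ε a D (fun d => U d ω) x * t x)) with hg
  have hEm : MeasurableSet E := by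
    have : E = ⋂ x ∈ F, {ω | (t x : ℝ≥0∞) < seed ε a D (fun d => U d ω) x} := by
      ext ω; simp [hE]
    rw [this]
    exact Finset.measurableSet_biInter F fun x _ =>
      measurableSet_lt measurable_const (measurable_seed hR ε a x)
  have hm : (⨆ x, MeasurableSpace.comap (fun ω => weight ε a D (fun d => U d ω) x)
      inferInstance) ≤ mΩ := iSup_le fun x => (measurable_weight hR ε a x).comap_le
  have hm' : (⨆ x, MeasurableSpace.comap (fun ω => weight ε a D (fun d => U d ω) x)
      inferInstance) ≤ sigmaOn U (Draw.outputs 𝒳 m r) :=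
    iSup_le fun x => (measurable_weight_outputs ε a D U x).comap_le
  have hgm : Measurable[⨆ x, MeasurableSpace.comap (fun ω => weight ε a D (fun d => U d ω) x)
      inferInstance] g := by
    refine Finset.measurable_fun_prod F fun x _ => Real.measurable_exp.comp ?_
    refine (Measurable.mul_const ?_ _).neg
    exact (comap_measurable _).mono
      (le_iSup (fun x => MeasurableSpace.comap (fun ω => weight ε a D (fun d => U d ω) x)
        inferInstance) x) le_rfl
  have hg0 : ∀ ω, 0 ≤ g ω := fun ω => Finset.prod_nonneg fun x _ => (Real.exp_pos _).le
  have hg1 : ∀ ω, g ω ≤ 1 := fun ω => Finset.prod_le_one (fun x _ => (Real.exp_pos _).le)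
    fun x _ => by
      rw [Real.exp_le_one_iff, neg_nonpos]
      exact mul_nonneg (weight_mem_Icc hε ha hD hr _ x).1 (t x).2
  have hgi : Integrable g P := Integrable.of_mem_Icc 0 1 (hgm.mono hm le_rfl).aemeasurable
    (ae_of_all _ fun ω => ⟨hg0 ω, hg1 ω⟩)
  refine (ae_eq_condExp_of_forall_setIntegral_eq hm ((integrable_const 1).indicator hEm)
    (fun s _ _ => hgi.integrableOn) (fun s hs _ => ?_) hgm.stronglyMeasurable.aestronglyMeasurable
    ).symm
  have hsm := hm _ hs
  have key := lintegral_mul_lt_seed hR hD ε a hr F t (W := s.indicator fun _ => 1)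
    (measurable_const.indicator (hm' _ hs))
  rw [← hE] at key
  rw [integral_eq_lintegral_of_nonneg_ae (ae_of_all _ hg0)
      (hgm.mono hm le_rfl).aestronglyMeasurable,
    integral_eq_lintegral_of_nonneg_ae (ae_of_all _ fun ω => Set.indicator_nonneg
      (fun _ _ => zero_le_one) _) ((measurable_const.indicator hEm).aestronglyMeasurable)]
  congr 1
  rw [← lintegral_indicator hsm, ← lintegral_indicator hsm]
  calc _ = ∫⁻ ω, s.indicator (fun _ => 1) ω * ENNReal.ofReal (g ω) ∂P := by
        refine lintegral_congr fun ω => ?_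
        by_cases h : ω ∈ s <;> simp [h]
    _ = _ := key.symm
    _ = _ := by
        refine lintegral_congr fun ω => ?_
        by_cases h : ω ∈ s <;> by_cases h' : ω ∈ E <;> simp [h, h']

lemma isStochasticPPSWOR_seed [IsProbabilityMeasure P] (hR : IsRandomness P D U)
    (hD : ∀ j, 0 < (D j).val) {ε : ℝ} (hε : 0 < ε) {a : Measure ℝ} (ha : FiniteTails a)
    (hr : 0 < r) :
    IsStochasticPPSWOR P (fun x ω => weight ε a D (fun d => U d ω) x)
      (fun x ω => seed ε a D (fun d => U d ω) x) := by
  have hr' : (0 : ℝ) < r := by exact_mod_cast hr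
  have hA := tailMass_nonneg a (threshold ε (sumVal D))
  have hB := headMoment_nonneg a (threshold ε (sumVal D))
  have hle : ∀ x, freq D x ≤ sumVal D := fun x =>
    Finset.sum_le_sum_of_subset_of_nonneg (Finset.filter_subset _ _) fun j _ _ => (hD j).le
  have hs : 0 ≤ sumVal D := Finset.sum_nonneg fun j _ => (hD j).le
  -- The constant `ν_x B(γ)` is spread evenly over the `r` independent summands. The last `+ 1` in
  -- `T` only ensures `0 < T`.
  refine ⟨⟨tailMass a (threshold ε (sumVal D)) / r +
      sumVal D * headMoment a (threshold ε (sumVal D)) / r + 1, fun _ => r,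
      fun q ω => maxPassed ε a D (fun d => U d ω) q.1 q.2 / r +
        freq D q.1 * headMoment a (threshold ε (sumVal D)) / r, by positivity, ?_, ?_, ?_, ?_⟩,
    measurable_seed hR ε a, condExp_lt_seed hR hD hε ha hr⟩
  · rintro ⟨x, i⟩
    exact (((measurable_maxPassed ε a D U x i).mono (sigmaOn_le hR.measurable _)
      le_rfl).div_const _).add_const _
  · refine iIndepFun_of_sigmaOn hR.measurable hR.indep
      (b := fun q : Σ _ : 𝒳, Fin r => Draw.outputsOf D (q.1, q.2)) ?_ ?_
    · rintro ⟨x, i⟩ ⟨x', i'⟩ h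
      exact Draw.disjoint_outputsOf D _ _ fun e => h (by simpa using e)
    · rintro ⟨x, i⟩
      exact ((measurable_maxPassed ε a D U x i).div_const _).add_const _
  · rintro ⟨x, i⟩ ω
    have h1 := maxPassed_nonneg ε a D (fun d => U d ω) x i
    have h2 := maxPassed_le hε ha D (fun d => U d ω) x i
    have h3 := freq_nonneg hD x
    refine ⟨by positivity, ?_⟩
    have h4 : freq D x * headMoment a (threshold ε (sumVal D)) / r ≤
        sumVal D * headMoment a (threshold ε (sumVal D)) / r := by
      gcongr; exact hle x
    have h5 : maxPassed ε a D (fun d => U d ω) x i / r ≤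
        tailMass a (threshold ε (sumVal D)) / r := by gcongr
    dsimp only
    linarith
  · intro x ω
    simp only [weight, Finset.sum_add_distrib, Finset.sum_div, Finset.sum_const,
      Finset.card_univ, Fintype.card_fin, nsmul_eq_mul]
    congr 1
    field_simp

/-- Given the weights, the law is exponential with rate at most `K`, so the survival function is
`K`-Lipschitz and has no jump at a finite point. At 0, which leaves no room on its left, the
survival probability is 1. -/
lemma measure_seed_eq [IsProbabilityMeasure P] (hR : IsRandomness P D U)
    (hD : ∀ j, 0 < (D j).val) {ε : ℝ} (hε : 0 < ε) {a : Measure ℝ} (ha : FiniteTails a)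
    (hr : 0 < r) (x : 𝒳) {t : ℝ≥0∞} (ht : t ≠ ∞) :
    P {ω | seed ε a D (fun d => U d ω) x = t} = 0 := by
  lift t to ℝ≥0 using ht
  have hm := measurable_seed hR ε a x
  rcases eq_or_ne t 0 with rfl | ht0
  · have h1 := measure_lt_seed hR hD ε a hr x 0
    simp only [ENNReal.coe_zero, NNReal.coe_zero, mul_zero, neg_zero, Real.exp_zero,
      ENNReal.ofReal_one, lintegral_const, measure_univ, one_mul] at h1
    have h2 := (prob_compl_eq_zero_iff (measurableSet_lt measurable_const hm)).2 h1
    refine measure_mono_null (fun ω hω => ?_) h2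
    simpa using hω
  set K := tailMass a (threshold ε (sumVal D)) +
    freq D x * headMoment a (threshold ε (sumVal D)) with hK
  have hK0 : 0 ≤ K := add_nonneg (tailMass_nonneg _ _)
    (mul_nonneg (freq_nonneg hD x) (headMoment_nonneg _ _))
  have hV := fun ω => weight_mem_Icc hε ha hD hr (fun d => U d ω) x
  rw [← hK] at hV
  have bound : ∀ s : ℝ≥0, s < t →
      P {ω | seed ε a D (fun d => U d ω) x = t} ≤ ENNReal.ofReal (K * (t - s)) := by
    intro s hst
    have hst' : (s : ℝ) < t := by exact_mod_cast hst
    have h1 : P {ω | seed ε a D (fun d => U d ω) x = t} +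
        P {ω | (t : ℝ≥0∞) < seed ε a D (fun d => U d ω) x} ≤
        P {ω | (s : ℝ≥0∞) < seed ε a D (fun d => U d ω) x} := by
      rw [← measure_union _ (measurableSet_lt measurable_const hm)]
      · refine measure_mono ?_
        rintro ω (h | h)
        · have h : seed ε a D (fun d => U d ω) x = t := h
          show (s : ℝ≥0∞) < seed ε a D (fun d => U d ω) x
          rw [h]; exact_mod_cast hst
        · exact lt_trans (ENNReal.coe_lt_coe.2 hst) h
      · rw [Set.disjoint_left]
        intro ω h h'
        exact absurd h' (by simp [show seed ε a D (fun d => U d ω) x = t from h])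
    have h2 : P {ω | (s : ℝ≥0∞) < seed ε a D (fun d => U d ω) x} ≤
        ENNReal.ofReal (K * (t - s)) +
          P {ω | (t : ℝ≥0∞) < seed ε a D (fun d => U d ω) x} := by
      rw [measure_lt_seed hR hD ε a hr, measure_lt_seed hR hD ε a hr]
      have : ENNReal.ofReal (K * (t - s)) = ∫⁻ _, ENNReal.ofReal (K * (t - s)) ∂P := by simp
      rw [this, ← lintegral_add_left measurable_const]
      refine lintegral_mono fun ω => ?_
      rw [← ENNReal.ofReal_add (mul_nonneg hK0 (by linarith)) (Real.exp_pos _).le]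
      refine ENNReal.ofReal_le_ofReal ?_
      set V := weight ε a D (fun d => U d ω) x
      have hV0 := (hV ω).1
      have hV1 := (hV ω).2
      have e : Real.exp (-(V * t)) = Real.exp (-(V * s)) * Real.exp (-(V * (t - s))) := by
        rw [← Real.exp_add]; ring_nf
      have i1 := Real.add_one_le_exp (-(V * (t - s)))
      have i2 : Real.exp (-(V * s)) ≤ 1 := by
        rw [Real.exp_le_one_iff, neg_nonpos]; exact mul_nonneg hV0 s.2
      have i3 : V * (t - s) ≤ K * (t - s) := mul_le_mul_of_nonneg_right hV1 (by linarith)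
      have i4 : 0 ≤ V * (t - s) := mul_nonneg hV0 (by linarith)
      rw [e]
      nlinarith [Real.exp_pos (-(V * s))]
    have h3 := h1.trans h2
    exact (ENNReal.add_le_add_iff_right (measure_ne_top _ _)).1 h3
  refine le_antisymm (le_of_forall_pos_le_add fun η hη => ?_) zero_le
  rw [zero_add]
  by_cases hη' : η = ∞
  · simp [hη']
  have hη0 : 0 < η.toReal := ENNReal.toReal_pos hη.ne' hη'
  have ht1 : (0 : ℝ) < t := by exact_mod_cast pos_iff_ne_zero.2 ht0
  obtain ⟨s, hs, hs'⟩ : ∃ s : ℝ≥0, s < t ∧ K * (t - s) ≤ η.toReal := by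
    refine ⟨Real.toNNReal (t - η.toReal / (K + 1)), ?_, ?_⟩
    · rw [← NNReal.coe_lt_coe, Real.coe_toNNReal']
      exact max_lt (by linarith [div_pos hη0 (by linarith : 0 < K + 1)]) ht1
    · rw [Real.coe_toNNReal']
      have : (t : ℝ) - max (t - η.toReal / (K + 1)) 0 ≤ η.toReal / (K + 1) := by
        linarith [le_max_left ((t : ℝ) - η.toReal / (K + 1)) 0]
      calc K * (t - max ((t : ℝ) - η.toReal / (K + 1)) 0) ≤ K * (η.toReal / (K + 1)) :=
            mul_le_mul_of_nonneg_left this hK0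
        _ ≤ η.toReal := by
            rw [← mul_div_assoc, div_le_iff₀ (by linarith)]
            nlinarith
  exact (bound s hs).trans (ENNReal.ofReal_le_of_le_toReal hs')

lemma seed_eq_top (ε : ℝ) (a : Measure ℝ) (D : Fin m → Element 𝒳) (u : Draw 𝒳 m r → ℝ) {x : 𝒳}
    (hx : x ∉ activeKeys D) : seed ε a D u x = ∞ := by
  have hx' : ∀ j, (D j).key ≠ x := by simpa [activeKeys] using hx
  have : ∀ i, maxPassed ε a D u x i = 0 := fun i => by
    simp [maxPassed, minOutput, hx', tailMass_top]
  simp [seed, this, hx']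

lemma measure_seed_eq_seed [IsProbabilityMeasure P] (hR : IsRandomness P D U)
    (hD : ∀ j, 0 < (D j).val) {ε : ℝ} (hε : 0 < ε) {a : Measure ℝ} (ha : FiniteTails a)
    (hr : 0 < r) {x z : 𝒳} (hxz : x ≠ z) :
    ∀ᵐ ω ∂P, seed ε a D (fun d => U d ω) x = seed ε a D (fun d => U d ω) z →
      seed ε a D (fun d => U d ω) x = ∞ := by
  have hx := measurable_seed hR ε a x
  have hz := measurable_seed hR ε a z
  have hmap := (indepFun_iff_map_prod_eq_prod_map_map hx.aemeasurable hz.aemeasurable).1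
    ((iIndepFun_seed hR ε a).indepFun hxz)
  have hS : MeasurableSet {p : ℝ≥0∞ × ℝ≥0∞ | p.1 = p.2 ∧ p.2 ≠ ∞} :=
    (measurableSet_eq_fun measurable_fst measurable_snd).inter
      (measurable_snd (measurableSet_singleton _).compl)
  have h0 : (P.map fun ω => (seed ε a D (fun d => U d ω) x, seed ε a D (fun d => U d ω) z))
      {p : ℝ≥0∞ × ℝ≥0∞ | p.1 = p.2 ∧ p.2 ≠ ∞} = 0 := by
    have := Measure.isProbabilityMeasure_map (μ := P) hx.aemeasurable
    have := Measure.isProbabilityMeasure_map (μ := P) hz.aemeasurable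
    rw [hmap, Measure.prod_apply_symm hS, lintegral_eq_zero_iff (measurable_measure_prodMk_right hS)]
    refine ae_of_all _ fun q => ?_
    show (P.map _) {p | p = q ∧ q ≠ ∞} = 0
    by_cases hq : q = ∞
    · simp [hq]
    · have : {p : ℝ≥0∞ | p = q ∧ q ≠ ∞} = {q} := by ext; simp [hq]
      rw [this, Measure.map_apply hx (measurableSet_singleton _)]
      exact measure_seed_eq hR hD hε ha hr x hq
  rw [Measure.map_apply (hx.prodMk hz) hS] at h0
  refine measure_mono_null (fun ω hω => ?_) h0
  have hω : ¬ (seed ε a D (fun d => U d ω) x = seed ε a D (fun d => U d ω) z →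
      seed ε a D (fun d => U d ω) x = ∞) := hω
  rw [Classical.not_imp] at hω
  exact ⟨hω.1, fun e => hω.2 (hω.1.trans e)⟩

/-- Almost surely no two keys have the same finite seed. -/
lemma ae_seed_injective [IsProbabilityMeasure P] (hR : IsRandomness P D U)
    (hD : ∀ j, 0 < (D j).val) {ε : ℝ} (hε : 0 < ε) {a : Measure ℝ} (ha : FiniteTails a)
    (hr : 0 < r) :
    ∀ᵐ ω ∂P, ∀ x z, x ≠ z → seed ε a D (fun d => U d ω) x = seed ε a D (fun d => U d ω) z →
      seed ε a D (fun d => U d ω) x = ∞ := by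
  -- The key set may be uncountable, but only the finitely many active keys can have a finite seed,
  -- so finitely many null sets suffice.
  have h : ∀ᵐ ω ∂P, ∀ x ∈ activeKeys D, ∀ z ∈ activeKeys D, x ≠ z →
      seed ε a D (fun d => U d ω) x = seed ε a D (fun d => U d ω) z →
      seed ε a D (fun d => U d ω) x = ∞ := by
    refine (Finset.eventually_all _).2 fun x _ => (Finset.eventually_all _).2 fun z _ => ?_
    by_cases hxz : x = z
    · exact ae_of_all _ fun ω h => absurd hxz h
    · filter_upwards [measure_seed_eq_seed hR hD hε ha hr hxz] with ω hω _ using hω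
  filter_upwards [h] with ω hω x z hxz e
  by_cases hx : x ∈ activeKeys D
  · by_cases hz : z ∈ activeKeys D
    · exact hω x hx z hz hxz e
    · rw [e]; exact seed_eq_top ε a D _ hz
  · exact seed_eq_top ε a D _ hx

end Model

/-! ### Inequalities for `1 - e^{-s}` and the split of the integral at the threshold -/

/-- From `e^{-s} ≤ 1 - s + s²/2` and `s/2 ≤ ε`. The first inequality holds since `(1 - s + s²/2)(1 +
s + s²/2) = 1 + s⁴/4`. -/
lemma one_sub_mul_le_one_sub_exp {ε s : ℝ} (hs : 0 ≤ s) (hsε : s ≤ 2 * ε) :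
    (1 - ε) * s ≤ 1 - Real.exp (-s) := by
  have h1 := Real.quadratic_le_exp_of_nonneg hs
  have h2 : Real.exp (-s) * Real.exp s = 1 := by rw [← Real.exp_add]; simp
  have h3 : 0 < Real.exp (-s) := Real.exp_pos _
  have h4 : Real.exp (-s) * (1 + s + s ^ 2 / 2) ≤ 1 := by nlinarith
  have h5 : Real.exp (-s) ≤ 1 - s + s ^ 2 / 2 := by
    have h6 : (1 - s + s ^ 2 / 2) * (1 + s + s ^ 2 / 2) = 1 + s ^ 4 / 4 := by ring
    have h7 : 0 < 1 + s + s ^ 2 / 2 := by positivity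
    have h8 : 0 ≤ s ^ 4 / 4 := by positivity
    refine le_of_mul_le_mul_right ?_ h7
    rw [h6]; linarith
  nlinarith

/-- Subadditivity of `1 - e^{-s}`: with `p` and `q` the two exponentials, `(1 - p)(1 - q) ≥ 0`. -/
lemma one_sub_exp_sum_le {ι : Type*} (s : Finset ι) {g : ι → ℝ} (hg : ∀ i ∈ s, 0 ≤ g i) :
    1 - Real.exp (-∑ i ∈ s, g i) ≤ ∑ i ∈ s, (1 - Real.exp (-g i)) := by
  classical
  induction s using Finset.induction_on with
  | empty => simp
  | insert i s hi ih =>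
    rw [Finset.forall_mem_insert] at hg
    rw [Finset.sum_insert hi, Finset.sum_insert hi, neg_add, Real.exp_add]
    have h1 := ih hg.2
    have h2 : Real.exp (-g i) ≤ 1 := by rw [Real.exp_le_one_iff]; linarith [hg.1]
    have h3 : Real.exp (-∑ i ∈ s, g i) ≤ 1 := by
      rw [Real.exp_le_one_iff]; linarith [Finset.sum_nonneg hg.2]
    nlinarith

lemma ofReal_lt_threshold_iff {ε σ t : ℝ} (hε : 0 < ε) (ht : 0 ≤ t) :
    ENNReal.ofReal t < threshold ε σ ↔ t * σ < 2 * ε := by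
  unfold threshold
  rw [ENNReal.lt_div_iff_mul_lt (Or.inr ENNReal.ofReal_ne_top) (Or.inl ENNReal.ofReal_ne_top),
    ← ENNReal.ofReal_mul ht, ENNReal.ofReal_lt_ofReal_iff (by linarith)]

/-- The coefficients above the threshold, whose mass is `A(γ)`. -/
def tailSet (γ : ℝ≥0∞) : Set ℝ := {t : ℝ | 0 < t ∧ γ ≤ ENNReal.ofReal t}

/-- The coefficients below the threshold. -/
def headSet (γ : ℝ≥0∞) : Set ℝ := {t : ℝ | 0 < t ∧ ENNReal.ofReal t < γ}

lemma measurableSet_tailSet (γ : ℝ≥0∞) : MeasurableSet (tailSet γ) :=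
  measurableSet_Ioi.inter (measurableSet_le measurable_const ENNReal.measurable_ofReal)

lemma measurableSet_headSet (γ : ℝ≥0∞) : MeasurableSet (headSet γ) :=
  measurableSet_Ioi.inter (measurableSet_lt ENNReal.measurable_ofReal measurable_const)

lemma setLIntegral_tail_add_head (a : Measure ℝ) (γ : ℝ≥0∞) (g : ℝ → ℝ≥0∞) :
    ∫⁻ t in tailSet γ, g t ∂a + ∫⁻ t in headSet γ, g t ∂a = ∫⁻ t in Set.Ioi 0, g t ∂a := by
  rw [← lintegral_union (measurableSet_headSet γ)]
  · congr 2
    ext t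
    simp only [tailSet, headSet, Set.mem_union, Set.mem_ofPred_eq, Set.mem_Ioi]
    rcases le_or_gt γ (ENNReal.ofReal t) with h | h
    · simp [h]
    · simp [h, not_le.2 h]
  · rw [Set.disjoint_left]
    exact fun t h h' => absurd h'.2 (not_lt.2 h.2)

lemma ofReal_tailMass {a : Measure ℝ} (ha : FiniteTails a) {γ : ℝ≥0∞} (hγ : γ ≠ 0) :
    ENNReal.ofReal (tailMass a γ) = a (tailSet γ) := ENNReal.ofReal_toReal (ha γ hγ)

/-! ### Expected weights -/

section Model

variable {𝒳 : Type*} [DecidableEq 𝒳] {m r : ℕ} {Ω : Type*} [mΩ : MeasurableSpace Ω]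
  {P : Measure Ω} {D : Fin m → Element 𝒳} {U : Draw 𝒳 m r → Ω → ℝ}

lemma freq_le_sumVal (hD : ∀ j, 0 < (D j).val) (x : 𝒳) : freq D x ≤ sumVal D :=
  Finset.sum_le_sum_of_subset_of_nonneg (Finset.filter_subset _ _) fun j _ _ => (hD j).le

lemma sum_freq (D : Fin m → Element 𝒳) : ∑ z ∈ activeKeys D, freq D z = sumVal D := by
  unfold freq sumVal
  exact Finset.sum_fiberwise_of_maps_to (fun j _ => by simp [activeKeys]) _

lemma freq_eq_zero {x : 𝒳} (hx : x ∉ activeKeys D) : freq D x = 0 := by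
  have hx' : ∀ j, (D j).key ≠ x := by simpa [activeKeys] using hx
  simp [freq, hx']

lemma measure_lt_minOutputOn [IsProbabilityMeasure P] (hR : IsRandomness P D U)
    (hD : ∀ j, 0 < (D j).val) (J : Finset (Fin m)) (z : 𝒳 × Fin r) {t : ℝ} (ht : 0 ≤ t) :
    P {ω | ENNReal.ofReal t < minOutputOn D (fun d => U d ω) J z} =
      ENNReal.ofReal (Real.exp (-((∑ j ∈ J with (D j).key = z.1, (D j).val) * t))) := by
  have hinj : Function.Injective fun j : Fin m => (Draw.output j z.2 : Draw 𝒳 m r) := by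
    intro j j' h; simpa using h
  have h := hR.indep.precomp hinj |>.measure_inter_preimage_eq_mul
    (J.filter fun j => (D j).key = z.1) (sets := fun _ => Set.Ioi t) fun _ _ => measurableSet_Ioi
  have e : {ω | ENNReal.ofReal t < minOutputOn D (fun d => U d ω) J z} =
      ⋂ j ∈ J.filter fun j => (D j).key = z.1, (U (.output j z.2)) ⁻¹' Set.Ioi t := by
    ext ω
    simp only [minOutputOn, Set.mem_ofPred_eq, lt_iInf_iff_of_finite ENNReal.ofReal_ne_top,
      lt_iInf_prop_iff ENNReal.ofReal_ne_top, ENNReal.ofReal_lt_ofReal_iff_of_nonneg ht,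
      Set.mem_iInter, Set.mem_preimage, Set.mem_Ioi, Finset.mem_filter, and_imp]
  rw [e]
  refine h.trans ?_
  rw [Finset.sum_mul, ← Finset.sum_neg_distrib, Real.exp_sum,
    ENNReal.ofReal_prod_of_nonneg fun _ _ => (Real.exp_pos _).le]
  refine Finset.prod_congr rfl fun j _ => ?_
  rw [← Measure.map_apply (hR.measurable _) measurableSet_Ioi, hR.law, expMeasure_Ioi (rate_pos hD _) ht]
  rfl

lemma measurable_minOutputOn' (hR : IsRandomness P D U) (J : Finset (Fin m)) (z : 𝒳 × Fin r) :
    Measurable fun ω => minOutputOn D (fun d => U d ω) J z :=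
  (measurable_minOutputOn D U J z).mono (sigmaOn_le hR.measurable _) le_rfl

lemma measurable_maxPassed' (hR : IsRandomness P D U) (ε : ℝ) (a : Measure ℝ) (x : 𝒳)
    (i : Fin r) : Measurable fun ω => maxPassed ε a D (fun d => U d ω) x i :=
  (measurable_maxPassed ε a D U x i).mono (sigmaOn_le hR.measurable _) le_rfl

lemma measure_minOutputOn_le [IsProbabilityMeasure P] (hR : IsRandomness P D U)
    (hD : ∀ j, 0 < (D j).val) (J : Finset (Fin m)) (z : 𝒳 × Fin r) {t : ℝ} (ht : 0 ≤ t) :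
    P {ω | minOutputOn D (fun d => U d ω) J z ≤ ENNReal.ofReal t} =
      ENNReal.ofReal (1 - Real.exp (-((∑ j ∈ J with (D j).key = z.1, (D j).val) * t))) := by
  have h := measurableSet_lt (measurable_const (a := ENNReal.ofReal t))
    (measurable_minOutputOn' hR J z)
  rw [ENNReal.ofReal_sub _ (Real.exp_pos _).le, ← measure_lt_minOutputOn hR hD J z ht,
    ENNReal.ofReal_one, ← prob_compl_eq_one_sub h]
  congr 1
  ext ω; simp

/-- Tonelli: `A(max γ M)` is the `a`-measure of the `t ≥ γ` with `M ≤ t`, and `P(M ≤ t) = 1 -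
e^{-νt}`. -/
lemma lintegral_maxPassed [IsProbabilityMeasure P] (hR : IsRandomness P D U)
    (hD : ∀ j, 0 < (D j).val) {ε : ℝ} (hε : 0 < ε) {a : Measure ℝ} (ha : FiniteTails a)
    (x : 𝒳) (i : Fin r) :
    ∫⁻ ω, ENNReal.ofReal (maxPassed ε a D (fun d => U d ω) x i) ∂P =
      ∫⁻ t in tailSet (threshold ε (sumVal D)),
        ENNReal.ofReal (1 - Real.exp (-(freq D x * t))) ∂a := by
  set γ := threshold ε (sumVal D) with hγ
  have hγ0 : γ ≠ 0 := threshold_ne_zero hε _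
  -- `a` itself need not be σ-finite; its restriction to the tail is finite, which is enough for
  -- Tonelli.
  have hfin : IsFiniteMeasure (a.restrict (tailSet γ)) := ⟨by
    rw [Measure.restrict_apply_univ]; exact (ha γ hγ0).lt_top⟩
  have hS : MeasurableSet {p : Ω × ℝ |
      minOutputOn D (fun d => U d p.1) Finset.univ (x, i) ≤ ENNReal.ofReal p.2} :=
    measurableSet_le ((measurable_minOutputOn' hR _ _).comp measurable_fst)
      (ENNReal.measurable_ofReal.comp measurable_snd)
  have h1 := Measure.prod_apply (μ := P) (ν := a.restrict (tailSet γ)) hS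
  have h2 := Measure.prod_apply_symm (μ := P) (ν := a.restrict (tailSet γ)) hS
  calc _ = ∫⁻ ω, a.restrict (tailSet γ) (Prod.mk ω ⁻¹' {p : Ω × ℝ |
      minOutputOn D (fun d => U d p.1) Finset.univ (x, i) ≤ ENNReal.ofReal p.2}) ∂P := by
        refine lintegral_congr fun ω => ?_
        rw [maxPassed_eq, ofReal_tailMass ha
          (fun e => hγ0 (le_zero_iff.1 ((le_max_left _ _).trans_eq e))),
          Measure.restrict_apply (measurable_prodMk_left hS)]
        congr 1
        ext t
        simp only [tailSet, Set.mem_ofPred_eq, Set.mem_inter_iff, Set.mem_preimage, sup_le_iff]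
        tauto
    _ = _ := h1.symm.trans h2
    _ = _ := by
        refine setLIntegral_congr_fun (measurableSet_tailSet γ) fun t ht => ?_
        exact measure_minOutputOn_le hR hD Finset.univ (x, i) ht.1.le

lemma integral_maxPassed [IsProbabilityMeasure P] (hR : IsRandomness P D U)
    (hD : ∀ j, 0 < (D j).val) {ε : ℝ} (hε : 0 < ε) {a : Measure ℝ} (ha : FiniteTails a)
    (x : 𝒳) (i : Fin r) :
    ∫ ω, maxPassed ε a D (fun d => U d ω) x i ∂P =
      (∫⁻ t in tailSet (threshold ε (sumVal D)),
        ENNReal.ofReal (1 - Real.exp (-(freq D x * t))) ∂a).toReal := by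
  rw [← lintegral_maxPassed hR hD hε ha x i, integral_eq_lintegral_of_nonneg_ae
    (ae_of_all _ fun ω => maxPassed_nonneg _ _ _ _ _ _)
    (measurable_maxPassed' hR ε a x i).aestronglyMeasurable]

lemma integrable_maxPassed [IsProbabilityMeasure P] (hR : IsRandomness P D U)
    {ε : ℝ} (hε : 0 < ε) {a : Measure ℝ} (ha : FiniteTails a) (x : 𝒳) (i : Fin r) :
    Integrable (fun ω => maxPassed ε a D (fun d => U d ω) x i) P :=
  Integrable.of_mem_Icc 0 _ (measurable_maxPassed' hR ε a x i).aemeasurable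
    (ae_of_all _ fun _ => ⟨maxPassed_nonneg _ _ _ _ _ _, maxPassed_le hε ha D _ x i⟩)

lemma integrable_weight [IsProbabilityMeasure P] (hR : IsRandomness P D U)
    {ε : ℝ} (hε : 0 < ε) {a : Measure ℝ} (ha : FiniteTails a) (x : 𝒳) :
    Integrable (fun ω => weight ε a D (fun d => U d ω) x) P :=
  ((integrable_finsetSum _ fun i _ => integrable_maxPassed hR hε ha x i).div_const _).add
    (integrable_const _)

lemma integral_weight [IsProbabilityMeasure P] (hR : IsRandomness P D U)
    (hD : ∀ j, 0 < (D j).val) {ε : ℝ} (hε : 0 < ε) {a : Measure ℝ} (ha : FiniteTails a)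
    (hr : 0 < r) (x : 𝒳) :
    ∫ ω, weight ε a D (fun d => U d ω) x ∂P =
      (∫⁻ t in tailSet (threshold ε (sumVal D)),
        ENNReal.ofReal (1 - Real.exp (-(freq D x * t))) ∂a).toReal +
      freq D x * headMoment a (threshold ε (sumVal D)) := by
  have hr' : (0 : ℝ) < r := by exact_mod_cast hr
  unfold weight
  rw [integral_add ((integrable_finsetSum _ fun i _ =>
    integrable_maxPassed hR hε ha x i).div_const _) (integrable_const _), integral_div,
    integral_finsetSum _ fun i _ => integrable_maxPassed hR hε ha x i]
  simp only [integral_maxPassed hR hD hε ha, Finset.sum_const, Finset.card_univ, Fintype.card_fin,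
    nsmul_eq_mul, integral_const, probReal_univ, one_smul]
  rw [mul_div_cancel_left₀ _ hr'.ne']

/-- Below the threshold `ν t ≤ t * sumVal D < 2ε`, hence `(1 - ε) ν t ≤ 1 - e^{-νt} ≤ ν t`. -/
lemma headMoment_bounds {f : ℝ → ℝ} {ε : ℝ} (hε : 0 < ε) (hε' : ε ≤ 1 / 2) {a : Measure ℝ}
    (hf : IsSoftConcaveSublinear a f) (hD : ∀ j, 0 < (D j).val) (x : 𝒳) :
    (∫⁻ t in headSet (threshold ε (sumVal D)),
      ENNReal.ofReal (1 - Real.exp (-(freq D x * t))) ∂a).toReal ≤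
        freq D x * headMoment a (threshold ε (sumVal D)) ∧
    (1 - ε) * (freq D x * headMoment a (threshold ε (sumVal D))) ≤
      (∫⁻ t in headSet (threshold ε (sumVal D)),
        ENNReal.ofReal (1 - Real.exp (-(freq D x * t))) ∂a).toReal := by
  set γ := threshold ε (sumVal D) with hγ
  set ν := freq D x with hν
  have hν0 : 0 ≤ ν := freq_nonneg hD x
  rcases hν0.eq_or_lt with h0 | h0
  · simp [← h0]
  have hI : ∫⁻ t in headSet γ, ENNReal.ofReal (1 - Real.exp (-(ν * t))) ∂a ≠ ∞ := by
    refine ne_top_of_le_ne_top ENNReal.ofReal_ne_top (b := ENNReal.ofReal (f ν)) ?_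
    rw [(hf ν hν0).2]
    exact lintegral_mono_set fun t ht => ht.1
  have e1 : ENNReal.ofReal ν * ∫⁻ t in headSet γ, ENNReal.ofReal t ∂a =
      ∫⁻ t in headSet γ, ENNReal.ofReal (ν * t) ∂a := by
    rw [← lintegral_const_mul _ ENNReal.measurable_ofReal]
    simp only [ENNReal.ofReal_mul hν0]
  have h1 : ∫⁻ t in headSet γ, ENNReal.ofReal (1 - Real.exp (-(ν * t))) ∂a ≤
      ENNReal.ofReal ν * ∫⁻ t in headSet γ, ENNReal.ofReal t ∂a := by
    rw [e1]
    refine lintegral_mono fun t => ENNReal.ofReal_le_ofReal ?_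
    linarith [Real.add_one_le_exp (-(ν * t))]
  have h2 : ENNReal.ofReal (1 - ε) * (ENNReal.ofReal ν * ∫⁻ t in headSet γ, ENNReal.ofReal t ∂a) ≤
      ∫⁻ t in headSet γ, ENNReal.ofReal (1 - Real.exp (-(ν * t))) ∂a := by
    rw [e1, ← lintegral_const_mul _ (by fun_prop)]
    refine setLIntegral_mono (by fun_prop) fun t ht => ?_
    rw [← ENNReal.ofReal_mul (by linarith)]
    refine ENNReal.ofReal_le_ofReal (one_sub_mul_le_one_sub_exp (mul_nonneg hν0 ht.1.le) ?_)
    have := (ofReal_lt_threshold_iff hε ht.1.le).1 ht.2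
    nlinarith [freq_le_sumVal hD x, ht.1]
  -- For `ν > 0` the bound just proved forces a finite head moment; otherwise `toReal` would turn it
  -- into 0.
  have hfin : ENNReal.ofReal ν * ∫⁻ t in headSet γ, ENNReal.ofReal t ∂a ≠ ∞ := by
    intro e
    rw [e, ENNReal.mul_top (by simp; linarith), top_le_iff] at h2
    exact hI h2
  have e2 : (ENNReal.ofReal ν * ∫⁻ t in headSet γ, ENNReal.ofReal t ∂a).toReal =
      ν * headMoment a γ := by
    rw [ENNReal.toReal_mul, ENNReal.toReal_ofReal hν0]; rfl
  refine ⟨e2 ▸ ENNReal.toReal_mono hfin h1, ?_⟩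
  have := ENNReal.toReal_mono hI h2
  rwa [ENNReal.toReal_mul, e2, ENNReal.toReal_ofReal (by linarith)] at this

lemma le_integral_weight [IsProbabilityMeasure P] (hR : IsRandomness P D U)
    (hD : ∀ j, 0 < (D j).val) {ε : ℝ} (hε : 0 < ε) (hε' : ε ≤ 1 / 2) {a : Measure ℝ}
    {f : ℝ → ℝ} (hf : IsSoftConcaveSublinear a f) (hr : 0 < r) (x : 𝒳) :
    f (freq D x) ≤ ∫ ω, weight ε a D (fun d => U d ω) x ∂P ∧
      ∫ ω, weight ε a D (fun d => U d ω) x ∂P ≤ 1 / (1 - ε) * f (freq D x) := by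
  rw [integral_weight hR hD hε hf.finiteTails hr]
  obtain ⟨h1, h2⟩ := headMoment_bounds hε hε' hf hD x
  obtain ⟨hf0, hf1⟩ := hf _ (freq_nonneg hD x)
  have hsum := setLIntegral_tail_add_head a (threshold ε (sumVal D))
    fun t => ENNReal.ofReal (1 - Real.exp (-(freq D x * t)))
  rw [← hf1] at hsum
  have hne : _ ≠ ∞ ∧ _ ≠ ∞ := ENNReal.add_ne_top.1 (hsum.trans_ne ENNReal.ofReal_ne_top)
  have hreal := congrArg ENNReal.toReal hsum
  rw [ENNReal.toReal_add hne.1 hne.2, ENNReal.toReal_ofReal hf0] at hreal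
  have hnn : 0 ≤ (∫⁻ t in tailSet (threshold ε (sumVal D)),
      ENNReal.ofReal (1 - Real.exp (-(freq D x * t))) ∂a).toReal := ENNReal.toReal_nonneg
  refine ⟨by linarith, ?_⟩
  rw [one_div, ← div_eq_inv_mul, le_div_iff₀ (by linarith)]
  nlinarith

/-- For `t ≥ γ` subadditivity and `t * sumVal D ≥ 2ε` give `∑ (1 - e^{-ν_z t}) ≥ 1 - e^{-2ε} ≥ 2ε(1
- ε) ≥ ε`. With `r ≥ k/ε` this bounds every SumMax summand of a weight by `(1/k) ∑ f(ν_z)`. -/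
lemma mul_tailMass_le_sum {f : ℝ → ℝ} {ε : ℝ} (hε : 0 < ε) (hε' : ε ≤ 1 / 2) {a : Measure ℝ}
    (hf : IsSoftConcaveSublinear a f) (hD : ∀ j, 0 < (D j).val) :
    ε * tailMass a (threshold ε (sumVal D)) ≤ ∑ z ∈ activeKeys D, f (freq D z) := by
  have hf0 : ∀ z, 0 ≤ f (freq D z) := fun z => (hf _ (freq_nonneg hD z)).1
  rw [← ENNReal.ofReal_le_ofReal_iff (Finset.sum_nonneg fun z _ => hf0 z),
    ENNReal.ofReal_mul hε.le, ofReal_tailMass hf.finiteTails (threshold_ne_zero hε _),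
    ENNReal.ofReal_sum_of_nonneg fun z _ => hf0 z]
  simp only [(hf _ (freq_nonneg hD _)).2]
  rw [← lintegral_finsetSum _ fun z _ => by fun_prop, ← setLIntegral_const]
  refine (setLIntegral_mono (by fun_prop) fun t ht => ?_).trans
    (lintegral_mono_set fun t ht => ht.1)
  have hpos : ∀ z ∈ activeKeys D, 0 ≤ freq D z * t := fun z _ =>
    mul_nonneg (freq_nonneg hD z) ht.1.le
  rw [← ENNReal.ofReal_sum_of_nonneg fun z hz => by
    rw [sub_nonneg, Real.exp_le_one_iff]; linarith [hpos z hz]]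
  refine ENNReal.ofReal_le_ofReal ((le_trans ?_ (one_sub_exp_sum_le _ hpos)))
  have h1 : 2 * ε ≤ t * sumVal D := by
    by_contra! h
    exact absurd ((ofReal_lt_threshold_iff hε ht.1.le).2 h) (not_lt.2 ht.2)
  rw [← Finset.sum_mul, sum_freq]
  have h2 : Real.exp (-(sumVal D * t)) ≤ Real.exp (-(2 * ε)) := Real.exp_le_exp.2 (by linarith)
  have h3 := one_sub_mul_le_one_sub_exp (by linarith : 0 ≤ 2 * ε) le_rfl
  nlinarith

end Model

/-! ### The inclusion threshold seen from one key -/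

section Threshold

variable {𝒳 : Type*} [DecidableEq 𝒳]

/-- The `n`-th lowest value of `g` among the keys in `A` other than `x`. -/
def othersThreshold (n : ℕ) (A : Finset 𝒳) (g : 𝒳 → ℝ≥0∞) (x : 𝒳) : ℝ≥0∞ :=
  ((A.erase x).powersetCard n).inf fun F => F.sup g

/-- Membership of `x` is expressed through a threshold that ignores `x`, hence is independent of its
seed. With fewer than `k - 1` other keys the infimum is over the empty set and equals `∞`. -/
lemma mem_trim_iff_lt_othersThreshold {k : ℕ} {s : Store 𝒳} {g : 𝒳 → ℝ≥0∞} {A : Finset 𝒳}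
    (hs : s.Represents k g) (hg : ∀ x z, x ≠ z → g x = g z → g x = ∞) (hA : ∀ x ∉ A, g x = ∞)
    (x : 𝒳) : x ∈ (s.trim (k - 1)).keys ↔ g x < othersThreshold (k - 1) A g x := by
  rw [((hs.trim (Nat.sub_le k 1)).isBottomK hg).1 x]
  constructor
  · rintro ⟨hx, hc⟩
    rw [othersThreshold, Finset.lt_inf_iff hx]
    intro F hF
    obtain ⟨hFA, hFc⟩ := Finset.mem_powersetCard.1 hF
    by_contra! hle
    rw [Finset.sup_le_iff] at hle
    have hsub : (F : Set 𝒳) ⊆ {z | g z < g x} := fun z hz => by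
      refine lt_of_le_of_ne (hle z hz) fun e => ?_
      have := hg z x (Finset.ne_of_mem_erase (hFA hz)) e
      rw [e] at this
      exact hx.ne this
    have := Set.encard_le_encard hsub
    rw [Set.encard_coe_eq_coe_finsetCard, hFc] at this
    exact absurd hc (not_lt.2 this)
  · intro h
    have hx : g x < ∞ := h.trans_le le_top
    refine ⟨hx, ?_⟩
    by_contra! hc
    obtain ⟨F, hF, hFc⟩ := Set.exists_subset_encard_eq hc
    have hfin : F.Finite := Set.finite_of_encard_eq_coe hFc
    lift F to Finset 𝒳 using hfin
    rw [Set.encard_coe_eq_coe_finsetCard, Nat.cast_inj] at hFc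
    have hmem : F ∈ (A.erase x).powersetCard (k - 1) := by
      refine Finset.mem_powersetCard.2 ⟨fun z hz => ?_, hFc⟩
      have hz' : g z < g x := hF hz
      refine Finset.mem_erase.2 ⟨fun e => absurd hz' (by simp [e]), ?_⟩
      by_contra hzA
      rw [hA z hzA] at hz'
      exact not_top_lt hz'
    rw [othersThreshold, Finset.lt_inf_iff hx] at h
    obtain ⟨z, hz, hz'⟩ := Finset.lt_sup_iff.1 (h F hmem)
    exact absurd hz' (not_lt.2 (le_of_lt (hF hz)))

/-- For a sampled key the `k`-th lowest seed of all is the `(k - 1)`-th lowest of the others, so the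
estimator divides by the probability of the event in `mem_trim_iff_lt_othersThreshold`. -/
lemma inclusionThreshold_eq {k : ℕ} {s : Store 𝒳} {g : 𝒳 → ℝ≥0∞} {A : Finset 𝒳}
    (hs : s.Represents k g) (hA : ∀ x ∉ A, g x = ∞) {x : 𝒳} (hx : x ∈ s.keys)
    (hlt : g x < othersThreshold (k - 1) A g x) :
    inclusionThreshold k s = othersThreshold (k - 1) A g x := by
  have hfin : ∀ y ∈ s.keys, g y ≠ ∞ := fun y hy => by rw [← hs.val_eq y hy]; simp
  unfold inclusionThreshold
  split_ifs with hc
  · symm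
    rw [othersThreshold, Finset.inf_eq_top_iff]
    intro F hF
    obtain ⟨hFA, hFc⟩ := Finset.mem_powersetCard.1 hF
    by_contra hne
    have hsub : insert x F ⊆ s.keys := by
      intro z hz
      rcases Finset.mem_insert.1 hz with rfl | hz
      · exact hx
      by_contra hzs
      rcases hs.outside z hzs with h | ⟨h, -⟩
      · exact hne (top_le_iff.1 (h ▸ Finset.le_sup hz))
      · omega
    have h1 := Finset.card_le_card hsub
    rw [Finset.card_insert_of_notMem fun h => (Finset.ne_of_mem_erase (hFA h)) rfl, hFc] at h1
    omega
  · have hk : s.keys.card = k := le_antisymm hs.card_le (not_lt.1 hc)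
    rw [Finset.sup_congr rfl hs.val_eq]
    refine le_antisymm ?_ ?_
    · refine Finset.le_inf fun F hF => Finset.sup_le fun y hy => ?_
      obtain ⟨hFA, hFc⟩ := Finset.mem_powersetCard.1 hF
      by_cases hyx : y = x
      · subst hyx
        exact hlt.le.trans (Finset.inf_le hF)
      by_cases hyF : y ∈ F
      · exact Finset.le_sup hyF
      have : ¬ F ⊆ s.keys.erase x := fun h => by
        refine hyF ?_
        rw [Finset.eq_of_subset_of_card_le h (by rw [Finset.card_erase_of_mem hx, hk, hFc])]
        exact Finset.mem_erase.2 ⟨hyx, hy⟩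
      obtain ⟨z, hz, hz'⟩ := Finset.not_subset.1 this
      have hzs : z ∉ s.keys := fun h =>
        hz' (Finset.mem_erase.2 ⟨Finset.ne_of_mem_erase (hFA hz), h⟩)
      refine le_trans ?_ (Finset.le_sup hz)
      rcases hs.outside z hzs with h | ⟨-, h⟩
      · simp [h]
      · exact h y hy
    · refine (Finset.inf_le (b := s.keys.erase x) ?_).trans
        (Finset.sup_mono (Finset.erase_subset _ _))
      refine Finset.mem_powersetCard.2 ⟨Finset.erase_subset_erase x fun y hy => ?_, ?_⟩
      · by_contra hyA
        exact hfin y hy (hA y hyA)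
      · rw [Finset.card_erase_of_mem hx, hk]

end Threshold

/-! ### Moments of inverse-probability estimators -/

section Estimator

variable {Ω : Type*} [mΩ : MeasurableSpace Ω] {P : Measure Ω} [IsProbabilityMeasure P]

lemma measurable_measure_lt (T : Ω → ℝ≥0∞) : Measurable fun t => P {ω | T ω < t} :=
  Monotone.measurable fun _ _ h => measure_mono fun _ hω => lt_of_lt_of_le hω h

lemma lintegral_ite_lt_of_indepFun {T τ : Ω → ℝ≥0∞} (hT : Measurable T) (hτ : Measurable τ)
    (hi : IndepFun T τ P) {h : ℝ≥0∞ → ℝ≥0∞} (hh : Measurable h) :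
    ∫⁻ ω, (if T ω < τ ω then h (τ ω) else 0) ∂P = ∫⁻ ω, h (τ ω) * P {ω' | T ω' < τ ω} ∂P := by
  have hmap := (indepFun_iff_map_prod_eq_prod_map_map hT.aemeasurable hτ.aemeasurable).1 hi
  have := Measure.isProbabilityMeasure_map (μ := P) hT.aemeasurable
  have := Measure.isProbabilityMeasure_map (μ := P) hτ.aemeasurable
  have hF : Measurable fun p : ℝ≥0∞ × ℝ≥0∞ => if p.1 < p.2 then h p.2 else 0 :=
    Measurable.ite (measurableSet_lt measurable_fst measurable_snd) (hh.comp measurable_snd)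
      measurable_const
  have e : ∫⁻ ω, (if T ω < τ ω then h (τ ω) else 0) ∂P =
      ∫⁻ p, (if p.1 < p.2 then h p.2 else 0) ∂(P.map fun ω => (T ω, τ ω)) := by
    rw [lintegral_map hF (hT.prodMk hτ)]
  rw [e, hmap, lintegral_prod_symm _ hF.aemeasurable, lintegral_map hF.lintegral_prod_left' hτ]
  refine lintegral_congr fun ω => ?_
  have : ∀ p : ℝ≥0∞, (if p < τ ω then h (τ ω) else 0) =
      (Set.Iio (τ ω)).indicator (fun _ => h (τ ω)) p := fun p => by
    simp [Set.indicator_apply]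
  simp only [this]
  rw [lintegral_indicator_const measurableSet_Iio, Measure.map_apply hT measurableSet_Iio]
  rfl

/-- Moments of the inverse-probability estimator of `w`, if the inclusion threshold `τ` is
independent of the seed `T`. -/
lemma inverseProbability_moments {T τ : Ω → ℝ≥0∞} (hT : Measurable T) (hτ : Measurable τ)
    (hi : IndepFun T τ P) {w K : ℝ} (hw : 0 ≤ w) (hK : 0 ≤ K)
    (hinv : ∫⁻ ω, (P {ω' | T ω' < τ ω})⁻¹ ∂P ≤ 1 + ENNReal.ofReal K) {Z : Ω → ℝ}
    (hZ : Z =ᵐ[P] fun ω => if T ω < τ ω then w / P.real {ω' | T ω' < τ ω} else 0) :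
    MemLp Z 2 P ∧ ∫ ω, Z ω ∂P = w ∧ variance Z P ≤ w ^ 2 * K := by
  set q : ℝ≥0∞ → ℝ≥0∞ := fun t => P {ω' | T ω' < t} with hq
  have hqm : Measurable q := measurable_measure_lt T
  have hq1 : ∀ t, q t ≠ ∞ := fun t => measure_ne_top _ _
  -- A finite mean of `1 / q(τ)` already excludes `q(τ) = 0`, so the divisions below cancel.
  have hne : ∀ᵐ ω ∂P, q (τ ω) ≠ 0 := by
    have := ae_lt_top (hqm.comp hτ).inv (ne_top_of_le_ne_top (by simp) hinv)
    filter_upwards [this] with ω hω h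
    simp only [Pi.inv_apply, Function.comp_apply, h] at hω
    simp at hω
  set Y : Ω → ℝ := fun ω => if T ω < τ ω then w / P.real {ω' | T ω' < τ ω} else 0 with hY
  have hYm : Measurable Y := Measurable.ite (measurableSet_lt hT hτ)
    (measurable_const.div (hqm.comp hτ).ennreal_toReal) measurable_const
  have hY0 : ∀ ω, 0 ≤ Y ω := fun ω => by
    simp only [hY]; split_ifs
    · exact div_nonneg hw measureReal_nonneg
    · exact le_rfl
  have hofReal : ∀ ω, q (τ ω) ≠ 0 → ENNReal.ofReal (w / P.real {ω' | T ω' < τ ω}) =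
      ENNReal.ofReal w * (q (τ ω))⁻¹ := fun ω hω => by
    have : 0 < P.real {ω' | T ω' < τ ω} := ENNReal.toReal_pos hω (hq1 _)
    rw [ENNReal.ofReal_div_of_pos this, measureReal_def, ENNReal.ofReal_toReal (hq1 _),
      ENNReal.div_eq_inv_mul, mul_comm]
  have h1 : ∫⁻ ω, ENNReal.ofReal (Y ω) ∂P = ENNReal.ofReal w := by
    have e := lintegral_ite_lt_of_indepFun hT hτ hi (h := fun t => ENNReal.ofReal w * (q t)⁻¹)
      (hqm.inv.const_mul _)
    calc _ = ∫⁻ ω, (if T ω < τ ω then ENNReal.ofReal w * (q (τ ω))⁻¹ else 0) ∂P := by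
          refine lintegral_congr_ae (hne.mono fun ω hω => ?_)
          simp only [hY]
          split_ifs
          · exact hofReal ω hω
          · simp
      _ = _ := e
      _ = ∫⁻ _, ENNReal.ofReal w ∂P := by
          refine lintegral_congr_ae (hne.mono fun ω hω => ?_)
          dsimp only
          rw [mul_assoc, ENNReal.inv_mul_cancel hω (hq1 _), mul_one]
      _ = _ := by simp
  -- Given `τ`, the second moment is `(w / q)² q = w² / q`.
  have h2 : ∫⁻ ω, ENNReal.ofReal (Y ω ^ 2) ∂P ≤ ENNReal.ofReal (w ^ 2 * (1 + K)) := by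
    have e := lintegral_ite_lt_of_indepFun hT hτ hi
      (h := fun t => (ENNReal.ofReal w * (q t)⁻¹) ^ 2) ((hqm.inv.const_mul _).pow_const 2)
    calc _ = ∫⁻ ω, (if T ω < τ ω then (ENNReal.ofReal w * (q (τ ω))⁻¹) ^ 2 else 0) ∂P := by
          refine lintegral_congr_ae (hne.mono fun ω hω => ?_)
          simp only [hY]
          split_ifs
          · rw [ENNReal.ofReal_pow (div_nonneg hw measureReal_nonneg), hofReal ω hω]
          · simp
      _ = _ := e
      _ = ∫⁻ ω, ENNReal.ofReal w ^ 2 * (q (τ ω))⁻¹ ∂P := by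
          refine lintegral_congr_ae (hne.mono fun ω hω => ?_)
          show _ * q (τ ω) = _
          rw [mul_pow, mul_assoc, pow_two (q (τ ω))⁻¹, mul_assoc,
            ENNReal.inv_mul_cancel hω (hq1 _), mul_one]
      _ = ENNReal.ofReal w ^ 2 * ∫⁻ ω, (q (τ ω))⁻¹ ∂P :=
          lintegral_const_mul _ (hqm.comp hτ).inv
      _ ≤ ENNReal.ofReal w ^ 2 * (1 + ENNReal.ofReal K) := mul_le_mul_right hinv _
      _ = _ := by
          rw [ENNReal.ofReal_mul (by positivity), ENNReal.ofReal_pow hw,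
            ENNReal.ofReal_add zero_le_one hK, ENNReal.ofReal_one]
  have hmem : MemLp Y 2 P := by
    rw [memLp_two_iff_integrable_sq hYm.aestronglyMeasurable]
    refine ⟨(hYm.pow_const 2).aestronglyMeasurable, ?_⟩
    rw [hasFiniteIntegral_iff_ofReal (ae_of_all _ fun ω => sq_nonneg _)]
    exact h2.trans_lt ENNReal.ofReal_lt_top
  have hint : ∫ ω, Y ω ∂P = w := by
    rw [integral_eq_lintegral_of_nonneg_ae (ae_of_all _ hY0) hYm.aestronglyMeasurable, h1,
      ENNReal.toReal_ofReal hw]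
  refine ⟨(memLp_congr_ae hZ).2 hmem, (integral_congr_ae hZ).trans hint, ?_⟩
  rw [variance_congr hZ, variance_eq_sub hmem, hint]
  have h3 : ∫ ω, (Y ^ 2) ω ∂P ≤ w ^ 2 * (1 + K) := by
    show ∫ ω, Y ω ^ 2 ∂P ≤ _
    rw [integral_eq_lintegral_of_nonneg_ae (ae_of_all _ fun ω => sq_nonneg _)
      (hYm.pow_const 2).aestronglyMeasurable]
    exact ENNReal.toReal_le_of_le_ofReal (by positivity) h2
  linarith

lemma div_one_add_le_one_sub_exp {y : ℝ} (hy : 0 ≤ y) : y / (1 + y) ≤ 1 - Real.exp (-y) := by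
  have h1 := Real.add_one_le_exp y
  have h2 : Real.exp (-y) * Real.exp y = 1 := by rw [← Real.exp_add]; simp
  rw [div_le_iff₀ (by linarith)]
  nlinarith [Real.exp_pos (-y)]

/-- Layer cake: `∫ P(1/τ > t) dt ≤ c + ∫_c^∞ (c/t)^j dt = c + c/(j - 1)`, where `j ≥ 2` makes the
integral converge. -/
lemma lintegral_inv_le_of_tail {τ : Ω → ℝ≥0∞} (hτ : Measurable τ) (h0 : ∀ᵐ ω ∂P, τ ω ≠ 0)
    {c : ℝ} (hc : 0 < c) {j : ℕ} (hj : 2 ≤ j)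
    (htail : ∀ t : ℝ, 0 < t → P {ω | τ ω < ENNReal.ofReal t} ≤ ENNReal.ofReal ((c * t) ^ j)) :
    ∫⁻ ω, (τ ω)⁻¹ ∂P ≤ ENNReal.ofReal (c * j / (j - 1)) := by
  have hj' : (2 : ℝ) ≤ j := by exact_mod_cast hj
  have e : ∫⁻ ω, (τ ω)⁻¹ ∂P = ∫⁻ ω, ENNReal.ofReal ((τ ω)⁻¹).toReal ∂P := by
    refine lintegral_congr_ae (h0.mono fun ω hω => ?_)
    dsimp only
    rw [ENNReal.ofReal_toReal (ENNReal.inv_ne_top.2 hω)]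
  have hm : AEMeasurable (fun ω => ((τ ω)⁻¹).toReal) P := hτ.inv.ennreal_toReal.aemeasurable
  rw [e, lintegral_eq_lintegral_meas_lt P (ae_of_all _ fun ω => ENNReal.toReal_nonneg) hm]
  have hbound : ∀ t : ℝ, 0 < t → P {ω | t < ((τ ω)⁻¹).toReal} ≤ ENNReal.ofReal ((c / t) ^ j) := by
    intro t ht
    refine (measure_mono fun ω hω => ?_).trans ((htail t⁻¹ (inv_pos.2 ht)).trans_eq (by
      rw [div_eq_mul_inv]))
    have hω : t < ((τ ω)⁻¹).toReal := hω
    have hne : (τ ω)⁻¹ ≠ ∞ := fun h => by rw [h] at hω; simp at hω; linarith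
    have h2 := (ENNReal.ofReal_lt_iff_lt_toReal ht.le hne).2 hω
    show τ ω < ENNReal.ofReal t⁻¹
    rw [ENNReal.ofReal_inv_of_pos ht]
    rwa [ENNReal.lt_inv_iff_lt_inv] at h2
  have hsplit : Set.Ioi (0 : ℝ) = Set.Ioc 0 c ∪ Set.Ioi c := (Set.Ioc_union_Ioi_eq_Ioi hc.le).symm
  rw [hsplit]
  refine (lintegral_union_le _ _ _).trans ?_
  have h1 : ∫⁻ t in Set.Ioc 0 c, P {ω | t < ((τ ω)⁻¹).toReal} ≤ ENNReal.ofReal c := by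
    refine (lintegral_mono (g := fun _ => 1) fun t => prob_le_one).trans ?_
    simp
  have h2 : ∫⁻ t in Set.Ioi c, P {ω | t < ((τ ω)⁻¹).toReal} ≤ ENNReal.ofReal (c / (j - 1)) := by
    refine (setLIntegral_mono' measurableSet_Ioi fun t ht => hbound t (hc.trans ht)).trans ?_
    have e : ∀ t ∈ Set.Ioi c, (c / t) ^ j = c ^ j * t ^ (-(j : ℝ)) := fun t ht => by
      rw [div_pow, Real.rpow_neg (hc.trans ht).le, Real.rpow_natCast, div_eq_mul_inv]
    rw [setLIntegral_congr_fun measurableSet_Ioi fun t ht => by rw [e t ht],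
      ← ofReal_integral_eq_lintegral_ofReal
        ((integrableOn_Ioi_rpow_of_lt (by linarith) hc).const_mul _)
        ((ae_restrict_iff' measurableSet_Ioi).2 (ae_of_all _ fun t ht =>
          mul_nonneg (pow_nonneg hc.le _) (Real.rpow_nonneg (hc.trans ht).le _))),
      integral_const_mul, integral_Ioi_rpow_of_lt (by linarith) hc]
    refine ENNReal.ofReal_le_ofReal (le_of_eq ?_)
    have h3 : c ^ j * c ^ (-(j : ℝ) + 1) = c := by
      rw [← Real.rpow_natCast, ← Real.rpow_add hc]
      simp
    have h4 : (-(j : ℝ) + 1) = -(j - 1) := by ring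
    rw [neg_div, h4, div_neg, neg_neg, ← mul_div_assoc, ← h4, h3]
  refine (add_le_add h1 h2).trans ?_
  rw [← ENNReal.ofReal_add hc.le (div_nonneg hc.le (by linarith))]
  refine ENNReal.ofReal_le_ofReal (le_of_eq ?_)
  have : (j : ℝ) - 1 ≠ 0 := by linarith
  field_simp
  ring

end Estimator

/-! ### Variance of the estimator -/

section Model

variable {𝒳 : Type*} [DecidableEq 𝒳] {m r : ℕ} {Ω : Type*} [mΩ : MeasurableSpace Ω]
  {P : Measure Ω} [IsProbabilityMeasure P] {D : Fin m → Element 𝒳} {U : Draw 𝒳 m r → Ω → ℝ}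

lemma measurable_othersThreshold (hR : IsRandomness P D U) (ε : ℝ) (a : Measure ℝ) (n : ℕ)
    (A : Finset 𝒳) (x : 𝒳) :
    Measurable fun ω => othersThreshold n A (fun z => seed ε a D (fun d => U d ω) z) x := by
  simp only [othersThreshold, Finset.inf_eq_iInf, Finset.sup_eq_iSup]
  refine Measurable.biInf _ (Finset.countable_toSet _) fun F _ => ?_
  exact Measurable.biSup _ (Finset.countable_toSet _) fun z _ => measurable_seed hR ε a z

lemma indepFun_seed_othersThreshold (hR : IsRandomness P D U) (ε : ℝ) (a : Measure ℝ) (n : ℕ)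
    (A : Finset 𝒳) (x : 𝒳) :
    IndepFun (fun ω => seed ε a D (fun d => U d ω) x)
      (fun ω => othersThreshold n A (fun z => seed ε a D (fun d => U d ω) z) x) P := by
  have hdis : Disjoint {d : Draw 𝒳 m r | d.key D = x} {d | d.key D ≠ x} := by
    rw [Set.disjoint_left]; exact fun d h h' => h' h
  have hm : Measurable[sigmaOn U {d | d.key D ≠ x}]
      fun ω => othersThreshold n A (fun z => seed ε a D (fun d => U d ω) z) x := by
    simp only [othersThreshold, Finset.inf_eq_iInf, Finset.sup_eq_iSup]
    refine Measurable.biInf _ (Finset.countable_toSet _) fun F hF => ?_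
    refine Measurable.biSup _ (Finset.countable_toSet _) fun z hz => ?_
    have hzx : z ≠ x := Finset.ne_of_mem_erase ((Finset.mem_powersetCard.1 hF).1 hz)
    refine (measurable_seed_key ε a D U z).mono (sigmaOn_mono fun d hd => ?_) le_rfl
    rw [Set.mem_ofPred_eq] at hd ⊢
    rwa [hd]
  rw [IndepFun_iff_Indep]
  exact indep_of_indep_of_le_left (indep_of_indep_of_le_right
    (indep_sigmaOn hR.measurable hR.indep hdis) hm.comap_le) (measurable_seed_key ε a D U x).comap_le

/-- The survival probability is the Laplace transform of the weight at `s`. The random summands lie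
in `[0, T]` and obey the chord bound; for the constant summand `(1 - e^{-Ts})/T ≤ s` suffices. -/
lemma measure_lt_seed_le (hR : IsRandomness P D U) (hD : ∀ j, 0 < (D j).val) {ε : ℝ} (hε : 0 < ε)
    {a : Measure ℝ} (ha : FiniteTails a) (hr : 0 < r) (x : 𝒳) {T : ℝ} (hT : 0 < T)
    (hAT : tailMass a (threshold ε (sumVal D)) / r ≤ T) (s : ℝ≥0) :
    P {ω | (s : ℝ≥0∞) < seed ε a D (fun d => U d ω) x} ≤
      ENNReal.ofReal (Real.exp (-((∫ ω, weight ε a D (fun d => U d ω) x ∂P) *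
        ((1 - Real.exp (-(T * s))) / T)))) := by
  have hr' : (0 : ℝ) < r := by exact_mod_cast hr
  set X : Fin r → Ω → ℝ := fun i ω => maxPassed ε a D (fun d => U d ω) x i / r with hX
  set c := freq D x * headMoment a (threshold ε (sumVal D)) with hc
  have hc0 : 0 ≤ c := mul_nonneg (freq_nonneg hD x) (headMoment_nonneg _ _)
  have hXm : ∀ i, Measurable (X i) := fun i => (measurable_maxPassed' hR ε a x i).div_const _
  have hXi : iIndepFun X P := by
    refine iIndepFun_of_sigmaOn hR.measurable hR.indep (b := fun i => Draw.outputsOf D (x, i))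
      (fun i i' h => Draw.disjoint_outputsOf D _ _ fun e => h (Prod.ext_iff.1 e).2) fun i => ?_
    exact (measurable_maxPassed ε a D U x i).div_const _
  have hXT : ∀ i ω, X i ω ∈ Set.Icc 0 T := fun i ω =>
    ⟨div_nonneg (maxPassed_nonneg _ _ _ _ _ _) hr'.le,
      (div_le_div_of_nonneg_right (maxPassed_le hε ha D _ x i) hr'.le).trans hAT⟩
  have hV : ∀ ω, weight ε a D (fun d => U d ω) x = ∑ i, X i ω + c := fun ω => by
    rw [weight, Finset.sum_div]
  have hXint : ∀ i, Integrable (X i) P := fun i => (integrable_maxPassed hR hε ha x i).div_const _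
  have hEV : ∫ ω, weight ε a D (fun d => U d ω) x ∂P = ∑ i, ∫ ω, X i ω ∂P + c := by
    simp only [hV]
    rw [integral_add (integrable_finsetSum _ fun i _ => hXint i) (integrable_const _),
      integral_finsetSum _ fun i _ => hXint i]
    simp
  have hmgf := mgf_sum_le_of_mem_Icc hXm hXi hT hXT Finset.univ (-(s : ℝ))
  have hSm : Measurable fun ω => ∑ i, X i ω := Finset.measurable_fun_sum _ fun i _ => hXm i
  rw [measure_lt_seed hR hD ε a hr, hEV]
  have e : ∀ ω, Real.exp (-(weight ε a D (fun d => U d ω) x * s)) =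
      Real.exp (-s * ∑ i, X i ω) * Real.exp (-(c * s)) := fun ω => by
    rw [hV, ← Real.exp_add]; ring_nf
  simp only [e]
  rw [← ofReal_integral_eq_lintegral_ofReal _
    (ae_of_all _ fun ω => mul_nonneg (Real.exp_pos _).le (Real.exp_pos _).le), integral_mul_const]
  · refine ENNReal.ofReal_le_ofReal ?_
    refine (mul_le_mul_of_nonneg_right hmgf (Real.exp_pos _).le).trans ?_
    rw [← Real.exp_add, Real.exp_le_exp]
    have h1 : (1 - Real.exp (-(T * s))) / T ≤ s := by
      rw [div_le_iff₀ hT]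
      linarith [Real.add_one_le_exp (-(T * s))]
    have h2 : (Real.exp (-s * T) - 1) / T = -((1 - Real.exp (-(T * s))) / T) := by
      rw [← neg_div, neg_sub]; ring_nf
    rw [h2]
    nlinarith [mul_le_mul_of_nonneg_left h1 hc0]
  · refine Integrable.mul_const (Integrable.of_mem_Icc 0 1 (by fun_prop) (ae_of_all _ fun ω => ?_)) _
    refine ⟨(Real.exp_pos _).le, ?_⟩
    rw [Real.exp_le_one_iff]
    have : 0 ≤ ∑ i, X i ω := Finset.sum_nonneg fun i _ => (hXT i ω).1
    nlinarith [s.coe_nonneg]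

/-- With `y` the exponent in `measure_lt_seed_le`, `1 - e^{-y} ≥ y/(1 + y)` gives the bound `1 +
1/y`, and `y ≥ v s/(1 + T s)` turns `1/y` into at most `(T + 1/s)/v`. Linearity in `1/t` means that
only the mean of `1/τ` is needed later. -/
lemma inv_measure_seed_lt_le (hR : IsRandomness P D U) (hD : ∀ j, 0 < (D j).val) {ε : ℝ}
    (hε : 0 < ε) {a : Measure ℝ} (ha : FiniteTails a) (hr : 0 < r) (x : 𝒳) {T : ℝ} (hT : 0 < T)
    (hAT : tailMass a (threshold ε (sumVal D)) / r ≤ T)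
    (hv : 0 < ∫ ω, weight ε a D (fun d => U d ω) x ∂P) (t : ℝ≥0∞) :
    (P {ω | seed ε a D (fun d => U d ω) x < t})⁻¹ ≤
      1 + (ENNReal.ofReal T + t⁻¹) / ENNReal.ofReal (∫ ω, weight ε a D (fun d => U d ω) x ∂P) := by
  set v := ∫ ω, weight ε a D (fun d => U d ω) x ∂P with hvdef
  have hv' : ENNReal.ofReal v ≠ 0 := (ENNReal.ofReal_pos.2 hv).ne'
  rcases eq_or_ne t 0 with rfl | ht
  · rw [ENNReal.inv_zero, add_top, ENNReal.top_div_of_ne_top ENNReal.ofReal_ne_top, add_top]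
    exact le_top
  have hfin : ∀ s : ℝ≥0, s ≠ 0 → (s : ℝ≥0∞) < t →
      (P {ω | seed ε a D (fun d => U d ω) x < t})⁻¹ ≤
        1 + (ENNReal.ofReal T + (s : ℝ≥0∞)⁻¹) / ENNReal.ofReal v := by
    intro s hs0 hst
    have hs : (0 : ℝ) < s := by exact_mod_cast pos_iff_ne_zero.2 hs0
    have h1 : P {ω | (s : ℝ≥0∞) < seed ε a D (fun d => U d ω) x}ᶜ ≤
        P {ω | seed ε a D (fun d => U d ω) x < t} := by
      refine measure_mono fun ω hω => ?_
      have hω : seed ε a D (fun d => U d ω) x ≤ s := not_lt.1 hω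
      exact hω.trans_lt hst
    rw [prob_compl_eq_one_sub (measurableSet_lt measurable_const (measurable_seed hR ε a x))] at h1
    have h2 := measure_lt_seed_le hR hD hε ha hr x hT hAT s
    rw [← hvdef] at h2
    set y := v * ((1 - Real.exp (-(T * s))) / T) with hy
    have hTs : 0 < T * s := mul_pos hT hs
    have hlow : s / (1 + T * s) ≤ (1 - Real.exp (-(T * s))) / T := by
      rw [le_div_iff₀ hT]
      refine le_trans (le_of_eq ?_) (div_one_add_le_one_sub_exp hTs.le)
      ring
    have hypos : 0 < y := mul_pos hv ((by positivity : 0 < (s : ℝ) / (1 + T * s)).trans_le hlow)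
    have h3 : ENNReal.ofReal (y / (1 + y)) ≤ P {ω | seed ε a D (fun d => U d ω) x < t} := by
      refine le_trans ?_ h1
      refine le_trans ?_ (tsub_le_tsub_left h2 1)
      rw [← ENNReal.ofReal_one, ← ENNReal.ofReal_sub _ (Real.exp_pos _).le]
      exact ENNReal.ofReal_le_ofReal (div_one_add_le_one_sub_exp hypos.le)
    refine (ENNReal.inv_le_inv.2 h3).trans ?_
    rw [← ENNReal.ofReal_inv_of_pos (by positivity)]
    have h4 : (y / (1 + y))⁻¹ ≤ 1 + (T + (s : ℝ)⁻¹) / v := by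
      have e1 : (y / (1 + y))⁻¹ = 1 + 1 / y := by field_simp; ring
      have e2 : (T + (s : ℝ)⁻¹) / v = 1 / (v * (s / (1 + T * s))) := by field_simp; ring
      rw [e1, e2]
      have : 0 < v * (s / (1 + T * s)) := by positivity
      have h5 : v * (s / (1 + T * s)) ≤ y := mul_le_mul_of_nonneg_left hlow hv.le
      linarith [one_div_le_one_div_of_le this h5]
    refine (ENNReal.ofReal_le_ofReal h4).trans (le_of_eq ?_)
    rw [ENNReal.ofReal_add zero_le_one (by positivity), ENNReal.ofReal_div_of_pos hv,
      ENNReal.ofReal_add hT.le (by positivity), ENNReal.ofReal_inv_of_pos hs,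
      ENNReal.ofReal_coe_nnreal, ENNReal.ofReal_one]
  refine ENNReal.le_of_forall_pos_le_add fun η hη _ => ?_
  have hti : t⁻¹ ≠ ∞ := ENNReal.inv_ne_top.2 ht
  have hη' : (η : ℝ≥0∞) * ENNReal.ofReal v ≠ 0 := mul_ne_zero (by exact_mod_cast hη.ne') hv'
  have hbt : t⁻¹ + η * ENNReal.ofReal v ≠ ∞ :=
    ENNReal.add_ne_top.2 ⟨hti, ENNReal.mul_ne_top ENNReal.coe_ne_top ENNReal.ofReal_ne_top⟩
  have hb0 : t⁻¹ + η * ENNReal.ofReal v ≠ 0 := fun h => hη' (add_eq_zero.1 h).2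
  -- This finite `s < t` makes the error exactly `η`, also for `t = ∞`.
  obtain ⟨s, hs⟩ : ∃ s : ℝ≥0, (s : ℝ≥0∞) = (t⁻¹ + η * ENNReal.ofReal v)⁻¹ :=
    ⟨_, ENNReal.coe_toNNReal (ENNReal.inv_ne_top.2 hb0)⟩
  have hs0 : s ≠ 0 := by
    rintro rfl
    rw [ENNReal.coe_zero, eq_comm, ENNReal.inv_eq_zero] at hs
    exact hbt hs
  have hst : (s : ℝ≥0∞) < t := by
    rw [hs, ENNReal.inv_lt_iff_inv_lt]
    exact ENNReal.lt_add_right hti hη'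
  refine (hfin s hs0 hst).trans (le_of_eq ?_)
  rw [hs, inv_inv, ← add_assoc, ENNReal.add_div (a := _ + _), ENNReal.mul_div_cancel_right hv'
    ENNReal.ofReal_ne_top, add_assoc]

lemma integral_seed_lt_le (hR : IsRandomness P D U) (hD : ∀ j, 0 < (D j).val) {ε : ℝ}
    (hε : 0 < ε) {a : Measure ℝ} (ha : FiniteTails a) (hr : 0 < r) (x : 𝒳) {t : ℝ} (ht : 0 ≤ t) :
    P.real {ω | seed ε a D (fun d => U d ω) x < ENNReal.ofReal t} ≤
      (∫ ω, weight ε a D (fun d => U d ω) x ∂P) * t := by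
  have hV := fun ω => weight_mem_Icc hε ha hD hr (fun d => U d ω) x
  have hVm := measurable_weight hR ε a x
  have hm := measurableSet_lt (measurable_const (a := ((t.toNNReal : ℝ≥0) : ℝ≥0∞)))
    (measurable_seed hR ε a x)
  have hexp : Integrable (fun ω => Real.exp (-(weight ε a D (fun d => U d ω) x * t))) P := by
    refine Integrable.of_mem_Icc 0 1 (Real.measurable_exp.comp (hVm.mul_const _).neg).aemeasurable
      (ae_of_all _ fun ω => ⟨(Real.exp_pos _).le, ?_⟩)
    rw [Real.exp_le_one_iff, neg_nonpos]
    exact mul_nonneg (hV ω).1 ht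
  have h1 : P.real {ω | ((t.toNNReal : ℝ≥0) : ℝ≥0∞) < seed ε a D (fun d => U d ω) x} =
      ∫ ω, Real.exp (-(weight ε a D (fun d => U d ω) x * t)) ∂P := by
    rw [measureReal_def, measure_lt_seed hR hD ε a hr, Real.coe_toNNReal t ht,
      integral_eq_lintegral_of_nonneg_ae (ae_of_all _ fun ω => (Real.exp_pos _).le)
        hexp.aestronglyMeasurable]
  have h2 : P.real {ω | seed ε a D (fun d => U d ω) x < ENNReal.ofReal t} ≤
      P.real {ω | ((t.toNNReal : ℝ≥0) : ℝ≥0∞) < seed ε a D (fun d => U d ω) x}ᶜ :=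
    measureReal_mono fun ω hω => by
      rw [Set.mem_compl_iff, Set.mem_ofPred_eq, not_lt]
      exact le_of_lt hω
  refine h2.trans ?_
  rw [probReal_compl_eq_one_sub hm, h1]
  have h3 : ∫ ω, (1 - weight ε a D (fun d => U d ω) x * t) ∂P ≤
      ∫ ω, Real.exp (-(weight ε a D (fun d => U d ω) x * t)) ∂P :=
    integral_mono ((integrable_const _).sub ((integrable_weight hR hε ha x).mul_const _)) hexp
      fun ω => by linarith [Real.add_one_le_exp (-(weight ε a D (fun d => U d ω) x * t))]
  rw [integral_sub (integrable_const _) ((integrable_weight hR hε ha x).mul_const _),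
    integral_mul_const] at h3
  simp at h3
  linarith

/-- The Chernoff exponent at its optimum `θ = log (b/μ)`, with the factor `e^{-μ}` dropped. -/
lemma pow_mul_exp_bound {μ b : ℝ} (hμ : 0 < μ) {j : ℕ} (hb : b = j) (hj : 0 < j) :
    Real.exp (-Real.log (b / μ) * b + μ * (Real.exp (Real.log (b / μ)) - 1)) ≤
      (Real.exp 1 * μ / b) ^ j := by
  have hb0 : 0 < b := by rw [hb]; exact_mod_cast hj
  have e1 : (Real.exp 1 * μ / b) ^ j = Real.exp (b - Real.log (b / μ) * b) := by
    have : Real.exp 1 * μ / b = Real.exp (1 - Real.log (b / μ)) := by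
      rw [Real.exp_sub, Real.exp_log (by positivity)]
      field_simp
    rw [this, ← Real.exp_nat_mul, ← hb]
    ring_nf
  rw [e1, Real.exp_le_exp, Real.exp_log (by positivity)]
  have : μ * (b / μ - 1) = b - μ := by field_simp
  rw [this]; linarith

/-- If the threshold is below `t`, then at least `j` of the other seeds are. These are independent
events, at most `V t` of them in expectation. -/
lemma measure_othersThreshold_lt_le (hR : IsRandomness P D U) (hD : ∀ j, 0 < (D j).val) {ε : ℝ}
    (hε : 0 < ε) {a : Measure ℝ} (ha : FiniteTails a) (hr : 0 < r) {j : ℕ} (hj : 0 < j)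
    (A : Finset 𝒳) (x : 𝒳) {V : ℝ} (hV : 0 < V)
    (hVsum : ∑ z ∈ A, ∫ ω, weight ε a D (fun d => U d ω) z ∂P ≤ V) {t : ℝ} (ht : 0 < t) :
    P {ω | othersThreshold j A (fun z => seed ε a D (fun d => U d ω) z) x < ENNReal.ofReal t} ≤
      ENNReal.ofReal ((Real.exp 1 * V / j * t) ^ j) := by
  have hj' : (0 : ℝ) < j := by exact_mod_cast hj
  have hμ : 0 < V * t := mul_pos hV ht
  have e0 : Real.exp 1 * V / j * t = Real.exp 1 * (V * t) / j := by ring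
  rw [e0]
  -- For `j ≤ V t` the right side is at least 1; otherwise the optimal Chernoff parameter `log (j /
  -- (V t))` is nonnegative, as required.
  rcases le_or_gt (j : ℝ) (V * t) with hle | hlt
  · refine prob_le_one.trans ?_
    rw [← ENNReal.ofReal_one]
    refine ENNReal.ofReal_le_ofReal (one_le_pow₀ ?_)
    rw [le_div_iff₀ hj', one_mul]
    nlinarith [Real.add_one_le_exp (1 : ℝ)]
  set X : 𝒳 → Ω → ℝ := fun z => {ω | seed ε a D (fun d => U d ω) z < ENNReal.ofReal t}.indicator 1
    with hX
  have hset : ∀ z, MeasurableSet {ω | seed ε a D (fun d => U d ω) z < ENNReal.ofReal t} :=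
    fun z => measurableSet_lt (measurable_seed hR ε a z) measurable_const
  have hXm : ∀ z, Measurable (X z) := fun z => measurable_one.indicator (hset z)
  have hXi : iIndepFun X P :=
    (iIndepFun_seed hR ε a).comp (fun _ => (Set.Iio (ENNReal.ofReal t)).indicator 1)
      fun _ => measurable_one.indicator measurableSet_Iio
  have hX1 : ∀ z ω, X z ω ∈ Set.Icc (0 : ℝ) 1 := fun z ω =>
    ⟨Set.indicator_nonneg (fun _ _ => zero_le_one) _,
      Set.indicator_le_self' (fun _ _ => zero_le_one) _⟩
  have hmean : ∑ z ∈ A.erase x, ∫ ω, X z ω ∂P ≤ V * t := by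
    have h1 : ∀ z, ∫ ω, X z ω ∂P ≤ (∫ ω, weight ε a D (fun d => U d ω) z ∂P) * t := fun z => by
      rw [integral_indicator_one (hset z)]
      exact integral_seed_lt_le hR hD hε ha hr z ht.le
    refine (Finset.sum_le_sum fun z _ => h1 z).trans ?_
    rw [← Finset.sum_mul]
    refine mul_le_mul_of_nonneg_right (le_trans ?_ hVsum) ht.le
    exact Finset.sum_le_sum_of_subset_of_nonneg (Finset.erase_subset _ _) fun z _ _ =>
      integral_nonneg fun ω => (weight_mem_Icc hε ha hD hr _ z).1
  have h2 := measureReal_le_sum_le hXm hXi hX1 (A.erase x) hmean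
    (θ := Real.log (j / (V * t))) (Real.log_nonneg (by rw [le_div_iff₀ hμ]; linarith)) j
  have h3 := h2.trans (pow_mul_exp_bound hμ rfl hj)
  rw [← ENNReal.ofReal_toReal (measure_ne_top P _)]
  refine ENNReal.ofReal_le_ofReal (le_trans (measureReal_mono fun ω hω => ?_) h3)
  rw [Set.mem_ofPred_eq, othersThreshold, Finset.inf_lt_iff] at hω
  obtain ⟨F, hF, hFt⟩ := hω
  obtain ⟨hFA, hFc⟩ := Finset.mem_powersetCard.1 hF
  rw [Set.mem_ofPred_eq, ← hFc]
  have h4 : ∀ z ∈ F, X z ω = 1 := fun z hz => by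
    have : seed ε a D (fun d => U d ω) z < ENNReal.ofReal t := (Finset.le_sup hz).trans_lt hFt
    simp [hX, this]
  calc (F.card : ℝ) = ∑ z ∈ F, X z ω := by rw [Finset.sum_congr rfl h4]; simp
    _ ≤ _ := Finset.sum_le_sum_of_subset_of_nonneg hFA fun z _ _ => (hX1 z ω).1

lemma ae_othersThreshold_ne_zero (hR : IsRandomness P D U) (hD : ∀ j, 0 < (D j).val) {ε : ℝ}
    (hε : 0 < ε) {a : Measure ℝ} (ha : FiniteTails a) (hr : 0 < r) {j : ℕ} (hj : 0 < j)
    (A : Finset 𝒳) (x : 𝒳) :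
    ∀ᵐ ω ∂P, othersThreshold j A (fun z => seed ε a D (fun d => U d ω) z) x ≠ 0 := by
  have h : ∀ᵐ ω ∂P, ∀ z ∈ A, seed ε a D (fun d => U d ω) z ≠ 0 :=
    (Finset.eventually_all _).2 fun z _ => by
      have := measure_seed_eq hR hD hε ha hr z ENNReal.zero_ne_top
      simpa [ae_iff] using this
  filter_upwards [h] with ω hω
  rw [← pos_iff_ne_zero, othersThreshold, Finset.lt_inf_iff ENNReal.zero_lt_top]
  intro F hF
  obtain ⟨hFA, hFc⟩ := Finset.mem_powersetCard.1 hF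
  obtain ⟨z, hz⟩ := Finset.card_pos.1 (hj.trans_eq hFc.symm)
  exact Finset.lt_sup_iff.2 ⟨z, hz, pos_iff_ne_zero.2 (hω z (Finset.mem_of_mem_erase (hFA hz)))⟩

lemma estimator_moments {k : ℕ} (hk : 3 ≤ k) {ε : ℝ} (hε : 0 < ε) (hε' : ε ≤ 1 / 2)
    {a : Measure ℝ} {f : ℝ → ℝ} (hf : IsSoftConcaveSublinear a f) (hR : IsRandomness P D U)
    (hD : ∀ j, 0 < (D j).val) (hr : r = ⌈(k : ℝ) / ε⌉₊) {p : Plan m} (hp : p.elements.Nodup)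
    (hp' : ∀ j, j ∈ p.elements) (x : 𝒳) :
    MemLp (p.estimator P k ε a f D U x) 2 P ∧
      ∫ ω, p.estimator P k ε a f D U x ω ∂P = f (freq D x) ∧
      variance (p.estimator P k ε a f D U x) P ≤
        4 * f (freq D x) * (∑ z ∈ activeKeys D, f (freq D z)) / ((1 - ε) ^ 2 * ((k : ℝ) - 2)) := by
  have hk' : (3 : ℝ) ≤ k := by exact_mod_cast hk
  have ha := hf.finiteTails
  have hkr : (k : ℝ) / ε ≤ r := hr ▸ Nat.le_ceil _
  have hr0 : (0 : ℝ) < r := lt_of_lt_of_le (by positivity) hkr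
  have hr1 : 0 < r := by exact_mod_cast hr0
  have hf0 : ∀ z, 0 ≤ f (freq D z) := fun z => (hf _ (freq_nonneg hD z)).1
  set w := f (freq D x) with hw
  set W := ∑ z ∈ activeKeys D, f (freq D z) with hW
  rcases (hf0 x).eq_or_lt with h0 | h0
  · have : p.estimator P k ε a f D U x = 0 := by
      funext ω; simp [Plan.estimator, estimate, ← h0]
    rw [this, hw, ← h0]
    simp
  have hx : x ∈ activeKeys D := by
    by_contra hx
    have h2 := (hf 0 le_rfl).2
    simp only [zero_mul, neg_zero, Real.exp_zero, sub_self, ENNReal.ofReal_zero, lintegral_zero,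
      ENNReal.ofReal_eq_zero] at h2
    rw [freq_eq_zero hx] at h0
    linarith
  have hwW : w ≤ W := Finset.single_le_sum (f := fun z => f (freq D z)) (fun z _ => hf0 z) hx
  have hW0 : 0 < W := h0.trans_le hwW
  set v := ∫ ω, weight ε a D (fun d => U d ω) x ∂P with hv
  have hwv : w ≤ v := (le_integral_weight hR hD hε hε' hf hr1 x).1
  have hv0 : 0 < v := h0.trans_le hwv
  have hAT : tailMass a (threshold ε (sumVal D)) / r ≤ W / k := by
    have h1 := mul_tailMass_le_sum hε hε' hf hD
    rw [div_le_div_iff₀ hr0 (by linarith)]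
    have h2 : (k : ℝ) ≤ r * ε := by rwa [div_le_iff₀ hε] at hkr
    nlinarith [tailMass_nonneg a (threshold ε (sumVal D))]
  have hε1 : 0 < 1 - ε := by linarith
  set V := 1 / (1 - ε) * W with hVdef
  have hV0 : 0 < V := by positivity
  have hVsum : ∑ z ∈ activeKeys D, ∫ ω, weight ε a D (fun d => U d ω) z ∂P ≤ V := by
    rw [hVdef, hW, Finset.mul_sum]
    exact Finset.sum_le_sum fun z _ => (le_integral_weight hR hD hε hε' hf hr1 z).2
  set τ := fun ω => othersThreshold (k - 1) (activeKeys D)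
    (fun z => seed ε a D (fun d => U d ω) z) x with hτ
  have hτm : Measurable τ := measurable_othersThreshold hR ε a _ _ x
  have hjc : ((k - 1 : ℕ) : ℝ) = k - 1 := by rw [Nat.cast_sub (by omega)]; simp
  have hinvτ := lintegral_inv_le_of_tail hτm
    (ae_othersThreshold_ne_zero hR hD hε ha hr1 (by omega : 0 < k - 1) _ x)
    (c := Real.exp 1 * V / (k - 1 : ℕ)) (by
      have : (0 : ℝ) < (k - 1 : ℕ) := by rw [hjc]; linarith
      positivity) (j := k - 1) (by omega)
    fun t ht => measure_othersThreshold_lt_le hR hD hε ha hr1 (by omega) _ x hV0 hVsum ht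
  -- This is `c * j / (j - 1)` with `j = k - 1`, the origin of `k - 2` in the variance bound.
  have hc : Real.exp 1 * V / (k - 1 : ℕ) * (k - 1 : ℕ) / ((k - 1 : ℕ) - 1) =
      Real.exp 1 * V / (k - 2) := by
    rw [hjc, div_mul_cancel₀ _ (by linarith)]; ring_nf
  rw [hc] at hinvτ
  have hk2 : (0 : ℝ) < k - 2 := by linarith
  set K := (W / k + Real.exp 1 * V / (k - 2)) / v with hK
  have hinv : ∫⁻ ω, (P {ω' | seed ε a D (fun d => U d ω') x < τ ω})⁻¹ ∂P ≤
      1 + ENNReal.ofReal K := by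
    have hv' : ENNReal.ofReal v ≠ 0 := (ENNReal.ofReal_pos.2 hv0).ne'
    calc _ ≤ ∫⁻ ω, (1 + (ENNReal.ofReal (W / k) + (τ ω)⁻¹) / ENNReal.ofReal v) ∂P :=
          lintegral_mono fun ω => inv_measure_seed_lt_le hR hD hε ha hr1 x
            (div_pos hW0 (by linarith)) hAT hv0 (τ ω)
      _ = 1 + (ENNReal.ofReal (W / k) + ∫⁻ ω, (τ ω)⁻¹ ∂P) / ENNReal.ofReal v := by
          simp only [div_eq_mul_inv]
          rw [lintegral_add_left measurable_const,
            lintegral_mul_const' _ _ (ENNReal.inv_ne_top.2 hv'),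
            lintegral_add_left measurable_const]
          simp
      _ ≤ 1 + (ENNReal.ofReal (W / k) + ENNReal.ofReal (Real.exp 1 * V / (k - 2))) /
          ENNReal.ofReal v := by gcongr
      _ = _ := by
          rw [hK, ENNReal.ofReal_div_of_pos hv0, ENNReal.ofReal_add (by positivity) (by positivity)]
  have hZ : p.estimator P k ε a f D U x =ᵐ[P] fun ω =>
      if seed ε a D (fun d => U d ω) x < τ ω then
        w / P.real {ω' | seed ε a D (fun d => U d ω') x < τ ω} else 0 := by
    filter_upwards [ae_seed_injective hR hD hε ha hr1] with ω hω
    have hs := Plan.represents_sample (by omega : 1 ≤ k) hε ha hD (fun d => U d ω) hr1 hp hp'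
    have hA : ∀ z ∉ activeKeys D, seed ε a D (fun d => U d ω) z = ∞ := fun z hz =>
      seed_eq_top ε a D _ hz
    have hiff := mem_trim_iff_lt_othersThreshold hs hω hA x
    unfold Plan.estimator estimate
    by_cases hmem : x ∈ ((p.sample k ε a D fun d => U d ω).trim (k - 1)).keys
    · have hlt := hiff.1 hmem
      rw [if_pos hmem, if_pos hlt, inclusionThreshold_eq hs hA
        ((Store.isTrim_trim _ _).subset hmem) hlt]
    · rw [if_neg hmem, if_neg fun h => hmem (hiff.2 h)]
  obtain ⟨h1, h2, h3⟩ := inverseProbability_moments (measurable_seed hR ε a x) hτm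
    (indepFun_seed_othersThreshold hR ε a _ _ x) h0.le (by positivity) hinv hZ
  refine ⟨h1, h2, h3.trans ?_⟩
  -- One factor `w` is absorbed by the denominator of `K`, since `w ≤ v`.
  have hwK : w ^ 2 * K ≤ w * (W / k + Real.exp 1 * V / (k - 2)) := by
    rw [hK, ← mul_div_assoc, div_le_iff₀ hv0]
    have : 0 ≤ w * (W / k + Real.exp 1 * V / (k - 2)) := by positivity
    nlinarith
  refine hwK.trans ?_
  rw [le_div_iff₀ (by positivity)]
  have h4 : W / k ≤ W / (k - 2) := div_le_div_of_nonneg_left hW0.le hk2 (by linarith)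
  have h5 : w * (W / k + Real.exp 1 * V / (k - 2)) ≤ w * (W / (k - 2) + Real.exp 1 * V / (k - 2)) := by
    gcongr
  have h6 : w * (W / (k - 2) + Real.exp 1 * V / (k - 2)) * ((1 - ε) ^ 2 * (k - 2)) =
      w * W * ((1 - ε) * (1 - ε + Real.exp 1)) := by
    rw [hVdef]; field_simp
  -- The origin of the constant 4: the left side is at most `1 + e`.
  have h7 : (1 - ε) * (1 - ε + Real.exp 1) ≤ 4 := by
    have := Real.exp_one_lt_d9
    nlinarith
  calc _ ≤ w * (W / (k - 2) + Real.exp 1 * V / (k - 2)) * ((1 - ε) ^ 2 * (k - 2)) := by gcongr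
    _ = _ := h6
    _ ≤ w * W * 4 := by gcongr
    _ = _ := by ring

end Model

/-! ### Size of SideLine and expected space -/

lemma measurable_card_filter {Ω κ : Type*} [MeasurableSpace Ω] (A : Finset κ) {q : Ω → κ → Prop}
    [∀ ω, DecidablePred (q ω)] (hq : ∀ x, MeasurableSet {ω | q ω x}) :
    Measurable fun ω => (A.filter (q ω)).card := by
  simp only [Finset.card_filter]
  exact Finset.measurable_fun_sum A fun x _ => Measurable.ite (hq x) measurable_const
    measurable_const

section Model

variable {𝒳 : Type*} [DecidableEq 𝒳] {m r : ℕ} {Ω : Type*} [mΩ : MeasurableSpace Ω]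
  {P : Measure Ω} {D : Fin m → Element 𝒳} {U : Draw 𝒳 m r → Ω → ℝ}

/-- All the keys of outputs. -/
def outputKeys (D : Fin m → Element 𝒳) (r : ℕ) : Finset (𝒳 × Fin r) :=
  activeKeys D ×ˢ Finset.univ

lemma minOutputOn_eq_top (u : Draw 𝒳 m r → ℝ) (J : Finset (Fin m)) {z : 𝒳 × Fin r}
    (hz : z ∉ outputKeys D r) : minOutputOn D u J z = ∞ := by
  have hx' : ∀ j, (D j).key ≠ z.1 := by simpa [activeKeys, outputKeys] using hz
  simp [minOutputOn, hx']

lemma minOutputOn_anti (u : Draw 𝒳 m r → ℝ) {J J' : Finset (Fin m)} (h : J ⊆ J')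
    (z : 𝒳 × Fin r) : minOutputOn D u J' z ≤ minOutputOn D u J z :=
  biInf_mono fun _ hj => h hj

/-- The number of output keys whose minimum value, over the elements in `J`, is less than `γ`. -/
def pendingCount (D : Fin m → Element 𝒳) (u : Draw 𝒳 m r → ℝ) (J : Finset (Fin m)) (γ : ℝ≥0∞) :
    ℕ := ((outputKeys D r).filter fun z => minOutputOn D u J z < γ).card

/-- A single count with a larger set and a larger threshold dominates a whole range of times of a
stream. -/
lemma pendingCount_mono (u : Draw 𝒳 m r → ℝ) {J J' : Finset (Fin m)} (h : J ⊆ J') {γ γ' : ℝ≥0∞}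
    (hγ : γ ≤ γ') : pendingCount D u J γ ≤ pendingCount D u J' γ' := by
  refine Finset.card_le_card fun z hz => ?_
  rw [Finset.mem_filter] at hz ⊢
  exact ⟨hz.1, (minOutputOn_anti u h z).trans_lt (hz.2.trans_le hγ)⟩

lemma pendingCount_empty (u : Draw 𝒳 m r → ℝ) (γ : ℝ≥0∞) : pendingCount D u ∅ γ = 0 := by
  simp [pendingCount, minOutputOn]

lemma pend_ne_top_iff {γ M : ℝ≥0∞} : pend γ M ≠ ∞ ↔ M < γ := by
  unfold pend
  split_ifs with h
  · simp [h, (h.trans_le le_top).ne]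
  · simp [h]

namespace Plan

lemma card_sideline {k : ℕ} {ε : ℝ} {a : Measure ℝ} {u : Draw 𝒳 m r → ℝ} {p : Plan m}
    {s : Sketch 𝒳 r} (h : RunSpec k ε a D u p s) :
    s.sideline.keys.card =
      pendingCount D u p.elements.toFinset (threshold ε (p.total D)) := by
  unfold pendingCount
  congr 1
  ext z
  rw [Store.mem_keys_iff_value, h.sideline_eq, pend_ne_top_iff, Finset.mem_filter]
  refine ⟨fun hz => ⟨?_, hz⟩, fun hz => hz.2⟩
  by_contra hz'
  rw [minOutputOn_eq_top u _ hz'] at hz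
  exact not_top_lt hz

lemma space_le {k : ℕ} {ε : ℝ} {a : Measure ℝ} {u : Draw 𝒳 m r → ℝ} {p : Plan m}
    {s : Sketch 𝒳 r} (h : RunSpec k ε a D u p s) :
    s.space ≤ 3 * pendingCount D u p.elements.toFinset (threshold ε (p.total D)) + 4 * k + 2 := by
  unfold Sketch.space
  rw [card_sideline h]
  have h1 := h.summax.card_le
  have h2 := h.ppswor.card_le
  omega

lemma measurable_passed (hR : IsRandomness P D U) (ε : ℝ) (a : Measure ℝ) (p : Plan m)
    (z : 𝒳 × Fin r) : Measurable fun ω => passed ε a D (fun d => U d ω) p z := by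
  have hpend : ∀ (γ : ℝ≥0∞) (J : Finset (Fin m)),
      Measurable fun ω => pend γ (minOutputOn D (fun d => U d ω) J z) := fun γ J =>
    Measurable.ite (measurableSet_lt (measurable_minOutputOn' hR J z) measurable_const)
      (measurable_minOutputOn' hR J z) measurable_const
  have hpass : ∀ (γ : ℝ≥0∞) (b : Ω → ℝ≥0∞), Measurable b → Measurable fun ω => pass a γ (b ω) :=
    fun γ b hb => Measurable.ite (measurableSet_le measurable_const hb)
      ((measurable_tailMass a).comp hb) measurable_const
  induction p with
  | init => exact measurable_const
  | process p j ih =>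
    refine (ih.max measurable_const).max (hpass _ _ ((hpend _ _).min ?_))
    simp only [pend_top]
    split_ifs
    · exact ENNReal.measurable_ofReal.comp (hR.measurable _)
    · exact measurable_const
  | merge p q ihp ihq => exact (ihp.max ihq).max (hpass _ _ ((hpend _ _).min (hpend _ _)))

/-- The contents of the structures depend on arbitrary tie-breaking, but their sizes are `min k` of
numbers of keys that satisfy measurable conditions. -/
lemma measurable_space (hR : IsRandomness P D U) (hD : ∀ j, 0 < (D j).val) {k : ℕ} (hk : 1 ≤ k)
    {ε : ℝ} (hε : 0 < ε) {a : Measure ℝ} (ha : FiniteTails a) (p : Plan m) :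
    Measurable fun ω => (run k ε a D (fun d => U d ω) p).space := by
  have hspec := fun ω => runSpec_run hk hε a hD (fun d => U d ω) p
  have h1 : ∀ ω, (run k ε a D (fun d => U d ω) p).ppswor.keys.card =
      min k ((activeKeys D).filter fun x =>
        minPpswor D (fun d => U d ω) p.elements.toFinset x ≠ ∞).card := fun ω => by
    refine (hspec ω).ppswor.card_eq fun x => ?_
    rw [Finset.mem_filter]
    refine ⟨fun h => h.2, fun h => ⟨?_, h⟩⟩
    by_contra hx
    have hx' : ∀ j, (D j).key ≠ x := by simpa [activeKeys] using hx
    exact h (by simp [minPpswor, hx'])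
  have h2 : ∀ ω, (run k ε a D (fun d => U d ω) p).summax.keys.card =
      min k ((activeKeys D).filter fun x =>
        ∃ i, 0 < passed ε a D (fun d => U d ω) p (x, i)).card := fun ω => by
    refine (hspec ω).summax.card_eq fun x => ?_
    have h3 : passedMin (fun z => U (.hash z.1 z.2) ω) (passed ε a D (fun d => U d ω) p) x ≠ ∞ ↔
        ∃ i, 0 < passed ε a D (fun d => U d ω) p (x, i) := by
      simp [passedMin, iInf_eq_top]
    rw [Finset.mem_filter, h3]
    refine ⟨fun h => h.2, fun h => ⟨?_, h⟩⟩
    by_contra hx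
    obtain ⟨i, hi⟩ := h
    have := (passSpec_passed hε ha hD (fun d => U d ω) p (x, i)).le
    rw [minOutputOn_eq_top _ _ (by simp [outputKeys, hx]), max_eq_right le_top, tailMass_top]
      at this
    linarith
  unfold Sketch.space
  simp only [h1, h2, card_sideline (hspec _)]
  have m1 : Measurable fun ω => pendingCount D (fun d => U d ω) p.elements.toFinset
      (threshold ε (p.total D)) := measurable_card_filter _ fun z =>
    measurableSet_lt (measurable_minOutputOn' hR _ z) measurable_const
  have m2 : Measurable fun ω => ((activeKeys D).filter fun x =>
        ∃ i, 0 < passed ε a D (fun d => U d ω) p (x, i)).card := by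
    refine measurable_card_filter _ fun x => ?_
    have : {ω | ∃ i, 0 < passed ε a D (fun d => U d ω) p (x, i)} =
        ⋃ i, {ω | 0 < passed ε a D (fun d => U d ω) p (x, i)} := by ext ω; simp
    rw [this]
    exact MeasurableSet.iUnion fun i =>
      measurableSet_lt measurable_const (measurable_passed hR ε a p (x, i))
  have m3 : Measurable fun ω => ((activeKeys D).filter fun x =>
        minPpswor D (fun d => U d ω) p.elements.toFinset x ≠ ∞).card := by
    refine measurable_card_filter _ fun x => ?_
    have hm : Measurable fun ω => minPpswor D (fun d => U d ω) p.elements.toFinset x :=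
      Measurable.iInf fun j => Measurable.iInf fun _ => Measurable.iInf fun _ =>
        ENNReal.measurable_ofReal.comp (hR.measurable _)
    exact hm (measurableSet_singleton ∞).compl
  exact (((m1.const_mul 3).add ((measurable_const.min m2).const_mul 2)).add
    ((measurable_const.min m3).const_mul 2)).add_const 2

lemma total_eq_sum {p : Plan m} (hp : p.elements.Nodup) :
    p.total D = ∑ j ∈ p.elements.toFinset, (D j).val := by
  rw [total, List.sum_toFinset _ hp]

end Plan

variable [IsProbabilityMeasure P]

/-- The indicator of the event that the minimum value of an output key is less than `γ`. -/
def pendingIndicator (D : Fin m → Element 𝒳) (U : Draw 𝒳 m r → Ω → ℝ) (J : Finset (Fin m))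
    (γ : ℝ≥0∞) (z : 𝒳 × Fin r) : Ω → ℝ :=
  {ω | minOutputOn D (fun d => U d ω) J z < γ}.indicator 1

lemma pendingCount_eq_sum (J : Finset (Fin m)) (γ : ℝ≥0∞) (ω : Ω) :
    (pendingCount D (fun d => U d ω) J γ : ℝ) =
      ∑ z ∈ outputKeys D r, pendingIndicator D U J γ z ω := by
  simp only [pendingCount, pendingIndicator, Set.indicator_apply, Set.mem_ofPred_eq, Pi.one_apply]
  rw [Finset.sum_boole]

lemma measurable_pendingIndicator (hR : IsRandomness P D U) (J : Finset (Fin m)) (γ : ℝ≥0∞)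
    (z : 𝒳 × Fin r) : Measurable (pendingIndicator D U J γ z) :=
  measurable_one.indicator (measurableSet_lt (measurable_minOutputOn' hR J z) measurable_const)

lemma pendingIndicator_mem_Icc (J : Finset (Fin m)) (γ : ℝ≥0∞) (z : 𝒳 × Fin r) (ω : Ω) :
    pendingIndicator D U J γ z ω ∈ Set.Icc (0 : ℝ) 1 :=
  ⟨Set.indicator_nonneg (fun _ _ => zero_le_one) _,
    Set.indicator_le_self' (fun _ _ => zero_le_one) _⟩

/-- An exponential is below `θ` with probability at most its rate times `θ`, and the rates add up
over the keys, `r` times each. For `θ = 2ε / sum` the total is `2εr`, whatever the data. -/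
lemma sum_integral_pendingIndicator_le (hR : IsRandomness P D U) (hD : ∀ j, 0 < (D j).val)
    (J : Finset (Fin m)) {θ : ℝ} (hθ : 0 ≤ θ) :
    ∑ z ∈ outputKeys D r, ∫ ω, pendingIndicator D U J (ENNReal.ofReal θ) z ω ∂P ≤
      r * ((∑ j ∈ J, (D j).val) * θ) := by
  have h1 : ∀ z : 𝒳 × Fin r, ∫ ω, pendingIndicator D U J (ENNReal.ofReal θ) z ω ∂P ≤
      (∑ j ∈ J with (D j).key = z.1, (D j).val) * θ := fun z => by
    unfold pendingIndicator
    have h0 : 0 ≤ (∑ j ∈ J with (D j).key = z.1, (D j).val) * θ :=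
      mul_nonneg (Finset.sum_nonneg fun j _ => (hD j).le) hθ
    rw [integral_indicator_one (measurableSet_lt (measurable_minOutputOn' hR J z)
      measurable_const)]
    refine ENNReal.toReal_le_of_le_ofReal h0 ?_
    have hle : P {ω | minOutputOn D (fun d => U d ω) J z < ENNReal.ofReal θ} ≤
        P {ω | minOutputOn D (fun d => U d ω) J z ≤ ENNReal.ofReal θ} :=
      measure_mono fun ω hω => le_of_lt (show minOutputOn D (fun d => U d ω) J z < _ from hω)
    refine hle.trans
      ((measure_minOutputOn_le hR hD J z hθ).trans_le (ENNReal.ofReal_le_ofReal ?_))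
    linarith [Real.add_one_le_exp (-((∑ j ∈ J with (D j).key = z.1, (D j).val) * θ))]
  refine (Finset.sum_le_sum fun z _ => h1 z).trans (le_of_eq ?_)
  rw [outputKeys, Finset.sum_product]
  simp only [Finset.sum_const, Finset.card_univ, Fintype.card_fin, nsmul_eq_mul]
  rw [← Finset.mul_sum, ← Finset.sum_mul,
    Finset.sum_fiberwise_of_maps_to (fun j _ => by simp [activeKeys])]

lemma measure_le_pendingCount_le (hR : IsRandomness P D U) (hD : ∀ j, 0 < (D j).val)
    (J : Finset (Fin m)) {θ μ : ℝ} (hθ : 0 ≤ θ) (hμ : r * ((∑ j ∈ J, (D j).val) * θ) ≤ μ)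
    (b : ℝ) :
    P {ω | b ≤ (pendingCount D (fun d => U d ω) J (ENNReal.ofReal θ) : ℝ)} ≤
      ENNReal.ofReal (Real.exp (-b + μ * (Real.exp 1 - 1))) := by
  have hi : iIndepFun (pendingIndicator D U J (ENNReal.ofReal θ)) P :=
    (iIndepFun_minOutputOn hR J).comp (fun _ => (Set.Iio (ENNReal.ofReal θ)).indicator 1)
      fun _ => measurable_one.indicator measurableSet_Iio
  have := measureReal_le_sum_le (measurable_pendingIndicator hR J _) hi
    (pendingIndicator_mem_Icc J _) (outputKeys D r)
    ((sum_integral_pendingIndicator_le hR hD J hθ).trans hμ) zero_le_one b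
  simp only [pendingCount_eq_sum]
  rw [← ENNReal.ofReal_toReal (measure_ne_top P _)]
  refine ENNReal.ofReal_le_ofReal (this.trans_eq ?_)
  rw [neg_one_mul]

lemma threshold_eq_ofReal (ε : ℝ) {σ : ℝ} (hσ : 0 < σ) :
    threshold ε σ = ENNReal.ofReal (2 * ε / σ) := (ENNReal.ofReal_div_of_pos hσ).symm

/-- Rounding `k / ε` up costs at most `2ε ≤ 1`. -/
lemma two_mul_size_le {k : ℕ} {ε : ℝ} (hε : 0 < ε) (hε' : ε ≤ 1 / 2)
    (hr : r = ⌈(k : ℝ) / ε⌉₊) : 2 * ε * r ≤ 2 * k + 1 := by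
  have h := (Nat.ceil_lt_add_one (by positivity : 0 ≤ (k : ℝ) / ε)).le
  rw [← hr] at h
  have h2 : ε * ((k : ℝ) / ε + 1) = k + ε := by field_simp
  nlinarith

lemma space_expectation {k : ℕ} (hk : 3 ≤ k) {ε : ℝ} (hε : 0 < ε) (hε' : ε ≤ 1 / 2)
    {a : Measure ℝ} (ha : FiniteTails a) (hR : IsRandomness P D U) (hD : ∀ j, 0 < (D j).val)
    (hr : r = ⌈(k : ℝ) / ε⌉₊) {p : Plan m} (hp : p.elements.Nodup) :
    Integrable (fun ω => ((p.run k ε a D fun d => U d ω).space : ℝ)) P ∧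
      ∫ ω, ((p.run k ε a D fun d => U d ω).space : ℝ) ∂P ≤ 40 * k := by
  have hk' : (3 : ℝ) ≤ k := by exact_mod_cast hk
  have hspec := fun ω => Plan.runSpec_run (by omega : 1 ≤ k) hε a hD (fun d => U d ω) p
  set J := p.elements.toFinset with hJ
  set γ := threshold ε (p.total D) with hγ
  have hle : ∀ ω, ((p.run k ε a D fun d => U d ω).space : ℝ) ≤
      3 * (∑ z ∈ outputKeys D r, pendingIndicator D U J γ z ω) + (4 * k + 2) := fun ω => by
    rw [← pendingCount_eq_sum, ← add_assoc]
    exact_mod_cast Plan.space_le (hspec ω)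
  have hmeas : Measurable fun ω => ((p.run k ε a D fun d => U d ω).space : ℝ) :=
    measurable_from_nat.comp (Plan.measurable_space hR hD (by omega) hε ha p)
  have hXi : ∀ z, Integrable (pendingIndicator D U J γ z) P := fun z =>
    Integrable.of_mem_Icc 0 1 (measurable_pendingIndicator hR J γ z).aemeasurable
      (ae_of_all _ (pendingIndicator_mem_Icc J γ z))
  have hbi : Integrable (fun ω => 3 * (∑ z ∈ outputKeys D r, pendingIndicator D U J γ z ω) +
      (4 * (k : ℝ) + 2)) P :=
    ((integrable_finsetSum _ fun z _ => hXi z).const_mul 3).add (integrable_const _)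
  have hint : Integrable (fun ω => ((p.run k ε a D fun d => U d ω).space : ℝ)) P := by
    refine hbi.mono' hmeas.aestronglyMeasurable (ae_of_all _ fun ω => ?_)
    rw [Real.norm_of_nonneg (Nat.cast_nonneg _)]
    exact hle ω
  refine ⟨hint, ?_⟩
  have hmean : ∑ z ∈ outputKeys D r, ∫ ω, pendingIndicator D U J γ z ω ∂P ≤ 2 * k + 1 := by
    refine le_trans ?_ (two_mul_size_le hε hε' hr)
    have htot : p.total D = ∑ j ∈ J, (D j).val := Plan.total_eq_sum hp
    -- Without elements the threshold is `∞` and has no real form, but then nothing is pending.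
    rcases (Plan.total_nonneg hD p).eq_or_lt with h0 | h0
    · have hJ0 : J = ∅ := by
        by_contra hne
        have := Finset.sum_pos (fun j _ => hD j) (Finset.nonempty_iff_ne_empty.2 hne)
        linarith
      have : ∀ z ω, pendingIndicator D U J γ z ω = 0 := fun z ω => by
        simp [pendingIndicator, hJ0, minOutputOn]
      simp only [this, integral_zero, Finset.sum_const_zero]
      positivity
    · rw [hγ, threshold_eq_ofReal ε h0]
      refine (sum_integral_pendingIndicator_le hR hD J (by positivity)).trans (le_of_eq ?_)
      rw [← htot]
      field_simp
  have h1 := integral_mono hint hbi hle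
  rw [integral_add ((integrable_finsetSum _ fun z _ => hXi z).const_mul 3) (integrable_const _),
    integral_const_mul, integral_finsetSum _ fun z _ => hXi z] at h1
  simp only [integral_const, probReal_univ, one_smul] at h1
  linarith

/-! ### Space along a stream -/

/-- The first `n` elements of the stream. -/
def firstElements (m n : ℕ) : Finset (Fin m) := Finset.univ.filter fun j => (j : ℕ) < n

lemma elements_stream (m n : ℕ) : (Plan.stream m n).elements = (List.finRange m).take n := by
  have : ∀ (l : List (Fin m)) (p : Plan m), (l.foldl Plan.process p).elements = p.elements ++ l := by
    intro l
    induction l with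
    | nil => simp
    | cons j l ih => intro p; rw [List.foldl_cons, ih]; simp [Plan.elements]
  rw [Plan.stream, this]
  rfl

lemma toFinset_elements_stream (m n : ℕ) :
    (Plan.stream m n).elements.toFinset = firstElements m n := by
  ext j
  simp only [elements_stream, firstElements, List.mem_toFinset, Finset.mem_filter,
    Finset.mem_univ, true_and, List.mem_take_iff_getElem, List.getElem_finRange]
  constructor
  · rintro ⟨i, hi, rfl⟩
    simp at hi ⊢
    omega
  · intro h
    exact ⟨j, by simp [h], by simp⟩

lemma total_stream (D : Fin m → Element 𝒳) (n : ℕ) :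
    (Plan.stream m n).total D = ∑ j ∈ firstElements m n, (D j).val := by
  rw [Plan.total_eq_sum, toFinset_elements_stream]
  rw [elements_stream]
  exact (List.nodup_finRange m).sublist (List.take_sublist _ _)

lemma firstElements_mono (m : ℕ) {n n' : ℕ} (h : n ≤ n') :
    firstElements m n ⊆ firstElements m n' := fun j hj => by
  simp only [firstElements, Finset.mem_filter, Finset.mem_univ, true_and] at hj ⊢
  omega

/-- A union bound over groups of times. Every count in group `g` is dominated by the one count for
the larger set `J g` with the larger threshold `2ε / σ g`. As `J g` has sum at most `2 σ g`, the
mean of that count is at most `4εr ≤ 4k + 2`. -/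
lemma stream_space_tail {κ : Type*} {k : ℕ} (hk : 3 ≤ k) {ε : ℝ} (hε : 0 < ε) (hε' : ε ≤ 1 / 2)
    (a : Measure ℝ) (hR : IsRandomness P D U) (hD : ∀ j, 0 < (D j).val)
    (hr : r = ⌈(k : ℝ) / ε⌉₊) {δ : ℝ} (hδ : 0 < δ) (hδ' : δ < 1) (G : Finset κ)
    (hG : G.Nonempty) (J : κ → Finset (Fin m)) (σ : κ → ℝ) (hσ : ∀ g ∈ G, 0 < σ g)
    (hJ : ∀ g ∈ G, ∑ j ∈ J g, (D j).val ≤ 2 * σ g)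
    (hcover : ∀ n, 1 ≤ n → n ≤ m → ∃ g ∈ G, firstElements m n ⊆ J g ∧
      σ g ≤ ∑ j ∈ firstElements m n, (D j).val) {L : ℝ} (hL0 : 0 ≤ L)
    (hL : Real.log G.card ≤ L + 1) :
    P {ω | ∃ n ≤ m, 40 * (k + L + Real.log (1 / δ)) <
      (((Plan.stream m n).run k ε a D fun d => U d ω).space : ℝ)} ≤ ENNReal.ofReal δ := by
  have hk' : (3 : ℝ) ≤ k := by exact_mod_cast hk
  have hcard : (0 : ℝ) < G.card := by exact_mod_cast hG.card_pos
  have hlogδ : 0 ≤ Real.log (1 / δ) := Real.log_nonneg (by rw [le_div_iff₀ hδ]; linarith)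
  set μ : ℝ := 4 * k + 2 with hμ
  -- Chosen so that the Chernoff bound with parameter 1 is exactly `δ / |G|` for each group.
  set b : ℝ := μ * (Real.exp 1 - 1) + Real.log G.card + Real.log (1 / δ) with hb
  have hlogc : 0 ≤ Real.log G.card := Real.log_nonneg (by exact_mod_cast hG.card_pos)
  have he : Real.exp 1 - 1 ≤ 2 := by linarith [Real.exp_one_lt_d9]
  have he0 : 0 < Real.exp 1 - 1 := by linarith [Real.exp_one_gt_d9]
  have hb0 : 0 < b := by
    have : 0 < μ * (Real.exp 1 - 1) := mul_pos (by linarith) he0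
    linarith
  have hbC : 3 * b + 4 * k + 2 ≤ 40 * (k + L + Real.log (1 / δ)) := by
    have : μ * (Real.exp 1 - 1) ≤ μ * 2 := mul_le_mul_of_nonneg_left he (by linarith)
    linarith
  have hsub : {ω | ∃ n ≤ m, 40 * (k + L + Real.log (1 / δ)) <
      (((Plan.stream m n).run k ε a D fun d => U d ω).space : ℝ)} ⊆
      ⋃ g ∈ G, {ω | b ≤ (pendingCount D (fun d => U d ω) (J g)
        (ENNReal.ofReal (2 * ε / σ g)) : ℝ)} := by
    rintro ω ⟨n, hn, hlt⟩
    have h1 := Plan.space_le (Plan.runSpec_run (by omega : 1 ≤ k) hε a hD (fun d => U d ω)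
      (Plan.stream m n))
    rw [toFinset_elements_stream, total_stream] at h1
    set N := pendingCount D (fun d => U d ω) (firstElements m n)
      (threshold ε (∑ j ∈ firstElements m n, (D j).val)) with hN
    have h2 : (((Plan.stream m n).run k ε a D fun d => U d ω).space : ℝ) ≤ 3 * N + 4 * k + 2 := by
      exact_mod_cast h1
    have hbN : b < N := by linarith
    have hn1 : 1 ≤ n := by
      rcases Nat.eq_zero_or_pos n with rfl | h
      · have : firstElements m 0 = ∅ := by simp [firstElements]
        rw [hN, this, pendingCount_empty] at hbN
        simp at hbN
        linarith
      · exact h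
    obtain ⟨g, hg, hsubs, hσg⟩ := hcover n hn1 hn
    refine Set.mem_iUnion₂.2 ⟨g, hg, hbN.le.trans ?_⟩
    rw [← threshold_eq_ofReal ε (hσ g hg)]
    exact_mod_cast pendingCount_mono _ hsubs (threshold_anti ε hσg)
  refine (measure_mono hsub).trans ((measure_biUnion_finset_le _ _).trans ?_)
  have hmean : ∀ g ∈ G, r * ((∑ j ∈ J g, (D j).val) * (2 * ε / σ g)) ≤ μ := fun g hg => by
    have h1 := two_mul_size_le hε hε' hr
    have h2 : (∑ j ∈ J g, (D j).val) * (2 * ε / σ g) ≤ 2 * σ g * (2 * ε / σ g) :=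
      mul_le_mul_of_nonneg_right (hJ g hg) (by have := hσ g hg; positivity)
    have h3 : 2 * σ g * (2 * ε / σ g) = 4 * ε := by
      have := (hσ g hg).ne'
      field_simp
      ring
    have h4 : (0 : ℝ) ≤ r := Nat.cast_nonneg r
    nlinarith
  refine (Finset.sum_le_sum fun g hg => measure_le_pendingCount_le hR hD (J g)
    (by have := hσ g hg; positivity) (hmean g hg) b).trans ?_
  rw [Finset.sum_const, nsmul_eq_mul, ← ENNReal.ofReal_natCast, ← ENNReal.ofReal_mul hcard.le]
  refine ENNReal.ofReal_le_ofReal (le_of_eq ?_)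
  have h5 : -b + μ * (Real.exp 1 - 1) = Real.log δ - Real.log G.card := by
    rw [hb, one_div, Real.log_inv]; ring
  rw [h5, Real.exp_sub, Real.exp_log hδ, Real.exp_log hcard]
  field_simp

lemma minVal_le (D : Fin m → Element 𝒳) (j : Fin m) : minVal D ≤ (D j).val :=
  ciInf_le (Set.finite_range _).bddBelow j

lemma minVal_pos (hD : ∀ j, 0 < (D j).val) (hm : 1 ≤ m) : 0 < minVal D := by
  have : Nonempty (Fin m) := ⟨⟨0, hm⟩⟩
  obtain ⟨j, hj⟩ := exists_eq_ciInf_of_finite (f := fun j => (D j).val)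
  rw [minVal, ← hj]
  exact hD j

lemma minVal_le_sum (hD : ∀ j, 0 < (D j).val) (hm : 1 ≤ m) {n : ℕ} (hn : 1 ≤ n) :
    minVal D ≤ ∑ j ∈ firstElements m n, (D j).val :=
  (minVal_le D ⟨0, hm⟩).trans (Finset.single_le_sum (f := fun j => (D j).val)
    (fun j _ => (hD j).le) (by simp [firstElements]; omega))

/-- The binary logarithm of `Q` plus 1 is at most `(1 / log 2 + 1) * max 1 (log Q)`, and `1 / log 2
+ 1 < e`. -/
lemma log_card_le {Q : ℝ} (hQ : 1 ≤ Q) :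
    Real.log ((Nat.log 2 ⌊Q⌋₊ + 1 : ℕ) : ℝ) ≤ Real.log (max 1 (Real.log Q)) + 1 := by
  have hfl : ⌊Q⌋₊ ≠ 0 := (Nat.floor_pos.2 hQ).ne'
  have h1 : (2 : ℝ) ^ Nat.log 2 ⌊Q⌋₊ ≤ Q :=
    le_trans (by exact_mod_cast Nat.pow_log_le_self 2 hfl) (Nat.floor_le (by linarith))
  have h2 : (Nat.log 2 ⌊Q⌋₊ : ℝ) * Real.log 2 ≤ Real.log Q := by
    rw [← Real.log_pow]
    exact Real.log_le_log (by positivity) h1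
  have h3 := Real.log_two_gt_d9
  have h4 := Real.exp_one_gt_d9
  have hmax : (1 : ℝ) ≤ max 1 (Real.log Q) := le_max_left _ _
  have hmax' : Real.log Q ≤ max 1 (Real.log Q) := le_max_right _ _
  have h5 : ((Nat.log 2 ⌊Q⌋₊ + 1 : ℕ) : ℝ) ≤ max 1 (Real.log Q) * Real.exp 1 := by
    push_cast
    have h0 : (0 : ℝ) ≤ Nat.log 2 ⌊Q⌋₊ := Nat.cast_nonneg _
    nlinarith
  calc _ ≤ Real.log (max 1 (Real.log Q) * Real.exp 1) := Real.log_le_log (by positivity) h5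
    _ = _ := by rw [Real.log_mul (by positivity) (Real.exp_pos 1).ne', Real.log_exp]

/-- The two terms of the minimum come from two groupings: each time alone, or times with the same
scale of the running sum, where a scale is a doubling in units of `minVal D`. The number of groups
enters through its logarithm. -/
lemma stream_space {k : ℕ} (hk : 3 ≤ k) {ε : ℝ} (hε : 0 < ε) (hε' : ε ≤ 1 / 2)
    (a : Measure ℝ) (hR : IsRandomness P D U) (hD : ∀ j, 0 < (D j).val)
    (hr : r = ⌈(k : ℝ) / ε⌉₊) (hm : 1 ≤ m) {δ : ℝ} (hδ : 0 < δ) (hδ' : δ < 1) :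
    P {ω | ∃ n ≤ m, 40 * (k + min (Real.log m)
      (Real.log (max 1 (Real.log (sumVal D / minVal D)))) + Real.log (1 / δ)) <
      (((Plan.stream m n).run k ε a D fun d => U d ω).space : ℝ)} ≤ ENNReal.ofReal δ := by
  have hmin := minVal_pos hD hm
  have hpos : ∀ n, 1 ≤ n → 0 < ∑ j ∈ firstElements m n, (D j).val := fun n hn =>
    hmin.trans_le (minVal_le_sum hD hm hn)
  rcases le_total (Real.log m) (Real.log (max 1 (Real.log (sumVal D / minVal D)))) with h | h
  · rw [min_eq_left h]
    refine stream_space_tail hk hε hε' a hR hD hr hδ hδ' (Finset.Icc 1 m) ⟨1, by simp [hm]⟩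
      (firstElements m) (fun n => ∑ j ∈ firstElements m n, (D j).val)
      (fun n hn => hpos n (Finset.mem_Icc.1 hn).1)
      (fun n hn => by have := hpos n (Finset.mem_Icc.1 hn).1; linarith)
      (fun n h1 h2 => ⟨n, Finset.mem_Icc.2 ⟨h1, h2⟩, subset_rfl, le_rfl⟩)
      (Real.log_nonneg (by exact_mod_cast hm)) ?_
    rw [Nat.card_Icc, Nat.add_sub_cancel]
    linarith
  · rw [min_eq_right h]
    have hsum : ∀ n, ∑ j ∈ firstElements m n, (D j).val ≤ sumVal D := fun n =>
      Finset.sum_le_sum_of_subset_of_nonneg (Finset.subset_univ _) fun j _ _ => (hD j).le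
    have hQ : 1 ≤ sumVal D / minVal D := by
      rw [le_div_iff₀ hmin, one_mul]
      exact (minVal_le_sum hD hm le_rfl).trans (hsum 1)
    classical
    -- Scale `i` collects the times with running sum in `[2^i, 2^(i+1))` times `minVal D`; the
    -- prefix up to the last time below the upper end contains all their prefixes.
    set last : ℕ → ℕ := fun i => Nat.findGreatest
      (fun n => ∑ j ∈ firstElements m n, (D j).val < 2 ^ (i + 1) * minVal D) m with hlast
    have hlast_lt : ∀ i, ∑ j ∈ firstElements m (last i), (D j).val < 2 ^ (i + 1) * minVal D :=
      fun i => Nat.findGreatest_spec (m := 0)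
        (P := fun n => ∑ j ∈ firstElements m n, (D j).val < 2 ^ (i + 1) * minVal D)
        (Nat.zero_le m) (by simp [firstElements]; positivity)
    refine stream_space_tail hk hε hε' a hR hD hr hδ hδ'
      (Finset.range (Nat.log 2 ⌊sumVal D / minVal D⌋₊ + 1)) ⟨0, by simp⟩
      (fun i => firstElements m (last i)) (fun i => 2 ^ i * minVal D)
      (fun i _ => by positivity) (fun i _ => ?_) (fun n h1 h2 => ?_)
      (Real.log_nonneg (le_max_left _ _)) ?_
    · have := hlast_lt i
      rw [pow_succ] at this
      linarith
    · set q := (∑ j ∈ firstElements m n, (D j).val) / minVal D with hq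
      have hq1 : 1 ≤ q := by
        rw [hq, le_div_iff₀ hmin, one_mul]; exact minVal_le_sum hD hm h1
      have hfl : ⌊q⌋₊ ≠ 0 := (Nat.floor_pos.2 hq1).ne'
      have hlow : (2 : ℝ) ^ Nat.log 2 ⌊q⌋₊ ≤ q :=
        le_trans (by exact_mod_cast Nat.pow_log_le_self 2 hfl) (Nat.floor_le (by linarith))
      have hup : q < 2 ^ (Nat.log 2 ⌊q⌋₊ + 1) := by
        refine (Nat.lt_floor_add_one q).trans_le ?_
        exact_mod_cast Nat.lt_pow_succ_log_self (by norm_num : 1 < 2) ⌊q⌋₊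
      refine ⟨Nat.log 2 ⌊q⌋₊, ?_, ?_, ?_⟩
      · rw [Finset.mem_range, Nat.lt_succ_iff]
        refine Nat.log_mono_right (Nat.floor_le_floor ?_)
        exact div_le_div_of_nonneg_right (hsum n) hmin.le
      · refine firstElements_mono m (Nat.le_findGreatest h2 ?_)
        rwa [← div_lt_iff₀ hmin]
      · rwa [← le_div_iff₀ hmin]
    · rw [Finset.card_range]
      exact log_card_le hQ

end Model

end ConcaveSketch
end
theorem mainTheorem1 :
    ∃ C : ℝ, 0 < C ∧
      ∀ {𝒳 : Type*} [DecidableEq 𝒳] {Ω : Type*} [MeasurableSpace Ω] (P : Measure Ω)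
        [IsProbabilityMeasure P] (k r m : ℕ) (ε : ℝ) (a : Measure ℝ) (f : ℝ → ℝ)
        (D : Fin m → Element 𝒳) (U : Draw 𝒳 m r → Ω → ℝ),
        3 ≤ k → 0 < ε → ε ≤ 1 / 2 → r = ⌈(k : ℝ) / ε⌉₊ →
        IsSoftConcaveSublinear a f → (∀ j, 0 < (D j).val) → IsRandomness P D U →
        -- every computation that processes each data element exactly once
        (∀ p : Plan m, p.elements.Nodup → (∀ j, j ∈ p.elements) →
          -- stochastic PPSWOR sample of size `k - 1`
          IsStochasticPPSWOR P (fun x ω => weight ε a D (fun d => U d ω) x)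
            (fun x ω => seed ε a D (fun d => U d ω) x) ∧
          (∀ᵐ ω ∂P,
            IsBottomK k (seed ε a D fun d => U d ω) (p.sample k ε a D fun d => U d ω) ∧
            IsBottomK (k - 1) (seed ε a D fun d => U d ω)
              ((p.sample k ε a D fun d => U d ω).trim (k - 1))) ∧
          -- expected weights
          (∀ x, Integrable (fun ω => weight ε a D (fun d => U d ω) x) P ∧
            f (freq D x) ≤ ∫ ω, weight ε a D (fun d => U d ω) x ∂P ∧
            ∫ ω, weight ε a D (fun d => U d ω) x ∂P ≤ 1 / (1 - ε) * f (freq D x)) ∧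
          -- the per-key estimators
          (∀ x, MemLp (p.estimator P k ε a f D U x) 2 P ∧
            ∫ ω, p.estimator P k ε a f D U x ω ∂P = f (freq D x) ∧
            variance (p.estimator P k ε a f D U x) P ≤
              4 * f (freq D x) * (∑ z ∈ activeKeys D, f (freq D z)) /
                ((1 - ε) ^ 2 * ((k : ℝ) - 2)))) ∧
        -- expected space of every sketch computed from elements of the data
        (∀ p : Plan m, p.elements.Nodup →
          Integrable (fun ω => ((p.run k ε a D fun d => U d ω).space : ℝ)) P ∧
          ∫ ω, ((p.run k ε a D fun d => U d ω).space : ℝ) ∂P ≤ C * k) ∧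
        -- space at all times while the data is streamed
        (1 ≤ m → ∀ δ : ℝ, 0 < δ → δ < 1 →
          P {ω | ∃ n ≤ m,
            C * (k + min (Real.log m) (Real.log (max 1 (Real.log (sumVal D / minVal D)))) +
              Real.log (1 / δ)) < (((Plan.stream m n).run k ε a D fun d => U d ω).space : ℝ)}
            ≤ ENNReal.ofReal δ) := by

  -- The proofs give `10k + 5` for the expectation and `28k + 17 + 3L + 3 log (1/δ)` for the stream,
  -- with `L` the minimum of the two logarithmic terms; 40 covers both since `k ≥ 3`.
  refine ⟨40, by norm_num, ?_⟩
  intro 𝒳 _ Ω _ P _ k r m ε a f D U hk hε hε' hr hf hD hR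
  have ha := hf.finiteTails
  have hr0 : 0 < r := by
    rw [hr, Nat.ceil_pos]
    have : (0 : ℝ) < k := by exact_mod_cast (by omega : 0 < k)
    positivity
  refine ⟨fun p hp hp' => ⟨isStochasticPPSWOR_seed hR hD hε ha hr0, ?_,
    fun x => ⟨integrable_weight hR hε ha x, le_integral_weight hR hD hε hε' hf hr0 x⟩,
    fun x => estimator_moments hk hε hε' hf hR hD hr hp hp' x⟩,
    fun p hp => space_expectation hk hε hε' ha hR hD hr hp,
    fun hm δ hδ hδ' => stream_space hk hε hε' a hR hD hr hm hδ hδ'⟩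
  filter_upwards [ae_seed_injective hR hD hε ha hr0] with ω hω
  have hs := Plan.represents_sample (by omega : 1 ≤ k) hε ha hD (fun d => U d ω) hr0 hp hp'
  exact ⟨hs.isBottomK hω, (hs.trim (Nat.sub_le k 1)).isBottomK hω⟩
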